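/- Conventions. For a finitely generated nilpotent group $\Gamma$, let $d(\Gamma)\in\mathbb N$ be its degree of polynomial growth: the unique $d$ such that $\gamma_\Gamma^S(n)\approx n^d$ for a finite symmetric generating set $S$, where $\gamma_\Gamma^S(n)$ is the number of elements of $\Gamma$ that are products of at most $n$ elements of $S$, and $f\approx g$ means that there is a constant $C>0$ with $f(n)\le C\,g(Cn)$ and $g(n)\le C\,f(Cn)$ for all $n\ge 1$. A Mal'tsev completion of a finitely generated torsion-free nilpotent group $\Gamma$ is a connected, simply connected nilpotent real Lie group $\widehat\Gamma$ (unique up to isomorphism) in which $\Gamma$ embeds as a discrete cocompact subgroup. Let $\mathfrak g$ be the Lie algebra of $\widehat\Gamma$, with lower central series $\mathfrak g_1=\mathfrak g$, $\mathfrak g_{i+1}=[\mathfrak g,\mathfrak g_i]$; the graded Lie algebra $\mathfrak g_\infty=\bigoplus_{i\ge 1}\mathfrak g_i/\mathfrak g_{i+1}$ carries the bracket induced by $\mathfrak g_i\times\mathfrak g_j\to\mathfrak g_{i+j}$. The Carnot completion $\Gamma_\infty$ is the connected, simply connected nilpotent Lie group obtained by exponentiating $\mathfrak g_\infty$. (For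 a nilpotent real Lie algebra $\mathfrak n$, this group is $\exp\mathfrak n$: the set $\mathfrak n$ with its usual topology and the Baker--Campbell--Hausdorff product.) Proposition. Let $\Gamma$ and $\Delta$ be finitely generated torsion-free nilpotent groups with $d(\Gamma)=d(\Delta)$. Let $\mathfrak g$ and $\mathfrak h$ be the Lie algebras of Mal'tsev completions of $\Gamma$ and $\Delta$, and let $\Gamma_\infty=\exp\mathfrak g_\infty$ and $\Delta_\infty=\exp\mathfrak h_\infty$ be the Carnot completions. Let $F:\Gamma_\infty\to\Delta_\infty$ be a surjective continuous homomorphism. Then $\Gamma_\infty\cong\Delta_\infty$ as Lie groups. More precisely, $F$ itself is an isomorphism of topological groups, and the induced map $dF:\mathfrak g_\infty\to\mathfrak h_\infty$, characterised by $F(\exp X)=\exp(dF(X))$ for all $X\in\mathfrak g_\infty$, is an isomorphism of Lie algebras. -/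

import Mathlib

namespace Dynkin

/-! ### The Dynkin form of the Baker–Campbell–Hausdorff product -/

/-- The right-nested bracket `[x₁, [x₂, … [xₙ₋₁, xₙ] … ]]` of a word `x₁ x₂ … xₙ`. -/
def lieWord {L : Type*} [LieRing L] : List L → L
  | [] => 0
  | [x] => x
  | x :: y :: l => ⁅x, lieWord (y :: l)⁆

/-- Sequences `(r₁, s₁), …, (rₖ, sₖ)` of pairs of exponents `≤ N` with `(rᵢ, sᵢ) ≠ (0, 0)`. -/
def index (N k : ℕ) : Finset (Fin k → ℕ × ℕ) :=
  Fintype.piFinset fun _ => (Finset.range (N + 1) ×ˢ Finset.range (N + 1)).erase (0, 0)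

/-- The word `x^{r₁} y^{s₁} x^{r₂} y^{s₂} … x^{rₖ} y^{sₖ}`. -/
def word {L : Type*} {k : ℕ} (p : Fin k → ℕ × ℕ) (x y : L) : List L :=
  (List.ofFn p).flatMap fun rs => List.replicate rs.1 x ++ List.replicate rs.2 y

/-- Dynkin's formula for `log (exp x exp y)`:
`∑ₖ (-1)^(k-1)/k ∑ [x^{r₁} y^{s₁} … x^{rₖ} y^{sₖ}] / ((∑ᵢ (rᵢ + sᵢ)) ∏ᵢ rᵢ! sᵢ!)`,
the inner sum over all `(rᵢ, sᵢ) ≠ (0, 0)`. Only the terms with `k, rᵢ, sᵢ ≤ N` are written; in a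
Lie algebra of nilpotency step at most `N` all the others vanish (words longer than `N`). -/
noncomputable def bch {L : Type*} [LieRing L] [LieAlgebra ℝ L] (N : ℕ) (x y : L) : L :=
  ∑ k ∈ Finset.Icc 1 N, ∑ p ∈ index N k,
    ((-1 : ℝ) ^ (k - 1) / k / ((∑ i, ((p i).1 + (p i).2) : ℕ) *
      (∏ i, ((p i).1.factorial * (p i).2.factorial) : ℕ))) • lieWord (word p x y)

/-! ### Proof that the product is a group law on a nilpotent Lie algebra -/

section GroupLaw
open Polynomial

/-- truncated exponential series -/
noncomputable def expT {A : Type*} [Ring A] [Algebra ℝ A] (N : ℕ) (x : A) : A :=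
  ∑ j ∈ Finset.range (N + 1), ((j.factorial : ℝ)⁻¹) • x ^ j

/-- truncated series of `log (1 + x)` -/
noncomputable def logT {A : Type*} [Ring A] [Algebra ℝ A] (N : ℕ) (x : A) : A :=
  ∑ k ∈ Finset.Icc 1 N, ((-1 : ℝ) ^ (k - 1) / k) • x ^ k

section Series
variable {A B : Type*} [Ring A] [Algebra ℝ A] [Ring B] [Algebra ℝ B]

theorem map_expT (f : A →ₐ[ℝ] B) (N : ℕ) (x : A) : f (expT N x) = expT N (f x) := by
  simp [expT, map_sum]

theorem map_logT (f : A →ₐ[ℝ] B) (N : ℕ) (x : A) : f (logT N x) = logT N (f x) := by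
  simp [logT, map_sum]

theorem dvd_of_derivative {f : ℝ[X]} {N : ℕ} (h0 : f.coeff 0 = 0)
    (h : X ^ N ∣ derivative f) : X ^ (N + 1) ∣ f := by
  rw [X_pow_dvd_iff] at h ⊢
  intro d hd
  cases d with
  | zero => exact h0
  | succ d =>
    have := h d (by omega)
    rw [coeff_derivative] at this
    have h2 : ((d : ℝ) + 1) ≠ 0 := by positivity
    exact (mul_eq_zero.mp this).resolve_right h2

theorem derivative_expT (N : ℕ) :
    derivative (expT N (X : ℝ[X])) = expT N X - ((N.factorial : ℝ)⁻¹) • X ^ N := by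
  have h1 : expT N (X : ℝ[X]) - ((N.factorial : ℝ)⁻¹) • X ^ N
      = ∑ j ∈ Finset.range N, ((j.factorial : ℝ)⁻¹) • (X : ℝ[X]) ^ j := by
    rw [expT, Finset.sum_range_succ, add_sub_cancel_right]
  rw [h1, expT, derivative_sum, Finset.sum_range_succ']
  simp only [derivative_smul, derivative_X_pow]
  simp only [Nat.cast_zero, map_zero, zero_mul, smul_zero, add_zero]
  refine Finset.sum_congr rfl fun j _ => ?_
  rw [Nat.factorial_succ, Nat.add_sub_cancel, ← smul_eq_C_mul, smul_smul]
  congr 1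
  have : (j.factorial : ℝ) ≠ 0 := by positivity
  push_cast
  field_simp

theorem derivative_logT (N : ℕ) :
    derivative (logT N (X : ℝ[X])) * (1 + X) = 1 - (-X) ^ N := by
  have : derivative (logT N (X : ℝ[X])) = ∑ k ∈ Finset.range N, (-X : ℝ[X]) ^ k := by
    induction N with
    | zero => simp [logT]
    | succ N ih =>
      have h : logT (N + 1) (X : ℝ[X])
          = logT N X + ((-1 : ℝ) ^ N / ((N + 1 : ℕ) : ℝ)) • X ^ (N + 1) := by
        rw [logT, logT, Finset.sum_Icc_succ_top (by omega), Nat.add_sub_cancel]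
      rw [h, derivative_add, ih, Finset.sum_range_succ, derivative_smul, derivative_X_pow,
        Nat.add_sub_cancel, ← smul_eq_C_mul, smul_smul, div_mul_cancel₀ _ (by positivity),
        smul_eq_C_mul]
      simp only [map_pow, map_neg, map_one]
      exact congrArg _ (neg_pow (X : ℝ[X]) N).symm
  rw [this]
  have := geom_sum_mul (-X : ℝ[X]) N
  linear_combination -this

theorem X_dvd_expT (N : ℕ) : X ∣ expT N (X : ℝ[X]) - 1 := by
  rw [expT, Finset.sum_range_succ']
  simp only [pow_zero, Nat.factorial_zero, Nat.cast_one, inv_one, one_smul, add_sub_cancel_right]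
  exact Finset.dvd_sum fun j _ => dvd_smul_of_dvd _ (dvd_pow_self X (Nat.succ_ne_zero j))

theorem X_dvd_logT (N : ℕ) : X ∣ logT N (X : ℝ[X]) := by
  refine Finset.dvd_sum fun k hk => dvd_smul_of_dvd _ (dvd_pow_self X ?_)
  simp at hk
  omega

theorem logT_expT_dvd (N : ℕ) :
    X ^ (N + 1) ∣ (logT N (X : ℝ[X])).comp (expT N X - 1) - X := by
  have hE0 := X_dvd_expT N
  have hL0 := X_dvd_logT N
  have h1 := congrArg (fun p => p.comp (expT N X - 1)) (derivative_logT N)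
  have h2 := derivative_expT N
  set E := expT N (X : ℝ[X])
  set L := logT N (X : ℝ[X])
  apply dvd_of_derivative
  · obtain ⟨q, hq⟩ := hE0
    obtain ⟨r, hr⟩ := hL0
    rw [hq, hr]
    simp [coeff_zero_eq_eval_zero]
  · simp only [mul_comp, add_comp, one_comp, X_comp, sub_comp, pow_comp, neg_comp] at h1
    rw [derivative_sub, derivative_comp, derivative_sub, derivative_one, derivative_X, sub_zero, h2]
    have : (E - ((N.factorial : ℝ)⁻¹) • X ^ N) * (derivative L).comp (E - 1) - 1
      = - (-(E - 1)) ^ N - X ^ N * (C ((N.factorial : ℝ)⁻¹) * (derivative L).comp (E - 1)) := by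
      rw [smul_eq_C_mul]
      linear_combination h1
    rw [this]
    refine dvd_sub ?_ (dvd_mul_right _ _)
    rw [dvd_neg]
    exact pow_dvd_pow_of_dvd ((dvd_neg).mpr hE0) N

theorem expT_logT_dvd (N : ℕ) :
    X ^ (N + 1) ∣ (expT N (X : ℝ[X])).comp (logT N X) - (1 + X) := by
  have hE0 := X_dvd_expT N
  have hL0 := X_dvd_logT N
  have h1 := derivative_logT N
  have h2 := congrArg (fun p => p.comp (logT N X)) (derivative_expT N)
  set E := expT N (X : ℝ[X])
  set L := logT N (X : ℝ[X])
  have hH0 : (E.comp L - (1 + X)).coeff 0 = 0 := by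
    obtain ⟨q, hq⟩ := hE0
    obtain ⟨r, hr⟩ := hL0
    rw [eq_add_of_sub_eq hq, hr]
    simp [coeff_zero_eq_eval_zero]
  have key : X ^ N ∣ (1 + X) * derivative (E.comp L - (1 + X)) - (E.comp L - (1 + X)) := by
    rw [derivative_sub, derivative_comp, derivative_add, derivative_one, derivative_X]
    simp only [sub_comp, smul_comp, pow_comp, X_comp] at h2
    rw [h2]
    have : (1 + X) * (derivative L * (E.comp L - ((N.factorial : ℝ)⁻¹) • L ^ N) - (0 + 1))
        - (E.comp L - (1 + X)) = - ((-X) ^ N * E.comp L)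
          - L ^ N * (C ((N.factorial : ℝ)⁻¹) * ((1 + X) * derivative L)) := by
      rw [smul_eq_C_mul]
      linear_combination (E.comp L) * h1
    rw [this]
    refine dvd_sub ?_ (Dvd.dvd.mul_right (pow_dvd_pow_of_dvd hL0 N) _)
    rw [dvd_neg]
    exact Dvd.dvd.mul_right (pow_dvd_pow_of_dvd ((dvd_neg).mpr dvd_rfl) N) _
  generalize E.comp L - (1 + X) = H at hH0 key
  rw [X_pow_dvd_iff] at key ⊢
  intro d
  induction d with
  | zero => intro _; exact hH0
  | succ d ih =>
    intro hd
    have h1 := key d (by omega)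
    have h2 := ih (by omega)
    have h4 : (X * derivative H).coeff d = 0 := by
      cases d with
      | zero => simp
      | succ e => rw [coeff_X_mul, coeff_derivative, h2, zero_mul]
    rw [coeff_sub, add_mul, one_mul, coeff_add, h4, h2, coeff_derivative, add_zero, sub_zero] at h1
    exact (mul_eq_zero.mp h1).resolve_right (by positivity)

theorem logT_expT {N : ℕ} {x : A} (hx : x ^ (N + 1) = 0) : logT N (expT N x - 1) = x := by
  obtain ⟨q, hq⟩ := logT_expT_dvd N
  have := congrArg (aeval x) hq
  simp only [map_sub, map_mul, map_pow, aeval_X, hx, zero_mul, aeval_comp, map_logT, map_expT,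
    map_one] at this
  exact sub_eq_zero.mp this

theorem expT_logT {N : ℕ} {x : A} (hx : x ^ (N + 1) = 0) : expT N (logT N x) = 1 + x := by
  obtain ⟨q, hq⟩ := expT_logT_dvd N
  have := congrArg (aeval x) hq
  simp only [map_sub, map_mul, map_pow, aeval_X, hx, zero_mul, aeval_comp, map_logT, map_expT,
    map_one, map_add] at this
  exact sub_eq_zero.mp this

theorem expT_add {N : ℕ} {x y : A} (h : Commute x y) (hx : x ^ (N + 1) = 0) (hy : y ^ (N + 1) = 0)
    (hxy : (x + y) ^ (N + 1) = 0) : expT N (x + y) = expT N x * expT N y := by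
  let _ : Module ℚ A := Module.compHom A (algebraMap ℚ ℝ)
  have e : ∀ z : A, z ^ (N + 1) = 0 → expT N z = IsNilpotent.exp z := by
    intro z hz
    rw [IsNilpotent.exp_eq_sum hz, expT]
    refine Finset.sum_congr rfl fun j _ => ?_
    change _ = (algebraMap ℚ ℝ ((j.factorial : ℚ)⁻¹)) • z ^ j
    simp
  rw [e _ hx, e _ hy, e _ hxy]
  exact IsNilpotent.exp_add_of_commute h ⟨_, hx⟩ ⟨_, hy⟩

end Series

section Words

theorem word_length {L : Type*} {k : ℕ} (p : Fin k → ℕ × ℕ) (x y : L) :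
    (word p x y).length = ∑ i, ((p i).1 + (p i).2) := by
  simp [word, List.length_flatMap, List.sum_ofFn, Function.comp_def]

theorem word_map {L L' : Type*} (f : L → L') {k : ℕ} (p : Fin k → ℕ × ℕ) (x y : L) :
    (word p x y).map f = word p (f x) (f y) := by
  simp [word, List.map_flatMap]

theorem mem_word {L : Type*} {k : ℕ} {p : Fin k → ℕ × ℕ} {x y z : L} (h : z ∈ word p x y) :
    z = x ∨ z = y := by
  simp only [word, List.mem_flatMap, List.mem_append, List.mem_replicate] at h
  tauto

theorem le_word_length {L : Type*} {N k : ℕ} {p : Fin k → ℕ × ℕ} (hp : p ∈ index N k) (x y : L) :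
    k ≤ (word p x y).length := by
  rw [word_length]
  have : ∑ _i : Fin k, 1 ≤ ∑ i, ((p i).1 + (p i).2) := by
    refine Finset.sum_le_sum fun i _ => ?_
    have := (Fintype.mem_piFinset.mp hp i)
    rw [Finset.mem_erase, ne_eq, Prod.ext_iff] at this
    simp only at this
    omega
  simpa using this

theorem map_lieWord {L L' : Type*} [LieRing L] [LieRing L'] (f : L → L') (h0 : f 0 = 0)
    (hf : ∀ x y, f ⁅x, y⁆ = ⁅f x, f y⁆) : ∀ l : List L, f (lieWord l) = lieWord (l.map f)
  | [] => h0
  | [_] => rfl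
  | x :: y :: l => by
    have := map_lieWord f h0 hf (y :: l)
    simp only [lieWord, List.map_cons] at this ⊢
    rw [hf, this]

theorem map_bch {L L' : Type*} [LieRing L] [LieRing L'] [LieAlgebra ℝ L] [LieAlgebra ℝ L']
    (f : L →ₗ⁅ℝ⁆ L') (N : ℕ) (x y : L) : f (bch N x y) = bch N (f x) (f y) := by
  simp only [bch, map_sum, map_smul]
  refine Finset.sum_congr rfl fun k _ => Finset.sum_congr rfl fun p _ => ?_
  rw [map_lieWord f f.map_zero f.map_lie, word_map]

theorem lieWord_mem {L : Type*} [LieRing L] [LieAlgebra ℝ L] : ∀ (l : List L) (k : ℕ),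
    k < l.length → lieWord l ∈ LieModule.lowerCentralSeries ℝ L L k
  | [], k, h => by simp at h
  | [x], k, h => by
    obtain rfl : k = 0 := by simpa using h
    simp
  | x :: y :: l, 0, h => by simp
  | x :: y :: l, k + 1, h => by
    rw [LieModule.lowerCentralSeries_succ]
    exact LieSubmodule.lie_mem_lie (LieSubmodule.mem_top _)
      (lieWord_mem (y :: l) k (by simpa using h))

theorem lieWord_eq_zero {L : Type*} [LieRing L] [LieAlgebra ℝ L] {c : ℕ}
    (hc : LieModule.lowerCentralSeries ℝ L L c = ⊥) (l : List L) (hl : c < l.length) :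
    lieWord l = 0 := by
  have := lieWord_mem l c hl
  rwa [hc] at this

theorem bch_zero {L : Type*} [LieRing L] [LieAlgebra ℝ L] (N : ℕ) : bch N (0 : L) 0 = 0 := by
  have := map_bch (0 : L →ₗ⁅ℝ⁆ L) N 0 0
  simpa using this.symm

theorem bch_eq {L : Type*} [LieRing L] [LieAlgebra ℝ L] {c : ℕ}
    (hc : LieModule.lowerCentralSeries ℝ L L c = ⊥) {N : ℕ} (hN : c ≤ N) (x y : L) :
    bch N x y = bch c x y := by
  have hz : ∀ k, ∀ p ∈ index N k, (c < k ∨ p ∉ index c k) → lieWord (word p x y) = 0 := by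
    intro k p hp h
    apply lieWord_eq_zero hc
    rcases h with h | h
    · exact lt_of_lt_of_le h (le_word_length hp x y)
    · rw [word_length]
      by_contra hcon
      apply h
      rw [index, Fintype.mem_piFinset] at hp ⊢
      intro i
      have h1 := hp i
      have h2 := Finset.single_le_sum (f := fun i => (p i).1 + (p i).2) (fun _ _ => Nat.zero_le _)
        (Finset.mem_univ i)
      simp only [Finset.mem_erase, Finset.mem_product, Finset.mem_range] at h1 ⊢
      exact ⟨h1.1, by omega, by omega⟩
  unfold bch
  symm
  refine Finset.sum_subset_zero_on_sdiff (Finset.Icc_subset_Icc_right hN) ?_ ?_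
  · intro k hk
    refine Finset.sum_eq_zero fun p hp => ?_
    rw [hz k p hp (Or.inl ?_), smul_zero]
    simp at hk
    omega
  · intro k _
    refine Finset.sum_subset ?_ ?_
    · refine Fintype.piFinset_subset _ _ fun _ => Finset.erase_subset_erase _ ?_
      exact Finset.product_subset_product (Finset.range_mono (by omega)) (Finset.range_mono (by omega))
    · intro p hp hp'
      rw [hz k p hp (Or.inr hp'), smul_zero]

end Words

section Expansion
variable {A : Type*} [Ring A] [Algebra ℝ A]

theorem sum_pow_eq {R α : Type*} [Ring R] (s : Finset α) (f : α → R) (k : ℕ) :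
    (∑ a ∈ s, f a) ^ k = ∑ p ∈ Fintype.piFinset fun _ : Fin k => s, (List.ofFn fun i => f (p i)).prod := by
  induction k with
  | zero => simp
  | succ k ih =>
    have h := Finset.filter_piFinset_eq_map_consEquiv (α := fun _ : Fin (k+1) => α) (fun _ => s) (fun _ => True)
    simp only [Finset.filter_true] at h
    rw [h, Finset.sum_map, Finset.sum_product, pow_succ', ih, Finset.sum_mul]
    refine Finset.sum_congr rfl fun a _ => ?_
    rw [Finset.mul_sum]
    refine Finset.sum_congr rfl fun p _ => ?_
    simp [List.ofFn_succ]

theorem expT_mul_expT (N : ℕ) (a b : A) :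
    expT N a * expT N b - 1 = ∑ rs ∈ (Finset.range (N + 1) ×ˢ Finset.range (N + 1)).erase (0, 0),
      ((rs.1.factorial * rs.2.factorial : ℕ) : ℝ)⁻¹ • (a ^ rs.1 * b ^ rs.2) := by
  have : ∑ rs ∈ (Finset.range (N + 1) ×ˢ Finset.range (N + 1)),
      ((rs.1.factorial * rs.2.factorial : ℕ) : ℝ)⁻¹ • (a ^ rs.1 * b ^ rs.2)
      = expT N a * expT N b := by
    rw [expT, expT, Finset.sum_mul_sum, Finset.sum_product]
    refine Finset.sum_congr rfl fun i _ => Finset.sum_congr rfl fun j _ => ?_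
    rw [smul_mul_smul_comm]
    push_cast
    rw [mul_inv]
  rw [← this, ← Finset.add_sum_erase _ _ (show ((0, 0) : ℕ × ℕ) ∈ _ by simp)]
  simp

theorem logT_mul (N : ℕ) (a b : A) :
    logT N (expT N a * expT N b - 1) = ∑ k ∈ Finset.Icc 1 N, ∑ p ∈ index N k,
      ((-1 : ℝ) ^ (k - 1) / k / (∏ i, ((p i).1.factorial * (p i).2.factorial) : ℕ)) •
        (word p a b).prod := by
  rw [logT]
  refine Finset.sum_congr rfl fun k _ => ?_
  rw [expT_mul_expT, sum_pow_eq, Finset.smul_sum]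
  refine Finset.sum_congr rfl fun p _ => ?_
  rw [div_eq_mul_inv _ ((∏ i, ((p i).1.factorial * (p i).2.factorial) : ℕ) : ℝ), mul_smul]
  congr 1
  clear * -
  induction k with
  | zero => simp [word]
  | succ k ih =>
    have := ih (fun i => p i.succ)
    simp only [word, List.ofFn_succ, List.prod_cons, List.flatMap_cons, List.prod_append,
      List.prod_replicate, Fin.prod_univ_succ] at this ⊢
    rw [this, smul_mul_smul_comm]
    push_cast
    simp only [mul_inv]

end Expansion

section Key
attribute [local instance 100] LieRing.ofAssociativeRing

variable {A : Type*} [Ring A] [Algebra ℝ A]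

theorem ad_eq (a : A) :
    LieAlgebra.ad ℝ A a = LinearMap.mulLeft ℝ a + LinearMap.mulRight ℝ (-a) := by
  ext x
  simp [Ring.lie_def, sub_eq_add_neg]

theorem expT_mulLeft (N : ℕ) (a : A) :
    expT N (LinearMap.mulLeft ℝ a) = LinearMap.mulLeft ℝ (expT N a) := by
  ext x
  simp [expT, LinearMap.pow_mulLeft, Finset.sum_mul]

theorem expT_mulRight (N : ℕ) (a : A) :
    expT N (LinearMap.mulRight ℝ a) = LinearMap.mulRight ℝ (expT N a) := by
  ext x
  simp [expT, LinearMap.pow_mulRight, Finset.mul_sum]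

theorem ad_pow {n N : ℕ} {a : A} (ha : a ^ (n + 1) = 0) (hN : 2 * n ≤ N) :
    (LieAlgebra.ad ℝ A a) ^ (N + 1) = 0 := by
  rw [ad_eq]
  refine (LinearMap.commute_mulLeft_right a (-a)).add_pow_eq_zero_of_add_le_succ_of_pow_eq_zero
    (m := n + 1) (n := n + 1) ?_ ?_ (by omega)
  · rw [LinearMap.pow_mulLeft, ha, LinearMap.mulLeft_zero_eq_zero]
  · rw [LinearMap.pow_mulRight, neg_pow, ha, mul_zero, LinearMap.mulRight_zero_eq_zero]

theorem expT_zero (N : ℕ) : expT N (0 : A) = 1 := by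
  rw [expT, Finset.sum_range_succ']
  simp

theorem expT_mul_neg {N : ℕ} {a : A} (ha : a ^ (N + 1) = 0) : expT N a * expT N (-a) = 1 := by
  rw [← expT_add (Commute.neg_right (Commute.refl a)) ha (by rw [neg_pow, ha, mul_zero]) (by simp),
    add_neg_cancel, expT_zero]

theorem expT_neg_mul {N : ℕ} {a : A} (ha : a ^ (N + 1) = 0) : expT N (-a) * expT N a = 1 := by
  have := expT_mul_neg (N := N) (a := -a) (by rw [neg_pow, ha, mul_zero])
  rwa [neg_neg] at this

theorem expT_ad {n N : ℕ} {a : A} (ha : a ^ (n + 1) = 0) (hN : 2 * n ≤ N) (x : A) :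
    expT N (LieAlgebra.ad ℝ A a) x = expT N a * x * expT N (-a) := by
  have ha' : a ^ (N + 1) = 0 := pow_eq_zero_of_le (by omega) ha
  have h := ad_pow ha hN
  rw [ad_eq] at h ⊢
  rw [expT_add (LinearMap.commute_mulLeft_right a (-a)) ?_ ?_ h, expT_mulLeft, expT_mulRight]
  · simp [mul_assoc]
  · rw [LinearMap.pow_mulLeft, ha', LinearMap.mulLeft_zero_eq_zero]
  · rw [LinearMap.pow_mulRight, neg_pow, ha', mul_zero, LinearMap.mulRight_zero_eq_zero]

theorem ad_log {n N : ℕ} {a b : A} (ha : a ^ (n + 1) = 0) (hb : b ^ (n + 1) = 0)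
    (hN : 2 * n ≤ N) (hP : (expT N a * expT N b - 1) ^ (n + 1) = 0)
    (hW : logT N (expT N a * expT N b - 1) ^ (n + 1) = 0) :
    LieAlgebra.ad ℝ A (logT N (expT N a * expT N b - 1)) =
      logT N (expT N (LieAlgebra.ad ℝ A a) * expT N (LieAlgebra.ad ℝ A b) - 1) := by
  have up : ∀ {x : A}, x ^ (n + 1) = 0 → x ^ (N + 1) = 0 := fun h => pow_eq_zero_of_le (by omega) h
  have hPW := expT_logT (up hP)
  set W := logT N (expT N a * expT N b - 1)
  have h1 : expT N W = expT N a * expT N b := by rw [hPW]; abel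
  have h2 : expT N (-W) = expT N (-b) * expT N (-a) := by
    have h3 : expT N W * (expT N (-b) * expT N (-a)) = 1 := by
      rw [h1, mul_assoc, ← mul_assoc (expT N b), expT_mul_neg (up hb), one_mul,
        expT_mul_neg (up ha)]
    calc expT N (-W) = expT N (-W) * (expT N W * (expT N (-b) * expT N (-a))) := by
          rw [h3, mul_one]
      _ = _ := by rw [← mul_assoc, expT_neg_mul (up hW), one_mul]
  have h4 : expT N (LieAlgebra.ad ℝ A a) * expT N (LieAlgebra.ad ℝ A b)
      = expT N (LieAlgebra.ad ℝ A W) := by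
    ext x
    rw [Module.End.mul_apply, expT_ad ha hN, expT_ad hb hN, expT_ad hW hN, h1, h2]
    simp only [mul_assoc]
  rw [h4, logT_expT (ad_pow hW hN)]

theorem ad_word_apply {D : A} : ∀ {l : List A}, l ≠ [] → (∀ x ∈ l, ⁅x, D⁆ = -x) →
    (l.map (LieAlgebra.ad ℝ A)).prod D = -lieWord l
  | [], h, _ => absurd rfl h
  | [x], _, h => by simpa [lieWord] using h x (by simp)
  | x :: y :: l, _, h => by
    have := ad_word_apply (l := y :: l) (by simp) (fun z hz => h z (by simp at hz ⊢; tauto))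
    rw [List.map_cons, List.prod_cons, Module.End.mul_apply, this, LieAlgebra.ad_apply, lie_neg]
    rfl

theorem lieWord_lie {D : A} : ∀ {l : List A}, (∀ x ∈ l, ⁅x, D⁆ = -x) →
    ⁅lieWord l, D⁆ = -((l.length : ℝ) • lieWord l)
  | [], _ => by simp [lieWord]
  | [x], h => by simpa [lieWord] using h x (by simp)
  | x :: y :: l, h => by
    have := lieWord_lie (l := y :: l) (fun z hz => h z (by simp at hz ⊢; tauto))
    rw [List.length_cons, lieWord, lie_lie, this, h x (by simp), lie_neg, lie_smul, lie_neg,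
      ← lie_skew x, Nat.cast_add]
    push_cast
    module

theorem lie_log_eq {n N : ℕ} {a b D : A} (ha : a ^ (n + 1) = 0) (hb : b ^ (n + 1) = 0)
    (hN : 2 * n ≤ N) (hP : (expT N a * expT N b - 1) ^ (n + 1) = 0)
    (hW : logT N (expT N a * expT N b - 1) ^ (n + 1) = 0)
    (haD : ⁅a, D⁆ = -a) (hbD : ⁅b, D⁆ = -b) :
    ⁅logT N (expT N a * expT N b - 1), D⁆ = ⁅bch N a b, D⁆ := by
  rw [← LieAlgebra.ad_apply (R := ℝ), ad_log ha hb hN hP hW, logT_mul, bch]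
  simp only [LinearMap.sum_apply, sum_lie, LinearMap.smul_apply, smul_lie]
  refine Finset.sum_congr rfl fun k hk => Finset.sum_congr rfl fun p hp => ?_
  have hlen := le_word_length hp a b
  have hmem : ∀ x ∈ word p a b, ⁅x, D⁆ = -x := by
    intro x hx
    rcases mem_word hx with rfl | rfl <;> assumption
  have hk1 : 1 ≤ k := by simp at hk; omega
  rw [← word_map, ad_word_apply (by rintro h; rw [h] at hlen; simp at hlen; omega) hmem,
    lieWord_lie hmem, ← word_length p a b, ← smul_neg, smul_smul]
  congr 1
  have : ((word p a b).length : ℝ) ≠ 0 := by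
    have : 0 < (word p a b).length := by omega
    positivity
  field_simp

variable {B : Type*} [Ring B] [Algebra ℝ B]

theorem sub_one_mem (S : NonUnitalSubalgebra ℝ A) (N : ℕ) {a b : A} (ha : a ∈ S) (hb : b ∈ S) :
    expT N a * expT N b - 1 ∈ S := by
  have pw : ∀ {x : A}, x ∈ S → ∀ j, x ^ (j + 1) ∈ S := by
    intro x hx j
    induction j with
    | zero => simpa using hx
    | succ j ih => rw [pow_succ]; exact S.mul_mem ih hx
  have h : ∀ {x : A}, x ∈ S → expT N x - 1 ∈ S := by
    intro x hx
    rw [expT, Finset.sum_range_succ']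
    simp only [pow_zero, Nat.factorial_zero, Nat.cast_one, inv_one, one_smul, add_sub_cancel_right]
    exact sum_mem fun j _ => S.smul_mem _ (pw hx j)
  have : expT N a * expT N b - 1 = (expT N a - 1) * (expT N b - 1) + (expT N a - 1)
      + (expT N b - 1) := by noncomm_ring
  rw [this]
  exact S.add_mem (S.add_mem (S.mul_mem (h ha) (h hb)) (h ha)) (h hb)

theorem logT_mem (S : NonUnitalSubalgebra ℝ A) (N : ℕ) {x : A} (hx : x ∈ S) : logT N x ∈ S := by
  refine sum_mem fun k hk => S.smul_mem _ ?_
  obtain ⟨j, rfl⟩ : ∃ j, k = j + 1 := ⟨k - 1, by simp at hk; omega⟩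
  clear hk
  induction j with
  | zero => simpa using hx
  | succ j ih => rw [pow_succ]; exact S.mul_mem ih hx

/-- polynomials with coefficients in `J` -/
def polySub (J : NonUnitalSubalgebra ℝ B) : NonUnitalSubalgebra ℝ B[X] where
  carrier := {f | ∀ n, f.coeff n ∈ J}
  add_mem' hf hg n := by rw [coeff_add]; exact J.add_mem (hf n) (hg n)
  zero_mem' n := by rw [coeff_zero]; exact J.zero_mem
  mul_mem' hf hg n := by rw [coeff_mul]; exact sum_mem fun ij _ => J.mul_mem (hf _) (hg _)
  smul_mem' c f hf n := by rw [coeff_smul]; exact J.smul_mem c (hf n)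

theorem polySub_pow {J : NonUnitalSubalgebra ℝ B} {K : ℕ → AddSubgroup B} {n : ℕ}
    (h1 : (1 : B) ∈ K 0) (hK : ∀ k x y, x ∈ K k → y ∈ J → x * y ∈ K (k + 1)) (hn : K (n + 1) = ⊥)
    {f : B[X]} (hf : f ∈ polySub J) : f ^ (n + 1) = 0 := by
  have : ∀ k d, (f ^ k).coeff d ∈ K k := by
    intro k
    induction k with
    | zero =>
      intro d
      rw [pow_zero, coeff_one]
      split_ifs
      · exact h1
      · exact zero_mem _
    | succ k ih =>
      intro d
      rw [pow_succ, coeff_mul]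
      exact sum_mem fun ij _ => hK _ _ _ (ih _) (hf _)
  ext d
  have h := this (n + 1) d
  rw [hn] at h
  simpa using h

/-- the Euler operator -/
noncomputable def euler (B : Type*) [Ring B] [Algebra ℝ B] : Module.End ℝ B[X] where
  toFun f := X * derivative f
  map_add' f g := by rw [derivative_add, mul_add]
  map_smul' c f := by rw [derivative_smul, mul_smul_comm]; rfl

theorem lie_euler (f : B[X]) :
    ⁅Algebra.lmul ℝ B[X] f, euler B⁆ = -Algebra.lmul ℝ B[X] (X * derivative f) := by
  refine LinearMap.ext fun g => ?_
  simp only [Ring.lie_def, LinearMap.sub_apply, Module.End.mul_apply, LinearMap.neg_apply, euler,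
    LinearMap.coe_mk, AddHom.coe_mk, Algebra.coe_lmul_eq_mul, LinearMap.mul_apply',
    derivative_mul, mul_add]
  rw [← mul_assoc f X, ← X_mul, mul_assoc, mul_assoc]
  abel

/-- evaluation at a real number -/
noncomputable def evalReal (s : ℝ) : B[X] →ₐ[ℝ] B :=
  eval₂AlgHom (AlgHom.id ℝ B) (algebraMap ℝ B s) (fun b => (Algebra.commutes s b).symm)

theorem expT_mul_expT_eq {J : NonUnitalSubalgebra ℝ B} {K : ℕ → AddSubgroup B} {n N : ℕ}
    (h1 : (1 : B) ∈ K 0) (hK : ∀ k x y, x ∈ K k → y ∈ J → x * y ∈ K (k + 1)) (hn : K (n + 1) = ⊥)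
    (hN : 2 * n ≤ N) {p q : B} (hp : p ∈ J) (hq : q ∈ J) :
    expT N p * expT N q = expT N (bch N p q) := by
  have hmem : ∀ {p : B}, p ∈ J → C p * X ∈ polySub J := by
    intro p hp d
    rw [coeff_C_mul, coeff_X]
    split_ifs
    · simpa using hp
    · simp
  set a : B[X] := C p * X with ha
  set b : B[X] := C q * X with hb
  have haJ : a ∈ polySub J := hmem hp
  have hbJ : b ∈ polySub J := hmem hq
  have hPJ := sub_one_mem (polySub J) N haJ hbJ
  have hWJ := logT_mem (polySub J) N hPJ
  have nil : ∀ {f : B[X]}, f ∈ polySub J → (Algebra.lmul ℝ B[X] f) ^ (n + 1) = 0 := by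
    intro f hf
    rw [← map_pow, polySub_pow h1 hK hn hf, map_zero]
  have heq : ∀ p : B, ⁅Algebra.lmul ℝ B[X] (C p * X), euler B⁆ = -Algebra.lmul ℝ B[X] (C p * X) := by
    intro p
    rw [lie_euler, derivative_C_mul, derivative_X, mul_one, X_mul]
  have hmap : expT N (Algebra.lmul ℝ B[X] a) * expT N (Algebra.lmul ℝ B[X] b) - 1
      = Algebra.lmul ℝ B[X] (expT N a * expT N b - 1) := by
    rw [map_sub, map_mul (Algebra.lmul ℝ B[X]) (expT N a), map_expT, map_expT, map_one]
  have key := lie_log_eq (n := n) (N := N) (nil haJ) (nil hbJ) hN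
    (by rw [hmap]; exact nil hPJ) (by rw [hmap, ← map_logT]; exact nil hWJ) (heq p) (heq q)
  have hbch : bch N (Algebra.lmul ℝ B[X] a) (Algebra.lmul ℝ B[X] b)
      = Algebra.lmul ℝ B[X] (bch N a b) := (map_bch (Algebra.lmul ℝ B[X]).toLieHom N a b).symm
  rw [hmap, ← map_logT, hbch, lie_euler, lie_euler, neg_inj] at key
  have key' := congrArg (fun f : Module.End ℝ B[X] => f 1) key
  simp only [Algebra.coe_lmul_eq_mul, LinearMap.mul_apply', mul_one] at key'
  have ev0 : ∀ f : B[X], evalReal 0 f = f.coeff 0 := by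
    intro f
    rw [coeff_zero_eq_eval_zero]
    change eval₂ _ _ f = eval₂ _ _ f
    rw [map_zero]
    rfl
  have hWz : logT N (expT N a * expT N b - 1) = bch N a b := by
    ext d
    cases d with
    | zero =>
      have h0 : ∀ p : B, evalReal 0 (C p * X) = 0 := by
        intro p; rw [ev0]; simp
      have h3 : evalReal 0 (bch N a b) = bch N (evalReal 0 a) (evalReal 0 b) :=
        map_bch (evalReal 0).toLieHom N a b
      rw [← ev0, ← ev0, h3, map_logT, map_sub, map_mul, map_expT, map_expT, map_one, h0, h0,
        bch_zero, expT_zero, mul_one, sub_self]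
      exact Finset.sum_eq_zero fun k hk => by
        rw [zero_pow (by simp at hk; omega), smul_zero]
    | succ d =>
      have h1 := congrArg (fun f => coeff f (d + 1)) key'
      simp only [coeff_X_mul, coeff_derivative] at h1
      have h2 : ((d : B) + 1) = algebraMap ℝ B ((d : ℝ) + 1) := by simp
      rw [h2, ← Algebra.commutes, ← Algebra.commutes, ← Algebra.smul_def, ← Algebra.smul_def] at h1
      exact smul_right_injective B (show ((d : ℝ) + 1) ≠ 0 by positivity) h1
  have hfin := expT_logT (N := N) (pow_eq_zero_of_le (show n + 1 ≤ N + 1 by omega)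
    (polySub_pow h1 hK hn hPJ))
  rw [hWz, add_sub_cancel] at hfin
  have ev1 : ∀ p : B, evalReal 1 (C p * X) = p := by
    intro p
    change eval₂ _ _ (C p * X) = p
    rw [eval₂_mul_X, eval₂_C]
    simp
  have h3 : evalReal 1 (bch N a b) = bch N (evalReal 1 a) (evalReal 1 b) :=
    map_bch (evalReal 1).toLieHom N a b
  have := congrArg (evalReal 1) hfin
  rw [map_mul, map_expT, map_expT, map_expT, h3, ev1, ev1] at this
  exact this.symm

end Key

section Affine
attribute [local instance 100] LieRing.ofAssociativeRing
variable {G : Type*} [LieRing G] [LieAlgebra ℝ G]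

/-- the affine representation defined by a derivation -/
def affineRep (D : G →ₗ[ℝ] G) (hD : ∀ u v, D ⁅u, v⁆ = ⁅D u, v⁆ + ⁅u, D v⁆) :
    G →ₗ⁅ℝ⁆ Module.End ℝ (G × ℝ) where
  toFun u :=
    { toFun m := (⁅u, m.1⁆ + m.2 • D u, 0)
      map_add' m m' := by
        refine Prod.ext ?_ (by simp)
        simp only [Prod.fst_add, Prod.snd_add, lie_add, add_smul]
        abel
      map_smul' c m := by
        refine Prod.ext ?_ (by simp)
        simp [mul_smul] }
  map_add' u u' := by
    refine LinearMap.ext fun m => Prod.ext ?_ (by simp)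
    simp only [LinearMap.coe_mk, AddHom.coe_mk, LinearMap.add_apply, Prod.fst_add, add_lie,
      map_add, smul_add]
    abel
  map_smul' c u := by
    refine LinearMap.ext fun m => Prod.ext ?_ (by simp)
    simp [smul_comm c m.2]
  map_lie' {u v} := by
    refine LinearMap.ext fun m => Prod.ext ?_ (by simp [Ring.lie_def])
    simp only [Ring.lie_def, LinearMap.sub_apply, Module.End.mul_apply, LinearMap.coe_mk,
      AddHom.coe_mk, hD, zero_smul, add_zero, lie_add, lie_smul, Prod.fst_sub, lie_lie, smul_add]
    rw [← lie_skew v (D u), smul_neg]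
    abel

theorem affineRep_apply (D : G →ₗ[ℝ] G) (hD) (u : G) (m : G × ℝ) :
    affineRep D hD u m = (⁅u, m.1⁆ + m.2 • D u, 0) := rfl

/-- filtration of `G × ℝ` -/
def filt (G : Type*) [LieRing G] [LieAlgebra ℝ G] : ℕ → Submodule ℝ (G × ℝ)
  | 0 => ⊤
  | k + 1 => (LieModule.lowerCentralSeries ℝ G G k).toSubmodule.prod ⊥

theorem filt_succ_le : ∀ k, filt G (k + 1) ≤ filt G k
  | 0 => le_top
  | k + 1 => by
    intro m hm
    refine ⟨?_, hm.2⟩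
    exact LieModule.antitone_lowerCentralSeries ℝ G G (Nat.le_succ k) hm.1

/-- operators raising the filtration -/
def raising (G : Type*) [LieRing G] [LieAlgebra ℝ G] :
    NonUnitalSubalgebra ℝ (Module.End ℝ (G × ℝ)) where
  carrier := {f | ∀ k, ∀ m ∈ filt G k, f m ∈ filt G (k + 1)}
  add_mem' hf hg k m hm := Submodule.add_mem _ (hf k m hm) (hg k m hm)
  zero_mem' _ _ _ := Submodule.zero_mem _
  mul_mem' hf hg k m hm := filt_succ_le _ (hf _ _ (hg k m hm))
  smul_mem' c _ hf k m hm := Submodule.smul_mem _ c (hf k m hm)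

theorem affineRep_mem (D : G →ₗ[ℝ] G) (hD) (u : G) : affineRep D hD u ∈ raising G := by
  intro k m hm
  cases k with
  | zero => exact ⟨by simp, rfl⟩
  | succ k =>
    have h2 : m.2 = 0 := hm.2
    refine ⟨?_, rfl⟩
    rw [affineRep_apply, h2, zero_smul, add_zero]
    change _ ∈ LieModule.lowerCentralSeries ℝ G G (k + 1)
    rw [LieModule.lowerCentralSeries_succ]
    exact LieSubmodule.lie_mem_lie (LieSubmodule.mem_top _) hm.1

/-- operators raising the filtration by `k` -/
def raisingBy (G : Type*) [LieRing G] [LieAlgebra ℝ G] (k : ℕ) :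
    AddSubgroup (Module.End ℝ (G × ℝ)) where
  carrier := {f | ∀ j, ∀ m ∈ filt G j, f m ∈ filt G (j + k)}
  add_mem' hf hg j m hm := Submodule.add_mem _ (hf j m hm) (hg j m hm)
  zero_mem' _ _ _ := Submodule.zero_mem _
  neg_mem' hf j m hm := Submodule.neg_mem _ (hf j m hm)

theorem one_mem_raisingBy : (1 : Module.End ℝ (G × ℝ)) ∈ raisingBy G 0 := fun _ _ hm => hm

theorem raisingBy_mul (k : ℕ) (f g : Module.End ℝ (G × ℝ)) (hf : f ∈ raisingBy G k)
    (hg : g ∈ raising G) : f * g ∈ raisingBy G (k + 1) := by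
  intro j m hm
  have := hf (j + 1) (g m) (hg j m hm)
  rwa [show j + 1 + k = j + (k + 1) by omega] at this

theorem raisingBy_eq_bot {n : ℕ} (hn : LieModule.lowerCentralSeries ℝ G G n = ⊥) :
    raisingBy G (n + 1) = ⊥ := by
  refine (AddSubgroup.eq_bot_iff_forall _).mpr fun f hf => LinearMap.ext fun m => ?_
  have h := hf 0 m trivial
  rw [zero_add, filt, hn] at h
  exact Prod.ext h.1 h.2

theorem exists_transfer (D : G →ₗ[ℝ] G) (hD : ∀ u v, D ⁅u, v⁆ = ⁅D u, v⁆ + ⁅u, D v⁆)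
    [LieRing.IsNilpotent G] :
    ∃ n₀ : ℕ, ∀ N, n₀ ≤ N → ∃ E : G → Module.End ℝ (G × ℝ),
      (∀ u v, E (bch N u v) = E u * E v) ∧ E 0 = 1 ∧ (∀ u, E u * E (-u) = 1) ∧
      (∀ u v, E u = E v → D u = D v) := by
  obtain ⟨n, hn⟩ : ∃ n, LieModule.lowerCentralSeries ℝ G G n = ⊥ :=
    LieModule.IsNilpotent.nilpotent ℝ G G
  refine ⟨2 * n, fun N hN => ⟨fun u => expT N (affineRep D hD u), ?_, ?_, ?_, ?_⟩⟩
  · intro u v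
    simp only
    rw [map_bch, expT_mul_expT_eq one_mem_raisingBy raisingBy_mul (raisingBy_eq_bot hn) hN (affineRep_mem D hD u) (affineRep_mem D hD v)]
  all_goals
    have nil : ∀ u : G, affineRep D hD u ^ (N + 1) = 0 := by
      intro u
      refine pow_eq_zero_of_le (show n + 1 ≤ N + 1 by omega) ?_
      have h : ∀ k, affineRep D hD u ^ k ∈ raisingBy G k := by
        intro k
        induction k with
        | zero => rw [pow_zero]; exact one_mem_raisingBy
        | succ k ih => rw [pow_succ]; exact raisingBy_mul k _ _ ih (affineRep_mem D hD u)
      have := h (n + 1)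
      rwa [raisingBy_eq_bot hn, AddSubgroup.mem_bot] at this
  · simp only [map_zero, expT_zero]
  · intro u
    simp only [map_neg]
    exact expT_mul_neg (nil u)
  · intro u v h
    simp only at h
    have h1 := logT_expT (nil u)
    rw [h, logT_expT (nil v)] at h1
    have h2 := congrArg (fun f => (f ((0 : G), (1 : ℝ))).1) h1
    simp only [affineRep_apply, lie_zero, zero_add, one_smul] at h2
    exact h2.symm

end Affine

section Assoc
open TensorProduct
variable {L : Type*} [LieRing L] [LieAlgebra ℝ L]

/-- polynomial curves in `L` -/
def Curve (L : Type*) [LieRing L] [LieAlgebra ℝ L] : Type _ := ℝ[X] ⊗[ℝ] L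

noncomputable instance : LieRing (Curve L) := LieAlgebra.ExtendScalars.instLieRing ℝ ℝ[X] L

noncomputable instance : LieAlgebra ℝ (Curve L) :=
  LieAlgebra.ExtendScalars.instBaseLieAlgebra ℝ ℝ[X] L

instance [LieRing.IsNilpotent L] : LieRing.IsNilpotent (Curve L) :=
  LieModule.instIsNilpotentTensor ℝ ℝ[X] L L

/-- the curve `t ↦ f t • x` -/
noncomputable def curve (f : ℝ[X]) (x : L) : Curve L := f ⊗ₜ[ℝ] x

theorem curve_lie (f g : ℝ[X]) (x y : L) : ⁅curve f x, curve g y⁆ = curve (f * g) ⁅x, y⁆ := rfl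

theorem curve_induction {P : Curve L → Prop} (h0 : P 0) (ha : ∀ u v, P u → P v → P (u + v))
    (ht : ∀ f x, P (curve f x)) (u : Curve L) : P u :=
  TensorProduct.induction_on (motive := P) u h0 ht ha

/-- linear maps applied to the polynomial part -/
noncomputable def curveMap (L : Type*) [LieRing L] [LieAlgebra ℝ L] (φ : ℝ[X] →ₗ[ℝ] ℝ[X]) :
    Curve L →ₗ[ℝ] Curve L := LinearMap.rTensor L φ

/-- functionals applied to the polynomial part -/
noncomputable def curveFun (L : Type*) [LieRing L] [LieAlgebra ℝ L] (φ : ℝ[X] →ₗ[ℝ] ℝ) :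
    Curve L →ₗ[ℝ] L :=
  (TensorProduct.lid ℝ L).toLinearMap ∘ₗ LinearMap.rTensor L φ

theorem curveMap_curve (φ : ℝ[X] →ₗ[ℝ] ℝ[X]) (f : ℝ[X]) (x : L) :
    curveMap L φ (curve f x) = curve (φ f) x := rfl

theorem curveFun_curve (φ : ℝ[X] →ₗ[ℝ] ℝ) (f : ℝ[X]) (x : L) :
    curveFun L φ (curve f x) = φ f • x := rfl

theorem curveMap_derivative_lie (u v : Curve L) :
    curveMap L derivative ⁅u, v⁆
      = ⁅curveMap L derivative u, v⁆ + ⁅u, curveMap L derivative v⁆ := by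
  induction u using curve_induction with
  | h0 => simp
  | ha u u' hu hu' => simp only [add_lie, map_add, hu, hu']; abel
  | ht f x =>
    induction v using curve_induction with
    | h0 => simp
    | ha v v' hv hv' => simp only [lie_add, map_add, hv, hv']; abel
    | ht g y =>
      simp only [curve_lie, curveMap_curve, derivative_mul]
      exact TensorProduct.add_tmul _ _ _

/-- evaluation of curves -/
noncomputable def curveEval (s : ℝ) : Curve L →ₗ⁅ℝ⁆ L where
  toLinearMap := curveFun L (leval s)
  map_lie' {u v} := by
    change curveFun L (leval s) ⁅u, v⁆ = ⁅curveFun L (leval s) u, curveFun L (leval s) v⁆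
    induction u using curve_induction with
    | h0 => simp
    | ha u u' hu hu' => simp only [add_lie, map_add, hu, hu']
    | ht f x =>
      induction v using curve_induction with
      | h0 => simp
      | ha v v' hv hv' => simp only [lie_add, map_add, hv, hv']
      | ht g y => simp [curve_lie, curveFun_curve, leval, smul_smul, mul_comm]

theorem curveEval_eq {z : Curve L} (h : curveMap L derivative z = 0) :
    curveEval 1 z = curveEval 0 z := by
  let I : ℝ[X] →ₗ[ℝ] ℝ := lsum fun n => ((n : ℝ) + 1)⁻¹ • LinearMap.id
  have hI : (leval 1 - leval 0 : ℝ[X] →ₗ[ℝ] ℝ) = I ∘ₗ derivative := by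
    refine lhom_ext' fun n => LinearMap.ext_ring ?_
    cases n with
    | zero => simp [leval, I]
    | succ n =>
      have : (n : ℝ) + 1 ≠ 0 := by positivity
      simp only [LinearMap.comp_apply, derivative_monomial, I, lsum_apply]
      rw [sum_monomial_index _ _ (by simp)]
      simp [leval, this]
  have h1 : ∀ w : Curve L, curveEval 1 w - curveEval 0 w = curveFun L I (curveMap L derivative w) := by
    intro w
    change curveFun L (leval 1) w - curveFun L (leval 0) w = _
    induction w using curve_induction with
    | h0 => simp
    | ha u v hu hv =>
      simp only [map_add]
      rw [← hu, ← hv]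
      abel
    | ht f x =>
      rw [curveFun_curve, curveFun_curve, ← sub_smul, curveMap_curve, curveFun_curve,
        ← LinearMap.sub_apply, hI]
      rfl
  have h2 := h1 z
  rw [h, map_zero] at h2
  exact sub_eq_zero.mp h2

theorem exists_curve_transfer (L : Type*) [LieRing L] [LieAlgebra ℝ L] [LieRing.IsNilpotent L] :
    ∃ n₀ : ℕ, ∀ N, n₀ ≤ N → ∃ E : Curve L → Module.End ℝ (Curve L × ℝ),
      (∀ u v, E (bch N u v) = E u * E v) ∧ E 0 = 1 ∧ (∀ u, E u * E (-u) = 1) ∧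
      (∀ u v, E u = E v → curveEval 1 u - curveEval 0 u = curveEval 1 v - curveEval 0 v) := by
  obtain ⟨n₀, h⟩ := exists_transfer (curveMap L derivative) curveMap_derivative_lie
  refine ⟨n₀, fun N hN => ?_⟩
  obtain ⟨E, h1, h2, h3, h4⟩ := h N hN
  refine ⟨E, h1, h2, h3, fun u v huv => ?_⟩
  have h5 := curveEval_eq (z := u - v) (by rw [map_sub, h4 u v huv, sub_self])
  rw [map_sub, map_sub] at h5
  rw [sub_eq_sub_iff_sub_eq_sub, h5]

@[simp] theorem curveEval_line (s : ℝ) (x : L) : curveEval s (curve X x) = s • x := by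
  change curveFun L (leval s) (curve X x) = _
  simp [curveFun_curve, leval]

variable [LieRing.IsNilpotent L]

theorem bch_assoc {c : ℕ} (hc : LieModule.lowerCentralSeries ℝ L L c = ⊥)
    (x y z : L) : bch c (bch c x y) z = bch c x (bch c y z) := by
  obtain ⟨n₀, h⟩ := exists_curve_transfer L
  obtain ⟨E, hmul, -, -, hinj⟩ := h (n₀ + c) (by omega)
  have key := hinj (bch (n₀ + c) (bch (n₀ + c) (curve X x) (curve X y)) (curve X z))
    (bch (n₀ + c) (curve X x) (bch (n₀ + c) (curve X y) (curve X z)))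
    (by simp only [hmul, mul_assoc])
  simpa [map_bch, bch_zero, bch_eq hc (show c ≤ n₀ + c by omega)] using key

theorem bch_zero_right {c : ℕ} (hc : LieModule.lowerCentralSeries ℝ L L c = ⊥)
    (x : L) : bch c x 0 = x := by
  obtain ⟨n₀, h⟩ := exists_curve_transfer L
  obtain ⟨E, hmul, h0, -, hinj⟩ := h (n₀ + c) (by omega)
  have key := hinj (bch (n₀ + c) (curve X x) 0) (curve X x) (by simp only [hmul, h0, mul_one])
  simpa [map_bch, bch_zero, bch_eq hc (show c ≤ n₀ + c by omega)] using key

theorem bch_zero_left {c : ℕ} (hc : LieModule.lowerCentralSeries ℝ L L c = ⊥)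
    (x : L) : bch c 0 x = x := by
  obtain ⟨n₀, h⟩ := exists_curve_transfer L
  obtain ⟨E, hmul, h0, -, hinj⟩ := h (n₀ + c) (by omega)
  have key := hinj (bch (n₀ + c) 0 (curve X x)) (curve X x) (by simp only [hmul, h0, one_mul])
  simpa [map_bch, bch_zero, bch_eq hc (show c ≤ n₀ + c by omega)] using key

theorem bch_neg_left {c : ℕ} (hc : LieModule.lowerCentralSeries ℝ L L c = ⊥)
    (x : L) : bch c (-x) x = 0 := by
  obtain ⟨n₀, h⟩ := exists_curve_transfer L
  obtain ⟨E, hmul, h0, hneg, hinj⟩ := h (n₀ + c) (by omega)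
  have key := hinj (bch (n₀ + c) (-curve X x) (curve X x)) 0 (by
    have := hneg (-curve X x)
    rw [neg_neg] at this
    simp only [hmul, h0, this])
  simpa [map_bch, bch_zero, bch_eq hc (show c ≤ n₀ + c by omega)] using key

end Assoc

end GroupLaw

end Dynkin

namespace Carnot

/-! ### The associated graded Lie algebra -/

section Graded

variable (𝔤 : Type*) [LieRing 𝔤] [LieAlgebra ℝ 𝔤]

/-- `lcs 𝔤 k` is the term `𝔤_{k+1}` of the lower central series `𝔤_1 = 𝔤`,
`𝔤_{i+1} = [𝔤, 𝔤_i]`. -/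
abbrev lcs (k : ℕ) : Submodule ℝ 𝔤 := (LieModule.lowerCentralSeries ℝ 𝔤 𝔤 k).toSubmodule

theorem lcs_succ_le (k : ℕ) : lcs 𝔤 (k + 1) ≤ lcs 𝔤 k :=
  LieModule.antitone_lowerCentralSeries ℝ 𝔤 𝔤 (Nat.le_succ k)

/-- The piece `𝔤_{k+1} / 𝔤_{k+2}`. -/
abbrev GrPiece (k : ℕ) : Type _ := lcs 𝔤 k ⧸ (lcs 𝔤 (k + 1)).submoduleOf (lcs 𝔤 k)

/-- The associated graded Lie algebra `𝔤_∞ = ⨁ 𝔤_i / 𝔤_{i+1}`. -/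
def GrLie : Type _ := DirectSum ℕ (GrPiece 𝔤)

noncomputable instance : AddCommGroup (GrLie 𝔤) :=
  inferInstanceAs (AddCommGroup (DirectSum ℕ (GrPiece 𝔤)))

noncomputable instance : Module ℝ (GrLie 𝔤) :=
  inferInstanceAs (Module ℝ (DirectSum ℕ (GrPiece 𝔤)))

variable {𝔤}

/-- The inclusion of the piece `𝔤_{k+1} / 𝔤_{k+2}` into `𝔤_∞`. -/
noncomputable def grLof (k : ℕ) : GrPiece 𝔤 k →ₗ[ℝ] GrLie 𝔤 := DirectSum.lof ℝ ℕ (GrPiece 𝔤) k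

/-- The linear map on `𝔤_∞` with given restrictions to the pieces. -/
noncomputable def grLift {M : Type*} [AddCommGroup M] [Module ℝ M]
    (f : ∀ k, GrPiece 𝔤 k →ₗ[ℝ] M) : GrLie 𝔤 →ₗ[ℝ] M := DirectSum.toModule ℝ ℕ M f

theorem grLift_grLof {M : Type*} [AddCommGroup M] [Module ℝ M] (f : ∀ k, GrPiece 𝔤 k →ₗ[ℝ] M)
    (k : ℕ) (x : GrPiece 𝔤 k) : grLift f (grLof k x) = f k x := DirectSum.toModule_lof ℝ k x

theorem lie_mem_lcs_succ {k : ℕ} (x : 𝔤) {y : 𝔤} (hy : y ∈ lcs 𝔤 k) : ⁅x, y⁆ ∈ lcs 𝔤 (k + 1) := by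
  rw [lcs, LieModule.lowerCentralSeries_succ]
  exact LieSubmodule.lie_mem_lie (LieSubmodule.mem_top _) hy

theorem lie_mem_lcs {i j : ℕ} {x y : 𝔤} (hx : x ∈ lcs 𝔤 i) (hy : y ∈ lcs 𝔤 j) :
    ⁅x, y⁆ ∈ lcs 𝔤 (i + j + 1) := by
  induction i generalizing j x y with
  | zero => rw [zero_add]; exact lie_mem_lcs_succ x hy
  | succ i ih =>
    rw [lcs, LieModule.lowerCentralSeries_succ, LieSubmodule.lieIdeal_oper_eq_linear_span'] at hx
    induction hx using Submodule.span_induction with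
    | mem x h =>
      obtain ⟨u, -, v, hv, rfl⟩ := h
      rw [lie_lie]
      have h1 := lie_mem_lcs_succ u (ih hv hy)
      have h2 := ih hv (lie_mem_lcs_succ u hy)
      rw [show i + 1 + j + 1 = i + j + 1 + 1 by omega]
      rw [show i + (j + 1) + 1 = i + j + 1 + 1 by omega] at h2
      exact Submodule.sub_mem _ h1 h2
    | zero => rw [zero_lie]; exact Submodule.zero_mem _
    | add x x' _ _ h h' => rw [add_lie]; exact Submodule.add_mem _ h h'
    | smul c x _ h => rw [smul_lie]; exact Submodule.smul_mem _ c h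

/-- The bracket with a fixed element of `𝔤_{i+1}`. -/
def lcsLie {i : ℕ} (x : lcs 𝔤 i) (j : ℕ) : lcs 𝔤 j →ₗ[ℝ] lcs 𝔤 (i + j + 1) where
  toFun y := ⟨⁅(x : 𝔤), (y : 𝔤)⁆, lie_mem_lcs x.2 y.2⟩
  map_add' y y' := Subtype.ext (by simp)
  map_smul' c y := Subtype.ext (by simp)

/-- The bilinear map `𝔤_i/𝔤_{i+1} × 𝔤_j/𝔤_{j+1} → 𝔤_{i+j}/𝔤_{i+j+1}` induced by the bracket. -/
def pieceLie (i j : ℕ) : GrPiece 𝔤 i →ₗ[ℝ] GrPiece 𝔤 j →ₗ[ℝ] GrPiece 𝔤 (i + j + 1) :=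
  Submodule.liftQ _
    { toFun := fun x => Submodule.mapQ _ _ (lcsLie x j) (fun y hy => by
        change ⁅(x : 𝔤), (y : 𝔤)⁆ ∈ lcs 𝔤 (i + j + 1 + 1)
        exact lie_mem_lcs (j := j + 1) x.2 hy)
      map_add' := fun x x' => by
        refine Submodule.linearMap_qext _ (LinearMap.ext fun y => ?_)
        exact congrArg Submodule.Quotient.mk (Subtype.ext (add_lie (x : 𝔤) (x' : 𝔤) (y : 𝔤)))
      map_smul' := fun c x => by
        refine Submodule.linearMap_qext _ (LinearMap.ext fun y => ?_)
        exact congrArg Submodule.Quotient.mk (Subtype.ext (smul_lie c (x : 𝔤) (y : 𝔤))) }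
    (fun x hx => by
      refine LinearMap.mem_ker.mpr ?_
      ext y
      change Submodule.Quotient.mk _ = 0
      rw [Submodule.Quotient.mk_eq_zero]
      change ⁅(x : 𝔤), (y : 𝔤)⁆ ∈ lcs 𝔤 (i + j + 1 + 1)
      have := lie_mem_lcs (i := i + 1) hx y.2
      rwa [show i + 1 + j + 1 = i + j + 1 + 1 by omega] at this)

/-- The class in `𝔤_∞` of an element of `𝔤_{k+1}`. -/
noncomputable def grMk (k : ℕ) (x : 𝔤) (hx : x ∈ lcs 𝔤 k) : GrLie 𝔤 :=
  grLof k (Submodule.Quotient.mk ⟨x, hx⟩)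

/-- The bracket of `𝔤_∞`, extended linearly from the bilinear maps on the pieces. -/
noncomputable def grBracket : GrLie 𝔤 →ₗ[ℝ] GrLie 𝔤 →ₗ[ℝ] GrLie 𝔤 :=
  grLift fun i => LinearMap.flip (grLift fun j =>
    LinearMap.flip ((pieceLie i j).compr₂ (grLof (i + j + 1))))

theorem grBracket_mk {i j : ℕ} {x y : 𝔤} (hx : x ∈ lcs 𝔤 i) (hy : y ∈ lcs 𝔤 j) :
    grBracket (grMk i x hx) (grMk j y hy) = grMk (i + j + 1) ⁅x, y⁆ (lie_mem_lcs hx hy) := by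
  unfold grBracket grMk
  rw [grLift_grLof, LinearMap.flip_apply, grLift_grLof]
  rfl

theorem grMk_congr {i j : ℕ} {x y : 𝔤} {hx : x ∈ lcs 𝔤 i} {hy : y ∈ lcs 𝔤 j} (h : i = j)
    (hxy : x = y) : grMk i x hx = grMk j y hy := by
  subst h hxy
  rfl

theorem grMk_add {k : ℕ} {x y : 𝔤} (hx : x ∈ lcs 𝔤 k) (hy : y ∈ lcs 𝔤 k) :
    grMk k x hx + grMk k y hy = grMk k (x + y) (Submodule.add_mem _ hx hy) := by
  unfold grMk
  rw [← map_add]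
  rfl

theorem grMk_zero {k : ℕ} (h : (0 : 𝔤) ∈ lcs 𝔤 k) : grMk k 0 h = 0 :=
  map_zero (grLof k)

theorem grLie_induction {P : GrLie 𝔤 → Prop} (h0 : P 0) (ha : ∀ u v, P u → P v → P (u + v))
    (hm : ∀ k x hx, P (grMk k x hx)) (u : GrLie 𝔤) : P u := by
  refine DirectSum.induction_on (motive := P) u h0 ?_ ha
  intro k x
  obtain ⟨⟨x, hx⟩, rfl⟩ := Submodule.Quotient.mk_surjective _ x
  exact hm k x hx

theorem grBracket_add_flip (u v : GrLie 𝔤) : grBracket u v + grBracket v u = 0 := by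
  induction u using grLie_induction with
  | h0 => simp
  | ha u u' hu hu' =>
    simp only [map_add, LinearMap.add_apply]
    rw [add_add_add_comm, hu, hu', add_zero]
  | hm i x hx =>
    induction v using grLie_induction with
    | h0 => simp
    | ha v v' hv hv' =>
      simp only [map_add, LinearMap.add_apply]
      rw [add_add_add_comm, hv, hv', add_zero]
    | hm j y hy =>
      rw [grBracket_mk, grBracket_mk]
      have e : grMk (j + i + 1) ⁅y, x⁆ (lie_mem_lcs hy hx)
          = grMk (i + j + 1) (-⁅x, y⁆) (Submodule.neg_mem _ (lie_mem_lcs hx hy)) :=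
        grMk_congr (by omega) (lie_skew y x).symm
      rw [e, grMk_add]
      simp only [add_neg_cancel]
      exact grMk_zero _

theorem grBracket_self (u : GrLie 𝔤) : grBracket u u = 0 := by
  induction u using grLie_induction with
  | h0 => simp
  | ha u v hu hv =>
    simp only [map_add, LinearMap.add_apply, hu, hv, zero_add, add_zero]
    rw [add_comm]
    exact grBracket_add_flip u v
  | hm i x hx =>
    rw [grBracket_mk]
    simp only [lie_self]
    exact grMk_zero _

theorem grBracket_leibniz (u v w : GrLie 𝔤) :
    grBracket u (grBracket v w) = grBracket (grBracket u v) w + grBracket v (grBracket u w) := by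
  induction u using grLie_induction with
  | h0 => simp
  | ha u u' hu hu' =>
    simp only [map_add, LinearMap.add_apply, hu, hu']
    abel
  | hm i x hx =>
    induction v using grLie_induction with
    | h0 => simp
    | ha v v' hv hv' =>
      simp only [map_add, LinearMap.add_apply, hv, hv']
      abel
    | hm j y hy =>
      induction w using grLie_induction with
      | h0 => simp
      | ha w w' hw hw' =>
        simp only [map_add, hw, hw']
        abel
      | hm k z hz =>
        simp only [grBracket_mk]
        have e1 : grMk (i + j + 1 + k + 1) ⁅⁅x, y⁆, z⁆ (lie_mem_lcs (lie_mem_lcs hx hy) hz)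
            = grMk (i + (j + k + 1) + 1) ⁅⁅x, y⁆, z⁆ (by
              have := lie_mem_lcs (lie_mem_lcs hx hy) hz
              rwa [show i + j + 1 + k + 1 = i + (j + k + 1) + 1 by omega] at this) :=
          grMk_congr (by omega) rfl
        have e2 : grMk (j + (i + k + 1) + 1) ⁅y, ⁅x, z⁆⁆ (lie_mem_lcs hy (lie_mem_lcs hx hz))
            = grMk (i + (j + k + 1) + 1) ⁅y, ⁅x, z⁆⁆ (by
              have := lie_mem_lcs hy (lie_mem_lcs hx hz)
              rwa [show j + (i + k + 1) + 1 = i + (j + k + 1) + 1 by omega] at this) :=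
          grMk_congr (by omega) rfl
        rw [e1, e2, grMk_add]
        exact grMk_congr rfl (leibniz_lie x y z)

noncomputable instance : LieRing (GrLie 𝔤) where
  bracket u v := grBracket u v
  add_lie u v w := by simp
  lie_add u v w := by simp
  lie_self u := grBracket_self u
  leibniz_lie u v w := grBracket_leibniz u v w

noncomputable instance : LieAlgebra ℝ (GrLie 𝔤) where
  lie_smul c u v := map_smul (grBracket u) c v

theorem grLie_lcs_le (k : ℕ) : lcs (GrLie 𝔤) k
    ≤ Submodule.span ℝ {u | ∃ (i : ℕ) (x : 𝔤) (hx : x ∈ lcs 𝔤 i), k ≤ i ∧ grMk i x hx = u} := by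
  induction k with
  | zero =>
    intro u _
    induction u using grLie_induction with
    | h0 => exact Submodule.zero_mem _
    | ha u v hu hv => exact Submodule.add_mem _ (hu trivial) (hv trivial)
    | hm i x hx => exact Submodule.subset_span ⟨i, x, hx, Nat.zero_le _, rfl⟩
  | succ k ih =>
    rw [lcs, LieModule.lowerCentralSeries_succ, LieSubmodule.lieIdeal_oper_eq_linear_span',
      Submodule.span_le]
    rintro _ ⟨u, -, v, hv, rfl⟩
    replace hv := ih hv
    induction hv using Submodule.span_induction with
    | zero => rw [lie_zero]; exact Submodule.zero_mem _
    | add v w _ _ h h' => rw [lie_add]; exact Submodule.add_mem _ h h'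
    | smul c v _ h => rw [lie_smul]; exact Submodule.smul_mem _ c h
    | mem v h =>
      obtain ⟨j, y, hy, hj, rfl⟩ := h
      induction u using grLie_induction with
      | h0 => rw [zero_lie]; exact Submodule.zero_mem _
      | ha u u' hu hu' => rw [add_lie]; exact Submodule.add_mem _ hu hu'
      | hm i x hx =>
        exact Submodule.subset_span
          ⟨i + j + 1, ⁅x, y⁆, lie_mem_lcs hx hy, by omega, (grBracket_mk hx hy).symm⟩

instance [LieRing.IsNilpotent 𝔤] : LieRing.IsNilpotent (GrLie 𝔤) := by
  obtain ⟨c, hc⟩ := LieModule.IsNilpotent.nilpotent ℝ 𝔤 𝔤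
  refine LieModule.IsNilpotent.mk (R := ℝ) (k := c) _ ?_
  rw [← LieSubmodule.toSubmodule_eq_bot, eq_bot_iff]
  change lcs (GrLie 𝔤) c ≤ ⊥
  refine (grLie_lcs_le c).trans (Submodule.span_le.mpr ?_)
  rintro _ ⟨i, x, hx, hi, rfl⟩
  have h0 := LieModule.antitone_lowerCentralSeries ℝ 𝔤 𝔤 hi hx
  rw [hc, LieSubmodule.mem_bot] at h0
  subst h0
  exact grMk_zero hx

end Graded

/-! ### The simply connected nilpotent Lie group with a given Lie algebra -/

section ExpGroup

/-- The connected, simply connected nilpotent Lie group obtained by exponentiating the nilpotent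
real Lie algebra `𝔤`, in exponential coordinates: every element is `exp X` for exactly one `X : 𝔤`,
and the product is given by the Baker–Campbell–Hausdorff formula. -/
@[ext]
structure ExpGroup (𝔤 : Type*) where
  /-- The exponential map `𝔤 → exp 𝔤`. -/
  exp ::
  /-- The logarithm `exp 𝔤 → 𝔤`. -/
  log : 𝔤

variable {𝔤 : Type*} [LieRing 𝔤] [LieAlgebra ℝ 𝔤]

theorem lcs_nilpotencyLength [LieRing.IsNilpotent 𝔤] :
    LieModule.lowerCentralSeries ℝ 𝔤 𝔤 (LieModule.nilpotencyLength 𝔤 𝔤) = ⊥ := by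
  rcases h : LieModule.nilpotencyLength 𝔤 𝔤 with _ | k
  · rw [LieModule.nilpotencyLength_eq_zero_iff] at h
    exact (LieSubmodule.eq_bot_iff _).mpr fun x _ => Subsingleton.elim x 0
  · exact ((LieModule.nilpotencyLength_eq_succ_iff ℝ 𝔤 𝔤 k).mp h).1

/-- `exp X * exp Y = exp (X + Y + [X, Y] / 2 + …)`, by Dynkin's formula. -/
noncomputable instance : Mul (ExpGroup 𝔤) :=
  ⟨fun a b => .exp (Dynkin.bch (LieModule.nilpotencyLength 𝔤 𝔤) a.log b.log)⟩

instance : One (ExpGroup 𝔤) := ⟨.exp 0⟩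

instance : Inv (ExpGroup 𝔤) := ⟨fun a => .exp (-a.log)⟩

noncomputable instance [LieRing.IsNilpotent 𝔤] : Group (ExpGroup 𝔤) :=
  Group.ofLeftAxioms
    (fun a b c => ExpGroup.ext (Dynkin.bch_assoc lcs_nilpotencyLength a.log b.log c.log))
    (fun a => ExpGroup.ext (Dynkin.bch_zero_left lcs_nilpotencyLength a.log))
    (fun a => ExpGroup.ext (Dynkin.bch_neg_left lcs_nilpotencyLength a.log))

/-- The Lie group topology: the one for which `exp` is a homeomorphism from `𝔤` with its usual
topology (the module topology, which for finite-dimensional `𝔤` is the topology of any norm). -/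
instance : TopologicalSpace (ExpGroup 𝔤) := (moduleTopology ℝ 𝔤).induced ExpGroup.log

end ExpGroup

/-! ### Mal'tsev completions and Carnot completions -/

section Completion

/-- A homomorphism `ι : Γ → exp 𝔤` exhibits the simply connected nilpotent Lie group `exp 𝔤` as the
Mal'tsev completion of `Γ`: it embeds `Γ` as a discrete cocompact subgroup. -/
structure IsMaltsevCompletion {Γ 𝔤 : Type*} [Group Γ] [LieRing 𝔤] [LieAlgebra ℝ 𝔤]
    [LieRing.IsNilpotent 𝔤] (ι : Γ →* ExpGroup 𝔤) : Prop where
  injective : Function.Injective ι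
  discrete : DiscreteTopology ι.range
  cocompact : CompactSpace (ExpGroup 𝔤 ⧸ ι.range)

/-- The Carnot completion `Γ_∞` of a group whose Mal'tsev completion has Lie algebra `𝔤`: the simply
connected nilpotent Lie group obtained by exponentiating the associated graded Lie algebra `𝔤_∞`. -/
abbrev CarnotCompletion (𝔤 : Type*) [LieRing 𝔤] [LieAlgebra ℝ 𝔤] : Type _ := ExpGroup (GrLie 𝔤)

end Completion

/-! ### Growth -/

section Growth

/-- The ball of radius `n` about `1` in the word metric of `S`. -/
def wordBall {G : Type*} [Group G] (S : Set G) (n : ℕ) : Set G :=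
  {g | ∃ l : List G, l.length ≤ n ∧ (∀ s ∈ l, s ∈ S) ∧ l.prod = g}

/-- The relation `f ≼ g`: for some constant `C > 0`, `f n ≤ C * g (C * n)` for all `n ≥ 1`. -/
def Dominated (f g : ℕ → ℕ) : Prop := ∃ C : ℕ, 0 < C ∧ ∀ n, 1 ≤ n → f n ≤ C * g (C * n)

/-- The growth function of `G` is equivalent to `n ^ d`. -/
def HasGrowthDegree (G : Type*) [Group G] (d : ℕ) : Prop :=
  ∃ S : Finset G, (∀ s ∈ S, s⁻¹ ∈ S) ∧ Subgroup.closure (S : Set G) = ⊤ ∧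
    Dominated (fun n => (wordBall (S : Set G) n).ncard) (fun n => n ^ d) ∧
    Dominated (fun n => n ^ d) (fun n => (wordBall (S : Set G) n).ncard)

/-- The degree `d(G)` of polynomial growth of `G`. There is at most one `d` with
`HasGrowthDegree G d`, and there is one if `G` is finitely generated and nilpotent. -/
noncomputable def growthDegree (G : Type*) [Group G] : ℕ := sInf {d | HasGrowthDegree G d}

end Growth

end Carnot

/-! A continuous homomorphism of simply connected nilpotent Lie groups is linear in exponential
coordinates and respects brackets (`exists_differential`), so `F` is the exponential of a surjective
Lie algebra homomorphism `f`, and injectivity of `f` is all that is missing. It comes from a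
dimension count.

The count rests on the Bass–Guivarc'h formula `IsMaltsevCompletion.growthDegree_eq`: the growth
degree of a lattice is the homogeneous dimension ∑ dim 𝔤_i = ∑ i · dim (𝔤_i/𝔤_{i+1}). Passing to 𝔤_∞
preserves the dimension of each term of the lower central series (`finrank_lcs_grLie`), so 𝔤_∞ and
𝔥_∞ have equal homogeneous dimension. A surjection maps each term of the lower central series onto
the corresponding one, so the dimensions in the source dominate those in the target term by term. As
the sums agree, all terms agree; the first one gives dim 𝔤_∞ = dim 𝔥_∞, and `f` is bijective
(`injective_of_surjective_of_homogeneousDim_eq`). Its inverse is linear, hence continuous.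

The growth formula is a volume comparison in coordinates adapted to the lower central series. The
seminorm `gauge b w r` rescales each coordinate by the power of `r` given by its weight; the bracket
is bounded for it with a constant independent of `r`, so products are controlled uniformly at all
scales. Left translations are unipotent in these coordinates and preserve Lebesgue measure, and a
gauge ball of scale `r` is comparable to a box of volume r^D, with D the homogeneous dimension. For
the upper bound, a word ball of radius `n` has bounded gauge at a scale proportional to `n`, and
disjoint translates of a small cube are packed into the box (`IsAdapted.exists_card_le`). For the
lower bound, every element of bounded gauge at scale `r` is a product of O(r) bounded horizontal
elements, because iterated commutators reach every layer of the series
(`IsAdapted.exists_subset_wordBall_horizontal`); cocompactness replaces such products by words in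
the lattice up to a bounded error, so translates of a fixed cube cover the box. -/

namespace Dynkin

/-! ### Low-order terms, vanishing terms and norm estimates in Dynkin's formula -/

section Estimates

variable {L : Type*} [LieRing L] [LieAlgebra ℝ L]

/-- The coefficient of a word in Dynkin's formula. -/
noncomputable def dynkinCoeff {k : ℕ} (p : Fin k → ℕ × ℕ) : ℝ :=
  (-1 : ℝ) ^ (k - 1) / k / ((∑ i, ((p i).1 + (p i).2) : ℕ) *
      (∏ i, ((p i).1.factorial * (p i).2.factorial) : ℕ))

theorem bch_eq_sum (N : ℕ) (x y : L) : bch N x y =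
    ∑ k ∈ Finset.Icc 1 N, ∑ p ∈ index N k, dynkinCoeff p • lieWord (word p x y) := rfl

theorem lieWord_cons {L : Type*} [LieRing L] {x : L} {l : List L} (hl : l ≠ []) : lieWord (x :: l) = ⁅x, lieWord l⁆ := by
  cases l with
  | nil => exact absurd rfl hl
  | cons y l => rfl

/-- Each letter to the left of `z` raises the filtration by one. If `z` is the outermost letter,
skew-symmetry makes the inner word act on `z`, and that action again raises the level by the length
of the inner word. -/
theorem lieWord_mem_of_mem {P : ℕ → Submodule ℝ L} (hP : Antitone P)
    (hlie : ∀ j (x : L), ∀ y ∈ P j, ⁅x, y⁆ ∈ P (j + 1)) {z : L} (hz : z ∈ P 0) :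
    ∀ {l : List L}, z ∈ l → ∀ {j}, j < l.length → lieWord l ∈ P j
  | [x], h, j, hj => by
    obtain rfl : z = x := by simpa using h
    obtain rfl : j = 0 := by simpa using hj
    exact hz
  | x :: y :: l, h, j, hj => by
    have hj' : j ≤ (y :: l).length := by simpa [Nat.lt_succ_iff] using hj
    rw [lieWord_cons (by simp)]
    by_cases hm : z ∈ y :: l
    · cases j with
      | zero =>
        exact hP (Nat.zero_le 1) (hlie 0 x _ (lieWord_mem_of_mem hP hlie hz hm (by simp)))
      | succ j => exact hlie j x _ (lieWord_mem_of_mem hP hlie hz hm hj')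
    · obtain rfl : z = x := by
        rcases List.mem_cons.mp h with h | h
        · exact h
        · exact absurd h hm
      rw [← lie_skew]
      refine Submodule.neg_mem _ ?_
      -- By the Jacobi identity, the adjoint action of a word of length m is a combination of m-fold
      -- compositions of adjoint actions.
      have aux : ∀ {l : List L}, l ≠ [] → ∀ (i : ℕ) (u : L), u ∈ P i →
          ⁅lieWord l, u⁆ ∈ P (i + l.length) := by
        intro l
        induction l with
        | nil => intro h; exact absurd rfl h
        | cons a l ih =>
          intro _ i u hu
          by_cases hl : l = []
          · subst hl; exact hlie i _ u hu
          · rw [lieWord_cons hl, lie_lie, List.length_cons]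
            refine Submodule.sub_mem _ (hlie _ a _ (ih hl i u hu)) ?_
            have := ih hl (i + 1) _ (hlie i a u hu)
            rwa [show i + 1 + l.length = i + (l.length + 1) by omega] at this
      have := aux (l := y :: l) (by simp) 0 z hz
      rw [zero_add] at this
      exact hP hj' this

theorem lieWord_eq_zero_of_zero_mem {l : List L} (h : (0 : L) ∈ l) : lieWord l = 0 := by
  have hl : 0 < l.length := List.length_pos_of_mem h
  have := lieWord_mem_of_mem (P := fun _ => (⊥ : Submodule ℝ L)) antitone_const
    (by rintro j x y hy; rw [Submodule.mem_bot] at hy; simp [hy]) (Submodule.zero_mem _) h hl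
  simpa using this

theorem lieWord_eq_zero_of_commute {L : Type*} [LieRing L] {l : List L} (hl : 2 ≤ l.length)
    (h : ∀ z ∈ l, ∀ w ∈ l, ⁅z, w⁆ = 0) : lieWord l = 0 := by
  induction l with
  | nil => rfl
  | cons a l ih =>
    have hl0 : l ≠ [] := by rintro rfl; simp at hl
    rw [lieWord_cons hl0]
    rcases Nat.lt_or_ge l.length 2 with h2 | h2
    · obtain ⟨b, rfl⟩ : ∃ b, l = [b] := by
        rw [← List.length_eq_one_iff]; simp at hl; omega
      exact h a (by simp) b (by simp)
    · rw [ih h2 fun z hz w hw => h z (by simp [hz]) w (by simp [hw]), lie_zero]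

theorem lieWord_smul (t : ℝ) : ∀ l : List L,
    lieWord (l.map (t • ·)) = t ^ l.length • lieWord l
  | [] => by simp [lieWord]
  | [x] => by simp [lieWord]
  | x :: y :: l => by
    have := lieWord_smul t (y :: l)
    rw [List.map_cons, lieWord_cons (by simp), this, lieWord_cons (l := y :: l) (by simp),
      smul_lie, lie_smul, smul_smul, List.length_cons (a := x), pow_succ']

theorem mem_index {N k : ℕ} {p : Fin k → ℕ × ℕ} :
    p ∈ index N k ↔ ∀ i, p i ≠ (0, 0) ∧ (p i).1 ≤ N ∧ (p i).2 ≤ N := by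
  simp [index, Fintype.mem_piFinset]

/-- The part of Dynkin's formula made of the words of length at least three. -/
noncomputable def bchRem (N : ℕ) (x y : L) : L :=
  ∑ k ∈ Finset.Icc 1 N, ∑ p ∈ index N k,
    if 3 ≤ ∑ i, ((p i).1 + (p i).2) then dynkinCoeff p • lieWord (word p x y) else 0

/-- With `sum_index_two_two`, this makes the terms with one or two blocks explicit enough to be
evaluated by `simp`. -/
theorem sum_index_two_one {M : Type*} [AddCommMonoid M] (f : (Fin 1 → ℕ × ℕ) → M) :
    ∑ p ∈ index 2 1, f p =
      ∑ a ∈ (Finset.range 3 ×ˢ Finset.range 3).erase (0, 0), f (fun _ => a) := by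
  symm
  refine Finset.sum_bij (fun a _ _ => a) ?_ ?_ ?_ ?_
  · intro a ha
    rw [index, Fintype.mem_piFinset]
    exact fun _ => ha
  · intro a _ b _ h
    exact congrFun h 0
  · intro p hp
    rw [index, Fintype.mem_piFinset] at hp
    refine ⟨p 0, hp 0, funext fun i => ?_⟩
    rw [Subsingleton.elim i 0]
  · intro a _; rfl

theorem sum_index_two_two {M : Type*} [AddCommMonoid M] (f : (Fin 2 → ℕ × ℕ) → M) :
    ∑ p ∈ index 2 2, f p =
      ∑ a ∈ (Finset.range 3 ×ˢ Finset.range 3).erase (0, 0),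
        ∑ b ∈ (Finset.range 3 ×ˢ Finset.range 3).erase (0, 0), f ![a, b] := by
  rw [← Finset.sum_product']
  symm
  refine Finset.sum_bij (fun a _ => ![a.1, a.2]) ?_ ?_ ?_ ?_
  · intro a ha
    rw [Finset.mem_product] at ha
    rw [index, Fintype.mem_piFinset]
    intro i
    fin_cases i
    · exact ha.1
    · exact ha.2
  · intro a _ b _ h
    exact Prod.ext (congrFun h 0) (congrFun h 1)
  · intro p hp
    rw [index, Fintype.mem_piFinset] at hp
    refine ⟨(p 0, p 1), Finset.mem_product.mpr ⟨hp 0, hp 1⟩, funext fun i => ?_⟩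
    fin_cases i <;> rfl
  · intro a _; rfl

theorem bch_eq_add_bchRem {N : ℕ} (hN : 2 ≤ N) (x y : L) :
    bch N x y = x + y + (1 / 2 : ℝ) • ⁅x, y⁆ + bchRem N x y := by
  have hsplit : bch N x y = (∑ k ∈ Finset.Icc 1 N, ∑ p ∈ index N k,
      if 3 ≤ ∑ i, ((p i).1 + (p i).2) then 0 else dynkinCoeff p • lieWord (word p x y))
      + bchRem N x y := by
    rw [bch_eq_sum, bchRem, ← Finset.sum_add_distrib]
    refine Finset.sum_congr rfl fun k _ => ?_
    rw [← Finset.sum_add_distrib]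
    refine Finset.sum_congr rfl fun p _ => ?_
    split_ifs <;> simp
  rw [hsplit]
  congr 1
  -- A word of length at most two has at most two blocks and exponents at most two, so the
  -- truncation can be lowered to 2.
  have hred : (∑ k ∈ Finset.Icc 1 N, ∑ p ∈ index N k,
      if 3 ≤ ∑ i, ((p i).1 + (p i).2) then 0 else dynkinCoeff p • lieWord (word p x y))
      = ∑ k ∈ Finset.Icc 1 2, ∑ p ∈ index 2 k,
      if 3 ≤ ∑ i, ((p i).1 + (p i).2) then 0 else dynkinCoeff p • lieWord (word p x y) := by
    symm
    refine Finset.sum_subset_zero_on_sdiff (Finset.Icc_subset_Icc_right hN) ?_ ?_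
    · intro k hk
      refine Finset.sum_eq_zero fun p hp => if_pos ?_
      have := le_word_length hp x y
      rw [word_length] at this
      simp at hk
      omega
    · intro k _
      refine Finset.sum_subset ?_ ?_
      · intro p hp
        rw [mem_index] at hp ⊢
        exact fun i => ⟨(hp i).1, (hp i).2.1.trans hN, (hp i).2.2.trans hN⟩
      · intro p hp hp'
        refine if_pos ?_
        by_contra hcon
        refine hp' (mem_index.mpr fun i => ⟨(mem_index.mp hp i).1, ?_⟩)
        have h2 := Finset.single_le_sum (f := fun i => (p i).1 + (p i).2)
          (fun _ _ => Nat.zero_le _) (Finset.mem_univ i)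
        constructor <;> omega
  rw [hred, show Finset.Icc 1 2 = {1, 2} from rfl, Finset.sum_pair (by norm_num),
    sum_index_two_one, sum_index_two_two]
  have he : (Finset.range 3 ×ˢ Finset.range 3).erase (0, 0)
    = ({(0, 1), (0, 2), (1, 0), (1, 1), (1, 2), (2, 0), (2, 1), (2, 2)} : Finset (ℕ × ℕ)) := by
    decide
  rw [he]
  simp [Fin.sum_univ_succ, Fin.prod_univ_succ, dynkinCoeff, word, lieWord, List.replicate]
  -- The word xy has total coefficient 1/2 − 1/4 and yx has −1/4; together they give half of the
  -- bracket.
  rw [← lie_skew x y]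
  module

theorem bchRem_eq_zero {N : ℕ} {x y : L}
    (h : ∀ k (p : Fin k → ℕ × ℕ), 3 ≤ (word p x y).length → lieWord (word p x y) = 0) :
    bchRem N x y = 0 := by
  refine Finset.sum_eq_zero fun k _ => Finset.sum_eq_zero fun p _ => ?_
  split_ifs with h3
  · rw [h k p (by rwa [word_length]), smul_zero]
  · rfl

/-- Elements whose double brackets vanish, elements with vanishing brackets, zero. -/
def annihilated (L : Type*) [LieRing L] [LieAlgebra ℝ L] : ℕ → Submodule ℝ L
  | 0 =>
    { carrier := {w | ∀ u v : L, ⁅u, ⁅v, w⁆⁆ = 0}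
      add_mem' := fun ha hb u v => by rw [lie_add, lie_add, ha u v, hb u v, add_zero]
      zero_mem' := fun u v => by simp
      smul_mem' := fun c w hw u v => by rw [lie_smul, lie_smul, hw u v, smul_zero] }
  | 1 =>
    { carrier := {w | ∀ u : L, ⁅u, w⁆ = 0}
      add_mem' := fun ha hb u => by rw [lie_add, ha u, hb u, add_zero]
      zero_mem' := fun u => by simp
      smul_mem' := fun c w hw u => by rw [lie_smul, hw u, smul_zero] }
  | _ + 2 => ⊥

theorem annihilated_antitone : Antitone (annihilated L) := by
  refine antitone_nat_of_succ_le fun n => ?_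
  match n with
  | 0 => exact fun w hw u v => by rw [hw v, lie_zero]
  | 1 => exact bot_le
  | _ + 2 => exact le_rfl

/-- The filtration `annihilated L` contains `y` at level 0 and is zero from level 2 on, so
`lieWord_mem_of_mem` applies with `j = 2`. -/
theorem lieWord_eq_zero_of_lie_lie_eq_zero {y : L} (hy : ∀ u v : L, ⁅u, ⁅v, y⁆⁆ = 0) {l : List L}
    (h : y ∈ l) (hl : 3 ≤ l.length) : lieWord l = 0 := by
  have := lieWord_mem_of_mem (P := annihilated L) annihilated_antitone
    (fun j x w hw => by
      match j with
      | 0 => exact fun u => hw u x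
      | 1 => exact hw x
      | _ + 2 =>
        have : w = 0 := hw
        simp [this]) hy h (j := 2) hl
  exact this

theorem bchRem_eq_zero_of_lie_lie_eq_zero {N : ℕ} (x : L) {y : L}
    (hy : ∀ u v : L, ⁅u, ⁅v, y⁆⁆ = 0) : bchRem N x y = 0 ∧ bchRem N y x = 0 := by
  constructor <;> refine bchRem_eq_zero fun k p hl => ?_
  · by_cases h : y ∈ word p x y
    · exact lieWord_eq_zero_of_lie_lie_eq_zero hy h hl
    · have hx : ∀ z ∈ word p x y, z = x := fun z hz => (mem_word hz).resolve_right
        (by rintro rfl; exact h hz)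
      exact lieWord_eq_zero_of_commute (by omega) fun z hz w hw => by
        rw [hx z hz, hx w hw, lie_self]
  · by_cases h : y ∈ word p y x
    · exact lieWord_eq_zero_of_lie_lie_eq_zero hy h hl
    · have hx : ∀ z ∈ word p y x, z = x := fun z hz => (mem_word hz).resolve_left
        (by rintro rfl; exact h hz)
      exact lieWord_eq_zero_of_commute (by omega) fun z hz w hw => by
        rw [hx z hz, hx w hw, lie_self]

section Nilpotent

variable {c : ℕ} (hc : LieModule.lowerCentralSeries ℝ L L c = ⊥)
include hc

theorem bch_eq_add_bchRem_of_nilpotent (x y : L) :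
    bch c x y = x + y + (1 / 2 : ℝ) • ⁅x, y⁆ + bchRem (c + 2) x y := by
  -- Raising the truncation to `c + 2` changes nothing in nilpotency step `c` and makes room for the
  -- quadratic terms when `c < 2`.
  rw [← bch_eq hc (show c ≤ c + 2 by omega), bch_eq_add_bchRem (by omega)]

theorem bch_of_lie_lie_eq_zero (x : L) {y : L} (hy : ∀ u v : L, ⁅u, ⁅v, y⁆⁆ = 0) :
    bch c x y = x + y + (1 / 2 : ℝ) • ⁅x, y⁆ ∧ bch c y x = y + x + (1 / 2 : ℝ) • ⁅y, x⁆ := by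
  have := bchRem_eq_zero_of_lie_lie_eq_zero (N := c + 2) x hy
  rw [bch_eq_add_bchRem_of_nilpotent hc, bch_eq_add_bchRem_of_nilpotent hc, this.1, this.2]
  simp

theorem bch_central (x : L) {z : L} (hz : ∀ u : L, ⁅u, z⁆ = 0) :
    bch c x z = x + z ∧ bch c z x = z + x := by
  have := bch_of_lie_lie_eq_zero hc x (y := z) (fun u v => by rw [hz, lie_zero])
  rw [this.1, this.2, ← lie_skew z x, hz]
  simp

theorem bch_smul_smul (s t : ℝ) (x : L) : bch c (s • x) (t • x) = (s + t) • x := by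
  rw [bch_eq_add_bchRem_of_nilpotent hc, bchRem_eq_zero]
  · simp [add_smul]
  · intro k p hl
    have hx : ∀ z ∈ word p (s • x) (t • x), ∃ a : ℝ, z = a • x := fun z hz => by
      rcases mem_word hz with rfl | rfl
      exacts [⟨s, rfl⟩, ⟨t, rfl⟩]
    refine lieWord_eq_zero_of_commute (by omega) fun z hz w hw => ?_
    obtain ⟨a, rfl⟩ := hx z hz
    obtain ⟨b, rfl⟩ := hx w hw
    simp

end Nilpotent

/-- A word of length m is homogeneous of degree m, so after t² is split off from the words of length
at least three a positive power of t remains. This second-order expansion recovers both the sum and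
the bracket from the group law. -/
theorem exists_bch_smul_expansion {c : ℕ} (hc : LieModule.lowerCentralSeries ℝ L L c = ⊥)
    [TopologicalSpace L] [ContinuousAdd L] [ContinuousSMul ℝ L] (x y : L) :
    ∃ Q : ℝ → L, Continuous Q ∧ Q 0 = 0 ∧ ∀ t : ℝ,
      bch c (t • x) (t • y) = t • (x + y) + t ^ 2 • ((1 / 2 : ℝ) • ⁅x, y⁆ + Q t) := by
  refine ⟨fun t => ∑ k ∈ Finset.Icc 1 (c + 2), ∑ p ∈ index (c + 2) k,
    if 3 ≤ ∑ i, ((p i).1 + (p i).2) then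
      t ^ (∑ i, ((p i).1 + (p i).2) - 2) • dynkinCoeff p • lieWord (word p x y) else 0, ?_, ?_, ?_⟩
  · refine continuous_finsetSum _ fun k _ => continuous_finsetSum _ fun p _ => ?_
    split_ifs
    · exact (continuous_pow _).smul continuous_const
    · exact continuous_const
  · refine Finset.sum_eq_zero fun k _ => Finset.sum_eq_zero fun p _ => ?_
    split_ifs with h
    · rw [zero_pow (by omega), zero_smul]
    · rfl
  · intro t
    rw [bch_eq_add_bchRem_of_nilpotent hc, smul_add (t ^ 2), Finset.smul_sum, smul_add t,
      add_assoc (t • x + t • y)]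
    congr 2
    · simp only [smul_lie, lie_smul]
      module
    · refine Finset.sum_congr rfl fun k _ => ?_
      rw [Finset.smul_sum]
      refine Finset.sum_congr rfl fun p _ => ?_
      split_ifs with h
      · rw [← word_map (t • ·), lieWord_smul, word_length, smul_smul (t ^ 2), ← pow_add,
          smul_comm, show 2 + (∑ i, ((p i).1 + (p i).2) - 2) = ∑ i, ((p i).1 + (p i).2) by omega]
      · simp

section Seminorm

variable {p : Seminorm ℝ L} {C R : ℝ}

theorem seminorm_lieWord_le (hC : 1 ≤ C) (hp : ∀ x y, p ⁅x, y⁆ ≤ C * p x * p y) (hR : 1 ≤ R) :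
    ∀ {l : List L}, (∀ u ∈ l, p u ≤ R) → p (lieWord l) ≤ (C * R) ^ l.length
  | [], _ => by simp [lieWord]
  | [x], h => by
    have := h x (by simp)
    simp only [lieWord, List.length_singleton, pow_one]
    nlinarith
  | x :: y :: l, h => by
    have ih := seminorm_lieWord_le hC hp hR (l := y :: l) fun u hu => h u (by simp at hu ⊢; tauto)
    have hx := h x (by simp)
    rw [lieWord_cons (by simp), List.length_cons, pow_succ']
    refine (hp _ _).trans ?_
    gcongr

/-- Keeping one factor `p z` explicit instead of bounding it by `R` is what makes the product
Lipschitz in its second argument. -/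
theorem seminorm_lieWord_le_of_mem (hC : 1 ≤ C) (hp : ∀ x y, p ⁅x, y⁆ ≤ C * p x * p y)
    (hR : 1 ≤ R) {z : L} :
    ∀ {l : List L}, (∀ u ∈ l, p u ≤ R) → z ∈ l → p (lieWord l) ≤ (C * R) ^ l.length * p z
  | [x], h, hz => by
    obtain rfl : z = x := by simpa using hz
    simp only [lieWord, List.length_singleton, pow_one]
    have : 1 ≤ C * R := by nlinarith
    nlinarith [apply_nonneg p z]
  | x :: y :: l, h, hz => by
    have h' : ∀ u ∈ y :: l, p u ≤ R := fun u hu => h u (by simp at hu ⊢; tauto)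
    have hx := h x (by simp)
    have hz0 := apply_nonneg p z
    rw [lieWord_cons (by simp), List.length_cons, pow_succ']
    refine (hp _ _).trans ?_
    rcases List.mem_cons.mp hz with rfl | hz
    · have := seminorm_lieWord_le hC hp hR h'
      calc C * p z * p (lieWord (y :: l)) ≤ C * p z * (C * R) ^ (y :: l).length := by gcongr
        _ = C * 1 * (C * R) ^ (y :: l).length * p z := by ring
        _ ≤ _ := by gcongr
    · have := seminorm_lieWord_le_of_mem hC hp hR h' hz
      calc C * p x * p (lieWord (y :: l)) ≤ C * R * ((C * R) ^ (y :: l).length * p z) := by gcongr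
        _ = _ := by ring

/-- A Lipschitz constant of the truncated Baker–Campbell–Hausdorff product at the origin. -/
noncomputable def bchConst (N : ℕ) (K : ℝ) : ℝ :=
  ∑ k ∈ Finset.Icc 1 N, ∑ q ∈ index N k, |dynkinCoeff q| * K ^ (∑ i, ((q i).1 + (q i).2))

theorem bchConst_nonneg (N : ℕ) {K : ℝ} (hK : 0 ≤ K) : 0 ≤ bchConst N K :=
  Finset.sum_nonneg fun _ _ => Finset.sum_nonneg fun _ _ => by positivity

/-- Words that do not involve the second argument cancel in the difference. Those that do vanish
when it is 0, and are otherwise linearly bounded in `p y`. The constant depends on `p` only through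
`C` and `R`, which is how uniformity in the scale will enter. -/
theorem seminorm_bch_sub_le (N : ℕ) (hC : 1 ≤ C) (hp : ∀ x y, p ⁅x, y⁆ ≤ C * p x * p y)
    (hR : 1 ≤ R) {x y : L} (hx : p x ≤ R) (hy : p y ≤ R) :
    p (bch N x y - bch N x 0) ≤ bchConst N (C * R) * p y := by
  rw [bch_eq_sum, bch_eq_sum, bchConst, ← Finset.sum_sub_distrib, Finset.sum_mul]
  refine (Finset.le_sum_of_subadditive p (map_zero p).le (map_add_le_add p) _ _).trans (Finset.sum_le_sum fun k _ => ?_)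
  rw [← Finset.sum_sub_distrib, Finset.sum_mul]
  refine (Finset.le_sum_of_subadditive p (map_zero p).le (map_add_le_add p) _ _).trans (Finset.sum_le_sum fun q _ => ?_)
  have hy0 := apply_nonneg p y
  rw [← smul_sub, map_smul_eq_mul, Real.norm_eq_abs, mul_assoc]
  refine mul_le_mul_of_nonneg_left ?_ (abs_nonneg _)
  by_cases h : ∃ i, (q i).2 ≠ 0
  · obtain ⟨i, hi⟩ := h
    have hm : ∀ z : L, z ∈ word q x z := fun z => by
      simp only [word, List.mem_flatMap, List.mem_append, List.mem_replicate]
      exact ⟨q i, List.mem_ofFn.mpr ⟨i, rfl⟩, Or.inr ⟨hi, trivial⟩⟩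
    rw [lieWord_eq_zero_of_zero_mem (hm 0), sub_zero, ← word_length q x y]
    refine seminorm_lieWord_le_of_mem hC hp hR (fun u hu => ?_) (hm y)
    rcases mem_word hu with rfl | rfl <;> assumption
  · push Not at h
    have : word q x y = word q x 0 := by
      rw [word, word]
      refine List.flatMap_congr fun a ha => ?_
      obtain ⟨i, rfl⟩ := List.mem_ofFn.mp ha
      rw [h i]
      rfl
    rw [this, sub_self, map_zero]
    have : 0 ≤ C * R := by positivity
    positivity

end Seminorm

end Estimates

end Dynkin

open Dynkin

namespace Carnot

/-! ### Differentials of continuous homomorphisms -/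

section ContinuousHom

variable {L M : Type*} [LieRing L] [LieAlgebra ℝ L] [LieRing.IsNilpotent L]
  [LieRing M] [LieAlgebra ℝ M] [LieRing.IsNilpotent M]

theorem ExpGroup.log_mul {L : Type*} [LieRing L] [LieAlgebra ℝ L] [LieRing.IsNilpotent L]
    (a b : ExpGroup L) :
    (a * b).log = bch (LieModule.nilpotencyLength L L) a.log b.log := rfl

theorem ExpGroup.log_one {L : Type*} [LieRing L] [LieAlgebra ℝ L] [LieRing.IsNilpotent L] :
    (1 : ExpGroup L).log = 0 := rfl

theorem ExpGroup.log_inv {L : Type*} [LieRing L] [LieAlgebra ℝ L] [LieRing.IsNilpotent L]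
    (a : ExpGroup L) : (a⁻¹).log = -a.log := rfl

theorem t2Space_moduleTopology (L : Type*) [AddCommGroup L] [Module ℝ L] [FiniteDimensional ℝ L] :
    @T2Space L (moduleTopology ℝ L) := by
  let : TopologicalSpace L := moduleTopology ℝ L
  have : IsModuleTopology ℝ L := ⟨rfl⟩
  let e := (Module.finBasis ℝ L).equivFun
  have he : Continuous e := IsModuleTopology.continuous_of_linearMap e.toLinearMap
  exact T2Space.of_injective_continuous e.injective he

theorem ExpGroup.exp_continuous (L : Type*) [LieRing L] [LieAlgebra ℝ L] :
    @Continuous _ _ (moduleTopology ℝ L) _ (ExpGroup.exp : L → ExpGroup L) := by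
  let : TopologicalSpace L := moduleTopology ℝ L
  exact continuous_induced_rng.mpr continuous_id

theorem ExpGroup.log_continuous (L : Type*) [LieRing L] [LieAlgebra ℝ L] :
    @Continuous _ _ _ (moduleTopology ℝ L) (ExpGroup.log : ExpGroup L → L) :=
  continuous_induced_dom

/-- A map `ℝ → M` that agrees away from the origin with another continuous map does so at `0`. -/
theorem eq_at_zero_of_eq_off_zero {M : Type*} [TopologicalSpace M] [T2Space M] {u v : ℝ → M}
    (hu : Continuous u) (hv : Continuous v) (h : ∀ t, t ≠ 0 → u t = v t) : u 0 = v 0 :=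
  congrFun (Continuous.ext_on (dense_compl_singleton (0 : ℝ)) hu hv fun t ht => h t ht) 0

/-- The differential of a continuous homomorphism of simply connected nilpotent Lie groups. -/
theorem exists_differential [FiniteDimensional ℝ L] [FiniteDimensional ℝ M]
    (F : ExpGroup L →* ExpGroup M) (hF : Continuous F) :
    ∃ f : L →ₗ⁅ℝ⁆ M, ∀ x, F (.exp x) = .exp (f x) := by
  let : TopologicalSpace L := moduleTopology ℝ L
  have : IsModuleTopology ℝ L := ⟨rfl⟩
  let : TopologicalSpace M := moduleTopology ℝ M
  have : IsModuleTopology ℝ M := ⟨rfl⟩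
  have : T2Space L := t2Space_moduleTopology L
  have : T2Space M := t2Space_moduleTopology M
  have : ContinuousAdd L := IsModuleTopology.toContinuousAdd ℝ L
  have : ContinuousAdd M := IsModuleTopology.toContinuousAdd ℝ M
  let f : L → M := fun x => (F (.exp x)).log
  have hf : Continuous f :=
    (ExpGroup.log_continuous M).comp (hF.comp (ExpGroup.exp_continuous L))
  have hmul : ∀ x y, f (bch (LieModule.nilpotencyLength L L) x y)
      = bch (LieModule.nilpotencyLength M M) (f x) (f y) := fun x y =>
    congrArg ExpGroup.log (F.map_mul (.exp x) (.exp y))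
  have hcL := lcs_nilpotencyLength (𝔤 := L)
  have hcM := lcs_nilpotencyLength (𝔤 := M)
  generalize LieModule.nilpotencyLength L L = c at *
  generalize LieModule.nilpotencyLength M M = d at *
  -- On a line the product is addition, which gives integer multiples; clearing denominators gives
  -- rational ones, and density of ℚ with continuity gives real ones.
  have hsmul : ∀ (t : ℝ) x, f (t • x) = t • f x := by
    intro t x
    have hnat : ∀ (n : ℕ) x, f ((n : ℝ) • x) = (n : ℝ) • f x := by
      intro n x
      induction n with
      | zero =>
        rw [Nat.cast_zero, zero_smul, zero_smul]
        exact congrArg ExpGroup.log F.map_one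
      | succ n ih =>
        have h := hmul ((n : ℝ) • x) ((1 : ℝ) • x)
        rw [bch_smul_smul hcL, ih, one_smul] at h
        rw [Nat.cast_succ, h]
        simpa using bch_smul_smul hcM n 1 (f x)
    have hneg : ∀ x, f (-x) = -f x := fun x => congrArg ExpGroup.log (F.map_inv (.exp x))
    have hint : ∀ (n : ℤ) x, f ((n : ℝ) • x) = (n : ℝ) • f x := by
      intro n x
      obtain ⟨m, rfl | rfl⟩ := n.eq_nat_or_neg
      · exact_mod_cast hnat m x
      · push_cast
        rw [neg_smul, hneg, hnat, neg_smul]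
    refine congrFun (Rat.denseRange_cast.equalizer (g := fun s : ℝ => f (s • x))
      (h := fun s : ℝ => s • f x) (by fun_prop) (by fun_prop) (funext fun q => ?_)) t
    have hq : ((q.den : ℕ) : ℝ) ≠ 0 := by exact_mod_cast q.den_ne_zero
    have hqq : (q.den : ℝ) * (q : ℝ) = (q.num : ℝ) := by exact_mod_cast Rat.den_mul_eq_num q
    refine smul_right_injective M hq ?_
    change (q.den : ℝ) • f ((q : ℝ) • x) = (q.den : ℝ) • (q : ℝ) • f x
    rw [← hnat, smul_smul, smul_smul, hqq, hint]
  -- The identity for the product of `exp (t x)` and `exp (t y)`, divided by t, is evaluated at t =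
  -- 0 by continuity.
  have hadd : ∀ x y, f (x + y) = f x + f y := by
    intro x y
    obtain ⟨Q, hQ, hQ0, hQt⟩ := exists_bch_smul_expansion hcL x y
    obtain ⟨P, hP, hP0, hPt⟩ := exists_bch_smul_expansion hcM (f x) (f y)
    have key := eq_at_zero_of_eq_off_zero
      (u := fun t : ℝ => f (x + y + t • ((1 / 2 : ℝ) • ⁅x, y⁆ + Q t)))
      (v := fun t : ℝ => f x + f y + t • ((1 / 2 : ℝ) • ⁅f x, f y⁆ + P t))
      (by fun_prop) (by fun_prop) (fun t ht => by
        have h := hmul (t • x) (t • y)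
        rw [hsmul, hsmul, hQt, hPt, pow_two, mul_smul, mul_smul, ← smul_add, ← smul_add, hsmul]
          at h
        exact smul_right_injective M ht h)
    simpa using key
  let φ : L →ₗ[ℝ] M := { toFun := f, map_add' := hadd, map_smul' := hsmul }
  refine ⟨{ φ with map_lie' := fun {x y} => ?_ }, fun x => rfl⟩
  change f ⁅x, y⁆ = ⁅f x, f y⁆
  obtain ⟨Q, hQ, hQ0, hQt⟩ := exists_bch_smul_expansion hcL x y
  obtain ⟨P, hP, hP0, hPt⟩ := exists_bch_smul_expansion hcM (f x) (f y)
  -- Additivity now cancels the first-order parts, so the same identity can be divided by t², and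
  -- its value at t = 0 compares the brackets.
  have key := eq_at_zero_of_eq_off_zero
    (u := fun t : ℝ => f ((1 / 2 : ℝ) • ⁅x, y⁆ + Q t))
    (v := fun t : ℝ => (1 / 2 : ℝ) • ⁅f x, f y⁆ + P t)
    (by fun_prop) (by fun_prop) (fun t ht => by
      have h := hmul (t • x) (t • y)
      rw [hsmul, hsmul, hQt, hPt, hadd, hsmul, hadd, hsmul, add_right_inj] at h
      exact smul_right_injective M (pow_ne_zero 2 ht) h)
  simp only [hQ0, hP0, add_zero, hsmul] at key
  exact smul_right_injective M (by norm_num : (1 / 2 : ℝ) ≠ 0) key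

end ContinuousHom

/-! ### Dimensions in the graded Lie algebra and the homogeneous dimension -/

section GradedDimension

variable {𝔤 : Type*} [LieRing 𝔤] [LieAlgebra ℝ 𝔤]

theorem lcs_antitone : Antitone (lcs 𝔤) := fun _ _ h =>
  LieModule.antitone_lowerCentralSeries ℝ 𝔤 𝔤 h

/-- The terms of degree at least `k` in the associated graded Lie algebra. -/
noncomputable def grTail (𝔤 : Type*) [LieRing 𝔤] [LieAlgebra ℝ 𝔤] (k : ℕ) :
    Submodule ℝ (GrLie 𝔤) :=
  Submodule.span ℝ {u | ∃ (i : ℕ) (x : 𝔤) (hx : x ∈ lcs 𝔤 i), k ≤ i ∧ grMk i x hx = u}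

theorem grTail_antitone : Antitone (grTail 𝔤) := fun _ _ h =>
  Submodule.span_mono fun _ ⟨i, x, hx, hi, e⟩ => ⟨i, x, hx, h.trans hi, e⟩

/-- The graded algebra is generated by its first piece: an element of 𝔤_{i+1} is a sum of brackets,
and the class of a bracket is a bracket with a class from the first piece. -/
theorem grMk_mem_lcs {i : ℕ} {x : 𝔤} (hx : x ∈ lcs 𝔤 i) : grMk i x hx ∈ lcs (GrLie 𝔤) i := by
  induction i generalizing x with
  | zero => trivial
  | succ i ih =>
    -- `grMk` takes the membership proof as an argument, so that proof stays quantified during the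
    -- span induction.
    have aux : ∀ x ∈ lcs 𝔤 (i + 1), ∀ hx, grMk (i + 1) x hx ∈ lcs (GrLie 𝔤) (i + 1) := by
      intro x hx
      rw [lcs, LieModule.lowerCentralSeries_succ,
        LieSubmodule.lieIdeal_oper_eq_linear_span'] at hx
      induction hx using Submodule.span_induction with
      | zero => intro hx; rw [grMk_zero]; exact Submodule.zero_mem _
      | add a b ha hb iha ihb =>
        intro hx
        have e : ∀ z, z ∈ Submodule.span ℝ {x | ∃ y ∈ (⊤ : LieIdeal ℝ 𝔤),
            ∃ n ∈ LieModule.lowerCentralSeries ℝ 𝔤 𝔤 i, ⁅y, n⁆ = x} → z ∈ lcs 𝔤 (i + 1) := by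
          intro z hz
          rwa [lcs, LieModule.lowerCentralSeries_succ,
            LieSubmodule.lieIdeal_oper_eq_linear_span']
        rw [← grMk_add (e a ha) (e b hb)]
        exact Submodule.add_mem _ (iha _) (ihb _)
      | smul t a ha iha =>
        intro hx
        have e : a ∈ lcs 𝔤 (i + 1) := by
          rwa [lcs, LieModule.lowerCentralSeries_succ,
            LieSubmodule.lieIdeal_oper_eq_linear_span']
        have : grMk (i + 1) (t • a) hx = t • grMk (i + 1) a e := by
          rw [grMk, grMk, ← map_smul]
          rfl
        rw [this]
        exact Submodule.smul_mem _ t (iha e)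
      | mem a ha =>
        obtain ⟨u, -, v, hv, rfl⟩ := ha
        intro hx
        have hu : u ∈ lcs 𝔤 0 := trivial
        have h := lie_mem_lcs_succ (grMk 0 u hu) (ih hv)
        have e : ⁅grMk 0 u hu, grMk i v hv⁆ = grMk (i + 1) ⁅u, v⁆ hx := by
          change grBracket _ _ = _
          rw [grBracket_mk]
          exact grMk_congr (by omega) rfl
        rwa [e] at h
    exact aux x hx hx

theorem lcs_grLie (k : ℕ) : lcs (GrLie 𝔤) k = grTail 𝔤 k := by
  refine le_antisymm (grLie_lcs_le k) (Submodule.span_le.mpr ?_)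
  rintro _ ⟨i, x, hx, hi, rfl⟩
  exact lcs_antitone hi (grMk_mem_lcs hx)

theorem exists_add_of_mem_grTail {k : ℕ} {u : GrLie 𝔤} (hu : u ∈ grTail 𝔤 k) :
    ∃ (a : GrPiece 𝔤 k), ∃ v ∈ grTail 𝔤 (k + 1), u = grLof k a + v := by
  induction hu using Submodule.span_induction with
  | zero => exact ⟨0, 0, Submodule.zero_mem _, by simp⟩
  | add x y _ _ hx hy =>
    obtain ⟨a, v, hv, rfl⟩ := hx
    obtain ⟨b, w, hw, rfl⟩ := hy
    exact ⟨a + b, v + w, Submodule.add_mem _ hv hw, by rw [map_add]; abel⟩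
  | smul t x _ hx =>
    obtain ⟨a, v, hv, rfl⟩ := hx
    exact ⟨t • a, t • v, Submodule.smul_mem _ t hv, by rw [map_smul, smul_add]⟩
  | mem x h =>
    obtain ⟨i, x, hx, hi, rfl⟩ := h
    rcases hi.eq_or_lt with rfl | hi
    · exact ⟨_, 0, Submodule.zero_mem _, (add_zero _).symm⟩
    · exact ⟨0, _, Submodule.subset_span ⟨i, x, hx, hi, rfl⟩, by simp⟩

theorem grTail_eq_bot {c : ℕ} (hc : LieModule.lowerCentralSeries ℝ 𝔤 𝔤 c = ⊥) :
    grTail 𝔤 c = ⊥ := by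
  rw [eq_bot_iff, grTail, Submodule.span_le]
  rintro _ ⟨i, x, hx, hi, rfl⟩
  have h0 : x ∈ lcs 𝔤 c := lcs_antitone hi hx
  rw [lcs, hc] at h0
  obtain rfl : x = 0 := h0
  exact grMk_zero hx

/-- A linear isomorphism between a nilpotent Lie algebra and its associated graded Lie algebra
that is compatible with the lower central series. -/
theorem exists_grLie_equiv [LieRing.IsNilpotent 𝔤] :
    ∃ e : GrLie 𝔤 ≃ₗ[ℝ] 𝔤, ∀ k, (lcs (GrLie 𝔤) k).map e.toLinearMap = lcs 𝔤 k := by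
  obtain ⟨c, hc⟩ := LieModule.IsNilpotent.nilpotent ℝ 𝔤 𝔤
  -- Each quotient map splits linearly; the isomorphism is the sum of chosen splittings.
  have hsec : ∀ k, ∃ s : GrPiece 𝔤 k →ₗ[ℝ] ↥(lcs 𝔤 k),
      (((lcs 𝔤 (k + 1)).submoduleOf (lcs 𝔤 k)).mkQ) ∘ₗ s = LinearMap.id := fun k =>
    LinearMap.exists_rightInverse_of_surjective _ (Submodule.range_mkQ _)
  choose s hs using hsec
  let ψ : GrLie 𝔤 →ₗ[ℝ] 𝔤 := grLift fun k => (lcs 𝔤 k).subtype ∘ₗ s k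
  have hψ : ∀ k a, ψ (grLof k a) = (s k a : 𝔤) := fun k a => grLift_grLof _ k a
  have htail : ∀ k, ∀ u ∈ grTail 𝔤 k, ψ u ∈ lcs 𝔤 k := by
    intro k u hu
    have : grTail 𝔤 k ≤ (lcs 𝔤 k).comap ψ := by
      refine Submodule.span_le.mpr ?_
      rintro _ ⟨i, x, hx, hi, rfl⟩
      change ψ (grLof _ _) ∈ lcs 𝔤 k
      rw [hψ]
      exact lcs_antitone hi (s i _).2
    exact this hu
  -- Leading-term argument: if `u` is killed, the lift of its component in degree `k` equals minus a
  -- term of `lcs 𝔤 (k + 1)`, so that component is zero.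
  have hker : ∀ k, ∀ u ∈ grTail 𝔤 k, ψ u = 0 → u ∈ grTail 𝔤 (k + 1) := by
    intro k u hu h0
    obtain ⟨a, v, hv, rfl⟩ := exists_add_of_mem_grTail hu
    have h1 : (s k a : 𝔤) ∈ lcs 𝔤 (k + 1) := by
      rw [map_add, hψ] at h0
      rw [eq_neg_of_add_eq_zero_left h0]
      exact Submodule.neg_mem _ (htail _ v hv)
    have h2 : a = 0 := by
      have h3 := LinearMap.congr_fun (hs k) a
      simp only [LinearMap.comp_apply, LinearMap.id_apply] at h3
      rw [← h3]
      exact (Submodule.Quotient.mk_eq_zero _).mpr h1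
    rw [h2, map_zero, zero_add]
    exact hv
  have hinj : Function.Injective ψ := by
    refine (injective_iff_map_eq_zero ψ).mpr fun u h0 => ?_
    have h : ∀ k, u ∈ grTail 𝔤 k := by
      intro k
      induction k with
      | zero => rw [← lcs_grLie]; trivial
      | succ k ih => exact hker k u ih h0
    have := h c
    rwa [grTail_eq_bot hc] at this
  -- Descending induction on `k` from `c`: `x` and the lift of its class differ by an element of the
  -- next term.
  have hle : ∀ j k, k + j = c → lcs 𝔤 k ≤ (grTail 𝔤 k).map ψ := by
    intro j
    induction j with
    | zero =>
      intro k hk x hx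
      obtain rfl : k = c := hk
      rw [lcs, hc] at hx
      obtain rfl : x = 0 := hx
      exact Submodule.zero_mem _
    | succ j ih =>
      intro k hk x hx
      have hd : x - ψ (grMk k x hx) ∈ lcs 𝔤 (k + 1) := by
        change x - ψ (grLof _ _) ∈ lcs 𝔤 (k + 1)
        rw [hψ]
        have h3 := LinearMap.congr_fun (hs k) (Submodule.Quotient.mk ⟨x, hx⟩)
        simp only [LinearMap.comp_apply, LinearMap.id_apply] at h3
        have h4 := (Submodule.Quotient.eq _).mp h3.symm
        exact h4
      have h1 := Submodule.map_mono (grTail_antitone (Nat.le_succ k)) (ih (k + 1) (by omega) hd)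
      have h2 : ψ (grMk k x hx) ∈ (grTail 𝔤 k).map ψ :=
        Submodule.mem_map_of_mem (Submodule.subset_span ⟨k, x, hx, le_rfl, rfl⟩)
      simpa using Submodule.add_mem _ h1 h2
  have hmap : ∀ k, (grTail 𝔤 k).map ψ = lcs 𝔤 k := by
    intro k
    refine le_antisymm (Submodule.map_le_iff_le_comap.mpr (htail k)) ?_
    rcases le_total k c with h | h
    · exact hle (c - k) k (by omega)
    · intro x hx
      have := lcs_antitone h hx
      rw [lcs, hc] at this
      obtain rfl : x = 0 := this
      exact Submodule.zero_mem _
  have hsurj : Function.Surjective ψ := by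
    intro x
    have : x ∈ (grTail 𝔤 0).map ψ := by rw [hmap]; trivial
    obtain ⟨u, -, hu⟩ := this
    exact ⟨u, hu⟩
  refine ⟨LinearEquiv.ofBijective ψ ⟨hinj, hsurj⟩, fun k => ?_⟩
  rw [lcs_grLie]
  exact hmap k

theorem finrank_lcs_grLie [LieRing.IsNilpotent 𝔤] (k : ℕ) :
    Module.finrank ℝ (lcs (GrLie 𝔤) k) = Module.finrank ℝ (lcs 𝔤 k) := by
  obtain ⟨e, he⟩ := exists_grLie_equiv (𝔤 := 𝔤)
  rw [← he k]
  exact (LinearEquiv.finrank_map_eq e _).symm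

instance [LieRing.IsNilpotent 𝔤] [FiniteDimensional ℝ 𝔤] : FiniteDimensional ℝ (GrLie 𝔤) := by
  obtain ⟨e, -⟩ := exists_grLie_equiv (𝔤 := 𝔤)
  exact Module.Finite.equiv e.symm

/-- The homogeneous dimension of a nilpotent Lie algebra. -/
noncomputable def homogeneousDim (𝔤 : Type*) [LieRing 𝔤] [LieAlgebra ℝ 𝔤] : ℕ :=
  ∑ᶠ k, Module.finrank ℝ (lcs 𝔤 k)

theorem finite_support_finrank_lcs [LieRing.IsNilpotent 𝔤] :
    (Function.support fun k => Module.finrank ℝ (lcs 𝔤 k)).Finite := by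
  obtain ⟨c, hc⟩ := LieModule.IsNilpotent.nilpotent ℝ 𝔤 𝔤
  refine (Set.finite_lt_nat c).subset fun k hk => ?_
  by_contra h
  refine hk ?_
  have : lcs 𝔤 k = ⊥ := by
    rw [eq_bot_iff]
    refine (lcs_antitone (not_lt.mp h)).trans ?_
    rw [lcs, hc]
    exact le_rfl
  change Module.finrank ℝ ↥(lcs 𝔤 k) = 0
  rw [this, finrank_bot]

/-- The image of `lcs 𝔤 k` is `lcs 𝔥 k`, so the two sums are comparable term by term. Equality of
the sums forces equality at k = 0, which is equality of the full dimensions. -/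
theorem injective_of_surjective_of_homogeneousDim_eq {𝔥 : Type*} [LieRing 𝔥] [LieAlgebra ℝ 𝔥]
    [LieRing.IsNilpotent 𝔤] [LieRing.IsNilpotent 𝔥] [FiniteDimensional ℝ 𝔤]
    [FiniteDimensional ℝ 𝔥] (f : 𝔤 →ₗ⁅ℝ⁆ 𝔥) (hf : Function.Surjective f)
    (h : homogeneousDim 𝔤 = homogeneousDim 𝔥) : Function.Injective f := by
  have hle : ∀ k, Module.finrank ℝ (lcs 𝔥 k) ≤ Module.finrank ℝ (lcs 𝔤 k) := by
    intro k
    have h1 : lcs 𝔥 k = (lcs 𝔤 k).map (f : 𝔤 →ₗ[ℝ] 𝔥) := by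
      rw [lcs, ← LieIdeal.lowerCentralSeries_map_eq k hf]
      exact LieIdeal.coe_map_of_surjective hf
    rw [h1]
    exact Submodule.finrank_map_le _ _
  have heq : Module.finrank ℝ (lcs 𝔤 0) = Module.finrank ℝ (lcs 𝔥 0) := by
    have hfin := (finite_support_finrank_lcs (𝔤 := 𝔤)).union
      (finite_support_finrank_lcs (𝔤 := 𝔥))
    -- Inserting 0 keeps that index in the sum even when both algebras are zero and the supports are
    -- empty.
    rw [homogeneousDim, homogeneousDim,
      finsum_eq_sum_of_support_subset (s := insert 0 hfin.toFinset) _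
        (fun k hk => by simp at hk ⊢; tauto),
      finsum_eq_sum_of_support_subset (s := insert 0 hfin.toFinset) _
        (fun k hk => by simp at hk ⊢; tauto)] at h
    exact ((Finset.sum_eq_sum_iff_of_le fun k _ => hle k).mp h.symm 0 (by simp)).symm
  have heq' : Module.finrank ℝ 𝔤 = Module.finrank ℝ 𝔥 := by
    rw [← finrank_top ℝ 𝔤, ← finrank_top ℝ 𝔥]
    exact heq
  exact (LinearMap.injective_iff_surjective_of_finrank_eq_finrank heq'
    (f := (f : 𝔤 →ₗ[ℝ] 𝔥))).mpr hf

end GradedDimension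

/-! ### Adapted bases and anisotropic gauges -/

section Adapted

/-- Starting from the empty set for `W c = ⊥`, a basis of each term is extended to a basis of the
next larger one. -/
theorem exists_linearIndepOn_span_inter {V : Type*} [AddCommGroup V] [Module ℝ V]
    (W : ℕ → Submodule ℝ V) (hW : Antitone W) {c : ℕ} (hc : W c = ⊥) :
    ∃ B : Set V, LinearIndepOn ℝ id B ∧ ∀ k, Submodule.span ℝ (B ∩ W k) = W k := by
  have key : ∀ j k, k + j = c → ∃ B : Set V, LinearIndepOn ℝ id B ∧ B ⊆ W k ∧
      ∀ m, k ≤ m → W m ≤ Submodule.span ℝ (B ∩ W m) := by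
    intro j
    induction j with
    | zero =>
      rintro k rfl
      refine ⟨∅, linearIndepOn_empty _ _, Set.empty_subset _, fun m hm => ?_⟩
      refine (hW hm).trans ?_
      rw [add_zero] at hc
      rw [hc]
      exact bot_le
    | succ j ih =>
      intro k hk
      obtain ⟨B, hB, hBW, hspan⟩ := ih (k + 1) (by omega)
      have hBk : B ⊆ W k := hBW.trans (hW (Nat.le_succ k))
      have hsub := hB.subset_extend hBk
      refine ⟨hB.extend hBk, hB.linearIndepOn_extend hBk, hB.extend_subset hBk, fun m hm => ?_⟩
      rcases hm.eq_or_lt with rfl | hm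
      · rw [Set.inter_eq_left.mpr (hB.extend_subset hBk)]
        have := hB.subset_span_extend hBk
        simpa using this
      · exact (hspan m hm).trans (Submodule.span_mono (Set.inter_subset_inter_left _ hsub))
  obtain ⟨B, hB, -, h⟩ := key c 0 (zero_add c)
  exact ⟨B, hB, fun k => le_antisymm (Submodule.span_le.mpr Set.inter_subset_right)
    (h k (Nat.zero_le k))⟩

variable {ι : Type*} [Fintype ι] {𝔤 : Type*} [LieRing 𝔤] [LieAlgebra ℝ 𝔤]

/-- A basis with weights that describes the lower central series by vanishing coordinates. -/
def IsAdapted {ι 𝔤 : Type*} [LieRing 𝔤] [LieAlgebra ℝ 𝔤] (b : Module.Basis ι ℝ 𝔤) (w : ι → ℕ) :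
    Prop :=
  ∀ k x, x ∈ lcs 𝔤 k ↔ ∀ i, w i < k → b.repr x i = 0

theorem exists_isAdapted (𝔤 : Type*) [LieRing 𝔤] [LieAlgebra ℝ 𝔤] [FiniteDimensional ℝ 𝔤]
    [LieRing.IsNilpotent 𝔤] :
    ∃ (n : ℕ) (b : Module.Basis (Fin n) ℝ 𝔤) (w : Fin n → ℕ), IsAdapted b w := by
  classical
  obtain ⟨c, hc⟩ := LieModule.IsNilpotent.nilpotent ℝ 𝔤 𝔤
  have hc' : lcs 𝔤 c = ⊥ := by rw [lcs, hc]; rfl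
  obtain ⟨B, hB, hspan⟩ := exists_linearIndepOn_span_inter (lcs 𝔤) lcs_antitone hc'
  have htop : ⊤ ≤ Submodule.span ℝ (Set.range ((↑) : B → 𝔤)) := by
    have h := hspan 0
    rw [Subtype.range_coe]
    intro x _
    have hx : x ∈ lcs 𝔤 0 := trivial
    rw [← h] at hx
    exact Submodule.span_mono Set.inter_subset_left hx
  let b₀ : Module.Basis B ℝ 𝔤 := Module.Basis.mk (v := ((↑) : B → 𝔤)) hB htop
  have : Fintype B := FiniteDimensional.fintypeBasisIndex b₀
  let e := Fintype.equivFin B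
  -- The weight of a basis vector is its depth in the series. The search bound `c` suffices, since
  -- `lcs 𝔤 c = ⊥` and basis vectors are nonzero.
  let w₀ : B → ℕ := fun v => Nat.findGreatest (fun k => (v : 𝔤) ∈ lcs 𝔤 k) c
  have hw₀ : ∀ (v : B) k, k ≤ w₀ v ↔ (v : 𝔤) ∈ lcs 𝔤 k := by
    intro v k
    have hspec : (v : 𝔤) ∈ lcs 𝔤 (w₀ v) :=
      Nat.findGreatest_spec (P := fun k => (v : 𝔤) ∈ lcs 𝔤 k) (Nat.zero_le c) trivial
    refine ⟨fun h => lcs_antitone h hspec, fun h => ?_⟩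
    refine Nat.le_findGreatest ?_ h
    by_contra hcon
    have h1 := lcs_antitone (not_le.mp hcon).le h
    rw [hc'] at h1
    exact hB.ne_zero (i := (v : 𝔤)) v.2 h1
  refine ⟨_, b₀.reindex e, w₀ ∘ e.symm, fun k x => ?_⟩
  have h1 : lcs 𝔤 k = Submodule.span ℝ (b₀ '' {v | k ≤ w₀ v}) := by
    rw [← hspan k]
    congr 1
    have hb₀ : ∀ v, b₀ v = v := fun v => Module.Basis.mk_apply _ _ v
    ext v
    constructor
    · rintro ⟨hv, hk⟩; exact ⟨⟨v, hv⟩, (hw₀ ⟨v, hv⟩ k).mpr hk, hb₀ _⟩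
    · rintro ⟨v, hk, rfl⟩; rw [hb₀]; exact ⟨v.2, (hw₀ v k).mp hk⟩
  rw [h1, b₀.mem_span_image]
  constructor
  · intro h i hi
    rw [Module.Basis.repr_reindex_apply, ← Finsupp.notMem_support_iff]
    intro hm
    exact absurd (h hm) (not_le.mpr hi)
  · intro h v hv
    by_contra hcon
    have := h (e v) (by simpa using hcon)
    rw [Module.Basis.repr_reindex_apply, Equiv.symm_apply_apply] at this
    exact Finsupp.mem_support_iff.mp hv this

variable {b : Module.Basis ι ℝ 𝔤} {w : ι → ℕ}

theorem IsAdapted.basis_mem {ι : Type*} {b : Module.Basis ι ℝ 𝔤} {w : ι → ℕ}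
    (h : IsAdapted b w) {i : ι} {k : ℕ} (hk : k ≤ w i) : b i ∈ lcs 𝔤 k := by
  classical
  rw [h]
  intro j hj
  rw [Module.Basis.repr_self, Finsupp.single_apply, if_neg]
  rintro rfl
  omega

theorem IsAdapted.finrank_lcs (h : IsAdapted b w) (k : ℕ) :
    Module.finrank ℝ (lcs 𝔤 k) = (Finset.univ.filter fun i => k ≤ w i).card := by
  classical
  have h1 : lcs 𝔤 k = Submodule.span ℝ (Set.range fun i : {i // k ≤ w i} => b i) := by
    have hr : (Set.range fun i : {i // k ≤ w i} => b i) = b '' {i | k ≤ w i} := by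
      ext x; simp
    ext x
    rw [hr, b.mem_span_image, h]
    constructor
    · intro hx i hi
      by_contra hcon
      exact Finsupp.mem_support_iff.mp hi (hx i (not_le.mp hcon))
    · intro hx i hi
      by_contra hcon
      exact absurd (hx (Finsupp.mem_support_iff.mpr hcon)) (not_le.mpr hi)
  have h2 := finrank_span_eq_card (b.linearIndependent.comp
    ((↑) : {i // k ≤ w i} → ι) Subtype.val_injective)
  rw [Fintype.card_subtype] at h2
  rw [h1]
  exact h2

/-- Double counting: `b i` contributes to `lcs 𝔤 k` exactly for k = 0, …, `w i`. The right side is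
the exponent in the volume of a gauge box. -/
theorem IsAdapted.homogeneousDim_eq (h : IsAdapted b w) :
    homogeneousDim 𝔤 = ∑ i, (w i + 1) := by
  have hfin : ∀ k, k ∈ Function.support (fun k => Module.finrank ℝ (lcs 𝔤 k)) →
      k ∈ Finset.range (Finset.univ.sup w + 1) := by
    intro k hk
    rw [Function.mem_support, h.finrank_lcs, Finset.card_ne_zero] at hk
    obtain ⟨i, hi⟩ := hk
    have := Finset.le_sup (f := w) (Finset.mem_univ i)
    simp at hi ⊢
    omega
  rw [homogeneousDim, finsum_eq_sum_of_support_subset _ hfin]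
  simp only [h.finrank_lcs, Finset.card_filter]
  rw [Finset.sum_comm]
  refine Finset.sum_congr rfl fun i _ => ?_
  rw [← Finset.card_filter]
  have := Finset.le_sup (f := w) (Finset.mem_univ i)
  have e : (Finset.range (Finset.univ.sup w + 1)).filter (fun k => k ≤ w i)
      = Finset.range (w i + 1) := by
    ext k; simp; omega
  rw [e, Finset.card_range]

/-- The anisotropic norm `∑ |xᵢ| / r ^ wᵢ`, where the weights start at one. -/
noncomputable def gauge (b : Module.Basis ι ℝ 𝔤) (w : ι → ℕ) (r : ℕ) : Seminorm ℝ 𝔤 :=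
  Seminorm.of (fun x => ∑ i, |b.repr x i| / (r : ℝ) ^ (w i + 1))
    (fun x y => by
      rw [← Finset.sum_add_distrib]
      refine Finset.sum_le_sum fun i _ => ?_
      rw [← add_div, map_add, Finsupp.add_apply]
      gcongr
      exact abs_add_le _ _)
    (fun a x => by
      rw [Finset.mul_sum]
      refine Finset.sum_congr rfl fun i _ => ?_
      rw [map_smul, Finsupp.smul_apply, smul_eq_mul, abs_mul, mul_div_assoc, Real.norm_eq_abs])

theorem gauge_apply (r : ℕ) (x : 𝔤) :
    gauge b w r x = ∑ i, |b.repr x i| / (r : ℝ) ^ (w i + 1) := rfl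

theorem gauge_one (x : 𝔤) : gauge b w 1 x = ∑ i, |b.repr x i| := by simp [gauge_apply]

theorem gauge_le_div {r : ℕ} (hr : 1 ≤ r) {x : 𝔤} {k : ℕ} (hx : ∀ i, w i < k → b.repr x i = 0) :
    gauge b w r x ≤ gauge b w 1 x / (r : ℝ) ^ (k + 1) := by
  rw [gauge_apply, gauge_one, Finset.sum_div]
  refine Finset.sum_le_sum fun i _ => ?_
  have hr' : (1 : ℝ) ≤ r := by exact_mod_cast hr
  rcases Nat.lt_or_ge (w i) k with h | h
  · rw [hx i h]; simp
  · gcongr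

theorem abs_repr_le_gauge {r : ℕ} (hr : 1 ≤ r) (x : 𝔤) (i : ι) :
    |b.repr x i| ≤ gauge b w r x * (r : ℝ) ^ (w i + 1) := by
  have hr' : (0 : ℝ) < r := by exact_mod_cast hr
  rw [← div_le_iff₀ (by positivity), gauge_apply]
  exact Finset.single_le_sum (f := fun i => |b.repr x i| / (r : ℝ) ^ (w i + 1))
    (fun _ _ => by positivity) (Finset.mem_univ i)

/-- The constant is independent of `r` because ⁅b i, b j⁆ lies in `lcs 𝔤 (w i + w j + 1)`: at scale
`r` its gauge gains the factor r^(−(w i + 1) − (w j + 1)), the product of the factors belonging to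
`b i` and `b j`. -/
theorem IsAdapted.exists_gauge_lie_le (h : IsAdapted b w) :
    ∃ C : ℝ, 1 ≤ C ∧ ∀ r : ℕ, 1 ≤ r → ∀ x y,
      gauge b w r ⁅x, y⁆ ≤ C * gauge b w r x * gauge b w r y := by
  let K : ι → ι → ℝ := fun i j => gauge b w 1 ⁅b i, b j⁆
  -- The sum dominates every structure term `K i j`, and the summand 1 ensures that the constant is
  -- at least 1.
  refine ⟨1 + ∑ i, ∑ j, K i j, ?_, fun r hr x y => ?_⟩
  · have : 0 ≤ ∑ i, ∑ j, K i j :=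
      Finset.sum_nonneg fun i _ => Finset.sum_nonneg fun j _ => apply_nonneg _ _
    linarith
  have hr' : (0 : ℝ) < r := by exact_mod_cast hr
  have hK : ∀ i j, K i j ≤ 1 + ∑ i, ∑ j, K i j := by
    intro i j
    have h1 := Finset.single_le_sum (f := fun j => K i j) (fun _ _ => apply_nonneg _ _)
      (Finset.mem_univ j)
    have h2 := Finset.single_le_sum (f := fun i => ∑ j, K i j)
      (fun _ _ => Finset.sum_nonneg fun j _ => apply_nonneg _ _) (Finset.mem_univ i)
    linarith
  have hb : ∀ i j, gauge b w r ⁅b i, b j⁆ ≤ K i j / ((r : ℝ) ^ (w i + 1) * r ^ (w j + 1)) := by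
    intro i j
    have := gauge_le_div hr ((h _ _).mp (lie_mem_lcs (h.basis_mem (le_refl (w i)))
      (h.basis_mem (le_refl (w j)))))
    rwa [← pow_add, show w i + 1 + (w j + 1) = w i + w j + 1 + 1 by omega]
  calc gauge b w r ⁅x, y⁆
      = gauge b w r (∑ i, ∑ j, (b.repr x i * b.repr y j) • ⁅b i, b j⁆) := by
        congr 1
        conv_lhs => rw [← b.sum_repr x, ← b.sum_repr y]
        rw [sum_lie_sum]
        simp only [smul_lie, lie_smul, smul_smul, mul_comm (b.repr y _)]
    _ ≤ ∑ i, ∑ j, gauge b w r ((b.repr x i * b.repr y j) • ⁅b i, b j⁆) :=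
        (Finset.le_sum_of_subadditive _ (map_zero _).le (map_add_le_add _) _ _).trans
          (Finset.sum_le_sum fun i _ =>
            Finset.le_sum_of_subadditive _ (map_zero _).le (map_add_le_add _) _ _)
    _ ≤ ∑ i, ∑ j, (1 + ∑ i, ∑ j, K i j) *
          ((|b.repr x i| / (r : ℝ) ^ (w i + 1)) * (|b.repr y j| / (r : ℝ) ^ (w j + 1))) := by
        refine Finset.sum_le_sum fun i _ => Finset.sum_le_sum fun j _ => ?_
        rw [map_smul_eq_mul, Real.norm_eq_abs, abs_mul]
        calc |b.repr x i| * |b.repr y j| * gauge b w r ⁅b i, b j⁆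
            ≤ |b.repr x i| * |b.repr y j| *
              ((1 + ∑ i, ∑ j, K i j) / ((r : ℝ) ^ (w i + 1) * r ^ (w j + 1))) := by
              refine mul_le_mul_of_nonneg_left ((hb i j).trans ?_) (by positivity)
              gcongr
              exact hK i j
          _ = _ := by field_simp
    _ = _ := by
        rw [gauge_apply, gauge_apply, mul_assoc, Finset.sum_mul_sum, Finset.mul_sum]
        simp only [Finset.mul_sum]

end Adapted

/-! ### The product modulo terms of the lower central series -/

section Congruence

variable {L : Type*} [LieRing L] [LieAlgebra ℝ L]

/-- The projection to the quotient by an ideal. -/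
def quotientHom (I : LieIdeal ℝ L) : L →ₗ⁅ℝ⁆ L ⧸ I where
  toLinearMap := I.toSubmodule.mkQ
  map_lie' := rfl

theorem quotientHom_surjective (I : LieIdeal ℝ L) : Function.Surjective (quotientHom I) :=
  Submodule.mkQ_surjective _

theorem quotientHom_eq_zero {I : LieIdeal ℝ L} {x : L} : quotientHom I x = 0 ↔ x ∈ I :=
  Submodule.Quotient.mk_eq_zero _

theorem quotient_lcs_eq_bot (I : LieIdeal ℝ L) {c : ℕ}
    (hc : LieModule.lowerCentralSeries ℝ L L c = ⊥) :
    LieModule.lowerCentralSeries ℝ (L ⧸ I) (L ⧸ I) c = ⊥ := by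
  rw [← LieIdeal.lowerCentralSeries_map_eq c (quotientHom_surjective I), hc]
  exact LieIdeal.map_eq_bot_iff.mpr bot_le

variable [LieRing.IsNilpotent L]

theorem isNilpotent_quotient (I : LieIdeal ℝ L) : LieRing.IsNilpotent (L ⧸ I) := by
  obtain ⟨c, hc⟩ := LieModule.IsNilpotent.nilpotent ℝ L L
  exact LieModule.IsNilpotent.mk (R := ℝ) (k := c) _ (quotient_lcs_eq_bot I hc)

variable {c : ℕ} (hc : LieModule.lowerCentralSeries ℝ L L c = ⊥)
include hc

/-- Modulo `lcs L (k + 1)` the element `z` is central, so adding it is the same as multiplying by it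
on the right, and associativity moves it out of the product. -/
theorem bch_add_sub_mem {k : ℕ} {z : L} (hz : z ∈ lcs L k) (a x : L) :
    bch c a (x + z) - bch c a x - z ∈ lcs L (k + 1) := by
  have := isNilpotent_quotient (LieModule.lowerCentralSeries ℝ L L (k + 1))
  have hcQ := quotient_lcs_eq_bot (LieModule.lowerCentralSeries ℝ L L (k + 1)) hc
  set q := quotientHom (LieModule.lowerCentralSeries ℝ L L (k + 1)) with hq
  have hcent : ∀ u : L ⧸ LieModule.lowerCentralSeries ℝ L L (k + 1), ⁅u, q z⁆ = 0 := by
    intro u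
    obtain ⟨u, rfl⟩ := quotientHom_surjective _ u
    rw [← hq, ← LieHom.map_lie]
    exact quotientHom_eq_zero.mpr (lie_mem_lcs_succ u hz)
  refine quotientHom_eq_zero.mp ?_
  rw [← hq, map_sub, map_sub, map_bch, map_bch, map_add, ← (bch_central hcQ (q x) hcent).1,
    ← bch_assoc hcQ, (bch_central hcQ _ hcent).1]
  abel

theorem bch_sub_mem {k : ℕ} {z : L} (hz : z ∈ lcs L k) (a : L) :
    bch c a z - a - z ∈ lcs L (k + 1) := by
  have := bch_add_sub_mem hc hz a 0
  rwa [zero_add, bch_zero_right hc] at this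

/-- The group commutator agrees with the bracket to leading order. Modulo `lcs L (k + 2)` double
brackets ending in `y` vanish, so the products of `x` and `y` are given by their quadratic parts. -/
theorem bch_commutator_sub_mem {k : ℕ} {y : L} (hy : y ∈ lcs L k) (x : L) :
    bch c (bch c x y) (-bch c y x) - ⁅x, y⁆ ∈ lcs L (k + 2) := by
  have := isNilpotent_quotient (LieModule.lowerCentralSeries ℝ L L (k + 2))
  have hcQ := quotient_lcs_eq_bot (LieModule.lowerCentralSeries ℝ L L (k + 2)) hc
  set q := quotientHom (LieModule.lowerCentralSeries ℝ L L (k + 2)) with hq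
  have hcent : ∀ u v : L ⧸ LieModule.lowerCentralSeries ℝ L L (k + 2), ⁅u, ⁅v, q y⁆⁆ = 0 := by
    intro u v
    obtain ⟨u, rfl⟩ := quotientHom_surjective _ u
    obtain ⟨v, rfl⟩ := quotientHom_surjective _ v
    rw [← hq, ← LieHom.map_lie, ← LieHom.map_lie]
    exact quotientHom_eq_zero.mpr (lie_mem_lcs_succ u (lie_mem_lcs_succ v hy))
  have h2 := bch_of_lie_lie_eq_zero hcQ (q x) hcent
  -- The two quadratic parts differ by exactly the bracket, which is central in the quotient and so
  -- can be split off as a factor.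
  have h3 : bch c (q x) (q y) = bch c ⁅q x, q y⁆ (bch c (q y) (q x)) := by
    rw [(bch_central hcQ (bch c (q y) (q x)) (fun u => hcent u (q x))).2, h2.1, h2.2,
      ← lie_skew (q y) (q x)]
    module
  have h4 : ∀ u : L ⧸ LieModule.lowerCentralSeries ℝ L L (k + 2), bch c u (-u) = 0 := fun u => by
    have := bch_neg_left hcQ (-u)
    rwa [neg_neg] at this
  refine quotientHom_eq_zero.mp ?_
  rw [← hq, map_sub, map_bch, map_bch, map_neg, map_bch, LieHom.map_lie, h3, bch_assoc hcQ, h4,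
    bch_zero_right hcQ, sub_self]

end Congruence

/-! ### Left translations preserve Lebesgue measure in adapted coordinates -/

section Volume

open MeasureTheory

variable {ι : Type*} [Fintype ι] {𝔤 : Type*} [LieRing 𝔤] [LieAlgebra ℝ 𝔤]
  (b : Module.Basis ι ℝ 𝔤)

theorem differentiable_lie {E : Type*} [NormedAddCommGroup E] [NormedSpace ℝ E] {f g : E → 𝔤}
    (hf : Differentiable ℝ fun u => b.equivFun (f u))
    (hg : Differentiable ℝ fun u => b.equivFun (g u)) :
    Differentiable ℝ fun u => b.equivFun ⁅f u, g u⁆ := by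
  have h : ∀ u, b.equivFun ⁅f u, g u⁆ =
      ∑ i, ∑ j, (b.equivFun (g u) i * b.equivFun (f u) j) • b.equivFun ⁅b j, b i⁆ := by
    intro u
    conv_lhs => rw [← b.sum_equivFun (f u), ← b.sum_equivFun (g u)]
    simp only [sum_lie, lie_sum, smul_lie, lie_smul, map_sum, map_smul, Finset.smul_sum, smul_smul]
  simp only [h]
  rw [differentiable_pi] at hf hg
  fun_prop

theorem differentiable_lieWord {E : Type*} [NormedAddCommGroup E] [NormedSpace ℝ E] :
    ∀ {l : List (E → 𝔤)}, (∀ f ∈ l, Differentiable ℝ fun u => b.equivFun (f u)) →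
      Differentiable ℝ fun u => b.equivFun (lieWord (l.map fun f => f u))
  | [], _ => by simp [lieWord]
  | [f], h => h f (by simp)
  | f :: g :: l, h => by
    have := differentiable_lieWord (l := g :: l) fun f hf => h f (by simp at hf ⊢; tauto)
    exact differentiable_lie b (h f (by simp)) this

theorem differentiable_bch (N : ℕ) {E : Type*} [NormedAddCommGroup E] [NormedSpace ℝ E]
    {f g : E → 𝔤} (hf : Differentiable ℝ fun u => b.equivFun (f u))
    (hg : Differentiable ℝ fun u => b.equivFun (g u)) :
    Differentiable ℝ fun u => b.equivFun (bch N (f u) (g u)) := by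
  simp only [bch_eq_sum, map_sum, map_smul]
  refine Differentiable.fun_sum fun k _ => Differentiable.fun_sum fun p _ => ?_
  suffices hw : Differentiable ℝ fun u => b.equivFun (lieWord (word p (f u) (g u))) from
    hw.fun_const_smul _
  have h : ∀ u, word p (f u) (g u) = (word p f g).map fun f => f u := fun u =>
    (word_map (fun f : E → 𝔤 => f u) p f g).symm
  simp only [h]
  refine differentiable_lieWord b fun f' hf' => ?_
  rcases mem_word hf' with rfl | rfl <;> assumption

/-- Left multiplication of `exp 𝔤` in coordinates. -/
noncomputable def leftMul [LieRing.IsNilpotent 𝔤] (g : ExpGroup 𝔤) (u : ι → ℝ) : ι → ℝ :=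
  b.equivFun (g * .exp (b.equivFun.symm u)).log

variable {b} {w : ι → ℕ}

theorem leftMul_injective [LieRing.IsNilpotent 𝔤] (g : ExpGroup 𝔤) :
    Function.Injective (leftMul b g) := by
  intro u v h
  have h1 := mul_left_cancel (ExpGroup.ext (b.equivFun.injective h))
  exact b.equivFun.symm.injective (congrArg ExpGroup.log h1)

theorem differentiable_leftMul [LieRing.IsNilpotent 𝔤] (g : ExpGroup 𝔤) :
    Differentiable ℝ (leftMul b g) :=
  differentiable_bch b _ (f := fun _ => g.log) (g := b.equivFun.symm) (differentiable_const _)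
    (by simp only [LinearEquiv.apply_symm_apply]; exact differentiable_id)

/-- This is `bch_add_sub_mem` in coordinates, and the source of the triangular shape of the Jacobian
matrix. -/
theorem IsAdapted.leftMul_apply_add [LieRing.IsNilpotent 𝔤] (h : IsAdapted b w) (g : ExpGroup 𝔤)
    (u v : ι → ℝ) {k : ℕ} (hv : b.equivFun.symm v ∈ lcs 𝔤 k) {i : ι} (hi : w i ≤ k) :
    leftMul b g (u + v) i = leftMul b g u i + v i := by
  have h1 := (h _ _).mp (bch_add_sub_mem lcs_nilpotencyLength hv g.log (b.equivFun.symm u)) i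
    (Nat.lt_succ_of_le hi)
  rw [← map_add, map_sub, map_sub, Finsupp.sub_apply, Finsupp.sub_apply] at h1
  have h2 : b.repr (b.equivFun.symm v) i = v i := congrFun (b.equivFun.apply_symm_apply v) i
  rw [h2] at h1
  change b.repr _ i = b.repr _ i + v i
  rw [ExpGroup.log_mul, ExpGroup.log_mul]
  linarith

/-- Translation in the direction `b j` moves the coordinates of weight at most `w j` exactly as
addition does. Hence the Jacobian matrix is block triangular with identity diagonal blocks. -/
theorem IsAdapted.det_fderiv_leftMul [LieRing.IsNilpotent 𝔤] (h : IsAdapted b w)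
    (g : ExpGroup 𝔤) (u : ι → ℝ) : (fderiv ℝ (leftMul b g) u).det = 1 := by
  classical
  have hentry : ∀ i j, w i ≤ w j →
      fderiv ℝ (leftMul b g) u (Pi.single j 1) i = (1 : Matrix ι ι ℝ) i j := by
    intro i j hij
    have hmem : ∀ s : ℝ, b.equivFun.symm (s • Pi.single j 1) ∈ lcs 𝔤 (w j) := by
      intro s
      rw [map_smul, Module.Basis.equivFun_symm_apply]
      refine Submodule.smul_mem _ _ ?_
      simpa [Pi.single_apply] using h.basis_mem (le_refl (w j))
    have h1 : HasDerivAt (fun s : ℝ => leftMul b g (u + s • Pi.single j 1) i)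
        (fderiv ℝ (leftMul b g) u (Pi.single j 1) i) 0 := by
      have hd := ((differentiable_leftMul (b := b) g) u).hasFDerivAt
      have hl := hd.hasLineDerivAt (Pi.single j 1)
      exact (hasDerivAt_pi.mp hl) i
    have h2 : HasDerivAt (fun s : ℝ => leftMul b g (u + s • Pi.single j 1) i)
        ((Pi.single j (1 : ℝ) : ι → ℝ) i) 0 := by
      simp only [h.leftMul_apply_add g u _ (hmem _) hij, Pi.smul_apply, smul_eq_mul]
      simpa using ((hasDerivAt_id (0 : ℝ)).mul_const ((Pi.single j (1 : ℝ) : ι → ℝ) i)).const_add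
        (leftMul b g u i)
    rw [h1.unique h2, Matrix.one_apply, Pi.single_apply]
  rw [ContinuousLinearMap.det, ← LinearMap.det_toMatrix']
  set M := LinearMap.toMatrix' (fderiv ℝ (leftMul b g) u : (ι → ℝ) →ₗ[ℝ] (ι → ℝ)) with hM
  have hMij : ∀ i j, w i ≤ w j → M i j = (1 : Matrix ι ι ℝ) i j := by
    intro i j hij
    rw [← hentry i j hij, hM, LinearMap.toMatrix'_apply]
    rfl
  -- The order on weights is reversed because entries vanish when the row has the smaller weight.
  have htri : M.BlockTriangular (OrderDual.toDual ∘ w) := by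
    intro i j hij
    have hij' : w i < w j := hij
    rw [hMij i j hij'.le, Matrix.one_apply_ne]
    rintro rfl
    exact lt_irrefl _ hij'
  rw [htri.det]
  refine Finset.prod_eq_one fun a _ => ?_
  have : M.toSquareBlock (OrderDual.toDual ∘ w) a = 1 := by
    ext i j
    rw [Matrix.toSquareBlock_def, Matrix.of_apply, hMij]
    · simp [Matrix.one_apply, Subtype.ext_iff]
    · exact (OrderDual.toDual.injective (i.2.trans j.2.symm)).le
  rw [this, Matrix.det_one]

theorem IsAdapted.volume_leftMul_image [LieRing.IsNilpotent 𝔤] (h : IsAdapted b w)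
    (g : ExpGroup 𝔤) {s : Set (ι → ℝ)} (hs : MeasurableSet s) :
    volume (leftMul b g '' s) = volume s := by
  rw [← lintegral_abs_det_fderiv_eq_addHaar_image volume hs
    (fun u _ => ((differentiable_leftMul g) u).hasFDerivAt.hasFDerivWithinAt)
    (leftMul_injective g).injOn]
  simp [h.det_fderiv_leftMul g]

end Volume

/-! ### Word balls -/

section WordBall

variable {G : Type*} [Group G] {S T : Set G} {m n : ℕ}

theorem wordBall_mono (hST : S ⊆ T) (hmn : m ≤ n) : wordBall S m ⊆ wordBall T n := by
  rintro _ ⟨l, hl, hS, rfl⟩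
  exact ⟨l, hl.trans hmn, fun s hs => hST (hS s hs), rfl⟩

theorem one_mem_wordBall : (1 : G) ∈ wordBall S n := ⟨[], by simp, by simp, rfl⟩

theorem mem_wordBall_one {g : G} (hg : g ∈ S) : g ∈ wordBall S 1 :=
  ⟨[g], by simp, by simpa using hg, by simp⟩

theorem mul_mem_wordBall {g h : G} (hg : g ∈ wordBall S m) (hh : h ∈ wordBall S n) :
    g * h ∈ wordBall S (m + n) := by
  obtain ⟨l, hl, hS, rfl⟩ := hg
  obtain ⟨l', hl', hS', rfl⟩ := hh
  refine ⟨l ++ l', by simp; omega, fun s hs => ?_, List.prod_append⟩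
  rcases List.mem_append.mp hs with h | h
  exacts [hS s h, hS' s h]

theorem inv_mem_wordBall (hS : ∀ s ∈ S, s⁻¹ ∈ S) {g : G} (hg : g ∈ wordBall S n) :
    g⁻¹ ∈ wordBall S n := by
  obtain ⟨l, hl, hlS, rfl⟩ := hg
  refine ⟨(l.map (·⁻¹)).reverse, by simpa using hl, fun s hs => ?_, List.prod_inv_reverse l |>.symm⟩
  obtain ⟨t, ht, rfl⟩ := List.mem_map.mp (List.mem_reverse.mp hs)
  exact hS t (hlS t ht)

theorem pow_mem_wordBall {g : G} (hg : g ∈ S) (n : ℕ) : g ^ n ∈ wordBall S n :=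
  ⟨List.replicate n g, by simp, fun s hs => by rwa [List.eq_of_mem_replicate hs], by simp⟩

theorem wordBall_subset_wordBall_mul (h : S ⊆ wordBall T m) :
    wordBall S n ⊆ wordBall T (m * n) := by
  rintro _ ⟨l, hl, hS, rfl⟩
  refine wordBall_mono subset_rfl (Nat.mul_le_mul_left m hl) ?_
  clear hl
  induction l with
  | nil => exact one_mem_wordBall
  | cons a l ih =>
    rw [List.prod_cons, List.length_cons, mul_add, mul_one, add_comm]
    exact mul_mem_wordBall (h (hS a (by simp))) (ih fun s hs => hS s (by simp [hs]))

theorem finite_wordBall (hS : S.Finite) (n : ℕ) : (wordBall S n).Finite := by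
  induction n with
  | zero =>
    refine (Set.finite_singleton (1 : G)).subset ?_
    rintro _ ⟨l, hl, -, rfl⟩
    simp [List.length_eq_zero_iff.mp (Nat.le_zero.mp hl)]
  | succ n ih =>
    refine ((Set.finite_singleton (1 : G)).union (hS.mul ih)).subset ?_
    rintro _ ⟨l, hl, hlS, rfl⟩
    cases l with
    | nil => exact Or.inl rfl
    | cons a l =>
      refine Or.inr ⟨a, hlS a (by simp), l.prod, ⟨l, ?_, fun s hs => hlS s (by simp [hs]), rfl⟩,
        List.prod_cons.symm⟩
      simpa using hl

theorem exists_mem_wordBall_of_closure_eq_top (hS : ∀ s ∈ S, s⁻¹ ∈ S)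
    (h : Subgroup.closure S = ⊤) (g : G) : ∃ n, g ∈ wordBall S n := by
  have hg : g ∈ Subgroup.closure S := by rw [h]; trivial
  induction hg using Subgroup.closure_induction with
  | mem x hx => exact ⟨1, mem_wordBall_one hx⟩
  | one => exact ⟨0, one_mem_wordBall⟩
  | mul x y _ _ hx hy =>
    obtain ⟨m, hm⟩ := hx
    obtain ⟨n, hn⟩ := hy
    exact ⟨m + n, mul_mem_wordBall hm hn⟩
  | inv x _ hx =>
    obtain ⟨n, hn⟩ := hx
    exact ⟨n, inv_mem_wordBall hS hn⟩

end WordBall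

/-! ### Uniqueness of the growth degree -/

section GrowthDegree

variable {G : Type*} [Group G]

/-- The generators of one set are words of bounded length in the other, so n^d is bounded by a
constant multiple of n^e. -/
theorem HasGrowthDegree.le {d e : ℕ} (hd : HasGrowthDegree G d) (he : HasGrowthDegree G e) :
    d ≤ e := by
  obtain ⟨S, hS, hSgen, -, C, hC, hlow⟩ := hd
  obtain ⟨T, hT, hTgen, ⟨K, hK, hup⟩, -⟩ := he
  have hm : ∃ m, (S : Set G) ⊆ wordBall (T : Set G) m := by
    choose f hf using exists_mem_wordBall_of_closure_eq_top (S := (T : Set G)) hT hTgen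
    exact ⟨S.sup f, fun s hs => wordBall_mono subset_rfl (Finset.le_sup (f := f) hs) (hf s)⟩
  obtain ⟨m, hm⟩ := hm
  have hm' : (S : Set G) ⊆ wordBall (T : Set G) (m + 1) :=
    hm.trans (wordBall_mono subset_rfl (Nat.le_succ m))
  have key : ∀ n, 1 ≤ n → n ^ d ≤ (C * K * (K * ((m + 1) * C)) ^ e) * n ^ e := by
    intro n hn
    calc n ^ d ≤ C * (wordBall (S : Set G) (C * n)).ncard := hlow n hn
      _ ≤ C * (wordBall (T : Set G) ((m + 1) * (C * n))).ncard := by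
        gcongr
        · exact finite_wordBall T.finite_toSet _
        · exact wordBall_subset_wordBall_mul hm'
      _ ≤ C * (K * (K * ((m + 1) * (C * n))) ^ e) := by
        gcongr
        exact hup _ (Nat.mul_pos (Nat.succ_pos m) (Nat.mul_pos hC hn))
      _ = C * (K * (K * ((m + 1) * C) * n) ^ e) := by ring_nf
      _ = _ := by rw [mul_pow]; ring
  by_contra hlt
  set A := C * K * (K * ((m + 1) * C)) ^ e
  -- If d > e, the choice n = A + 1 would give (A + 1)^(e + 1) ≤ A · (A + 1)^e.
  have h1 := key (A + 1) (by omega)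
  have h2 : (A + 1) * (A + 1) ^ e ≤ (A + 1) ^ d := by
    rw [← pow_succ']
    exact Nat.pow_le_pow_right (by omega) (by omega)
  have h3 := Nat.le_of_mul_le_mul_right (h2.trans h1) (by positivity)
  omega

theorem HasGrowthDegree.growthDegree_eq {d : ℕ} (h : HasGrowthDegree G d) :
    growthDegree G = d := by
  have : {e | HasGrowthDegree G e} = {d} :=
    Set.eq_singleton_iff_unique_mem.mpr ⟨h, fun e he => le_antisymm (he.le h) (h.le he)⟩
  rw [growthDegree, this, csInf_singleton]

end GrowthDegree

/-! ### Products of horizontal elements, uniformly in the scale -/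

section Reach

variable {ι : Type*} [Fintype ι] {𝔤 : Type*} [LieRing 𝔤] [LieAlgebra ℝ 𝔤]
  {b : Module.Basis ι ℝ 𝔤} {w : ι → ℕ}

/-- The elements of the form `exp v` with `v` of weight one and of gauge at most `R`. -/
def horizontal (b : Module.Basis ι ℝ 𝔤) (w : ι → ℕ) (r : ℕ) (R : ℝ) : Set (ExpGroup 𝔤) :=
  {g | (∀ i, w i ≠ 0 → b.repr g.log i = 0) ∧ gauge b w r g.log ≤ R}

theorem horizontal_mono {r : ℕ} {R R' : ℝ} (h : R ≤ R') :
    horizontal b w r R ⊆ horizontal b w r R' := fun _ hg => ⟨hg.1, hg.2.trans h⟩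

theorem gauge_smul_of_horizontal {r : ℕ} (hr : 1 ≤ r) {v : 𝔤}
    (hv : ∀ i, w i ≠ 0 → b.repr v i = 0) :
    gauge b w r ((r : ℝ) • v) = gauge b w 1 v := by
  have hr' : (0 : ℝ) < r := by exact_mod_cast hr
  rw [gauge_apply, gauge_one]
  refine Finset.sum_congr rfl fun i _ => ?_
  rw [map_smul, Finsupp.smul_apply, smul_eq_mul, abs_mul]
  by_cases hi : w i = 0
  · rw [hi, zero_add, pow_one, abs_of_pos hr']
    field_simp
  · rw [hv i hi]
    simp

theorem IsAdapted.exists_horizontal_add (h : IsAdapted b w) (x : 𝔤) :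
    ∃ v, (∀ i, w i ≠ 0 → b.repr v i = 0) ∧ x - v ∈ lcs 𝔤 1 := by
  classical
  refine ⟨∑ i, (if w i = 0 then b.repr x i else 0) • b i, fun i hi => ?_, ?_⟩
  · rw [b.repr_sum_self, if_neg hi]
  · rw [h]
    intro i hi
    rw [map_sub, Finsupp.sub_apply, b.repr_sum_self, if_pos (by omega), sub_self]

variable [LieRing.IsNilpotent 𝔤]

theorem ExpGroup.exp_pow (x : 𝔤) (n : ℕ) :
    (ExpGroup.exp x) ^ n = ExpGroup.exp ((n : ℝ) • x) := by
  induction n with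
  | zero => rw [pow_zero, Nat.cast_zero, zero_smul]; rfl
  | succ n ih =>
    rw [pow_succ, ih]
    refine ExpGroup.ext ?_
    have := bch_smul_smul lcs_nilpotencyLength (n : ℝ) 1 x
    rw [one_smul] at this
    rw [ExpGroup.log_mul, Nat.cast_succ]
    exact this

/-- `K` does not depend on `r`, since the bracket constant does not. The coefficient 1 on the first
factor matters: it lets the errors of a long product add up linearly instead of multiplying. -/
theorem IsAdapted.exists_gauge_mul_le (h : IsAdapted b w) (R : ℝ) :
    ∃ K : ℝ, 0 ≤ K ∧ ∀ r : ℕ, 1 ≤ r → ∀ g k : ExpGroup 𝔤, gauge b w r g.log ≤ R →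
      gauge b w r k.log ≤ R →
      gauge b w r (g * k).log ≤ gauge b w r g.log + K * gauge b w r k.log := by
  obtain ⟨C, hC, hlie⟩ := h.exists_gauge_lie_le
  have hc := lcs_nilpotencyLength (𝔤 := 𝔤)
  refine ⟨bchConst (LieModule.nilpotencyLength 𝔤 𝔤) (C * max R 1),
    bchConst_nonneg _ (by positivity), fun r hr g k hg hk => ?_⟩
  have h1 := seminorm_bch_sub_le (LieModule.nilpotencyLength 𝔤 𝔤) hC (hlie r hr)
    (le_max_right R 1) (hg.trans (le_max_left R 1)) (hk.trans (le_max_left R 1))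
  rw [bch_zero_right hc, ← ExpGroup.log_mul] at h1
  have h2 := map_add_le_add (gauge b w r) g.log ((g * k).log - g.log)
  rw [add_sub_cancel] at h2
  linarith

theorem inv_mem_horizontal {r : ℕ} {R : ℝ} :
    ∀ g ∈ horizontal b w r R, g⁻¹ ∈ horizontal b w r R := fun g hg => by
  refine ⟨fun i hi => ?_, ?_⟩
  · rw [ExpGroup.log_inv, map_neg, Finsupp.neg_apply, hg.1 i hi, neg_zero]
  · rw [ExpGroup.log_inv, map_neg_eq_map]
    exact hg.2

/-- A horizontal element at scale `r` is the r-th power of one at scale 1, because coordinates of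
lowest weight scale linearly. -/
theorem horizontal_subset_wordBall {r : ℕ} (hr : 1 ≤ r) (R : ℝ) :
    horizontal b w r R ⊆ wordBall (horizontal b w 1 R) r := by
  rintro ⟨x⟩ ⟨hx, hR⟩
  have hr' : (r : ℝ) ≠ 0 := by positivity
  simp only at hx hR
  have hx' : ∀ i, w i ≠ 0 → b.repr ((r : ℝ)⁻¹ • x) i = 0 := fun i hi => by
    rw [map_smul, Finsupp.smul_apply, hx i hi, smul_zero]
  have hxx : (r : ℝ) • (r : ℝ)⁻¹ • x = x := smul_inv_smul₀ hr' x
  have hmem : ExpGroup.exp ((r : ℝ)⁻¹ • x) ∈ horizontal b w 1 R := by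
    refine ⟨hx', ?_⟩
    rwa [← gauge_smul_of_horizontal hr hx', hxx]
  have := pow_mem_wordBall hmem r
  rwa [ExpGroup.exp_pow, hxx] at this

theorem IsAdapted.exists_gauge_wordBall_le (h : IsAdapted b w) (M : ℕ) (R : ℝ) :
    ∃ B : ℝ, ∀ r : ℕ, 1 ≤ r → ∀ g ∈ wordBall (horizontal b w r R) M, gauge b w r g.log ≤ B := by
  induction M with
  | zero =>
    refine ⟨0, fun r hr g hg => ?_⟩
    obtain ⟨l, hl, -, rfl⟩ := hg
    rw [List.length_eq_zero_iff.mp (Nat.le_zero.mp hl), List.prod_nil, ExpGroup.log_one, map_zero]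
  | succ M ih =>
    obtain ⟨B, hB⟩ := ih
    obtain ⟨K, hK, hmul⟩ := h.exists_gauge_mul_le (max B R)
    refine ⟨max 0 (R + K * B), fun r hr g hg => ?_⟩
    obtain ⟨l, hl, hlS, rfl⟩ := hg
    cases l with
    | nil =>
      rw [List.prod_nil, ExpGroup.log_one, map_zero]
      exact le_max_left _ _
    | cons a l =>
      have ha := (hlS a (by simp)).2
      have hl' := hB r hr l.prod ⟨l, by simpa using hl, fun s hs => hlS s (by simp [hs]), rfl⟩
      have := hmul r hr a l.prod (ha.trans (le_max_right _ _)) (hl'.trans (le_max_left _ _))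
      rw [List.prod_cons]
      refine le_max_of_le_right (this.trans ?_)
      gcongr

/-- The element `z` of the lower central series is reached, modulo the next term and uniformly in
the scale `r`, by a bounded number of horizontal elements. -/
def IsReachable (b : Module.Basis ι ℝ 𝔤) (w : ι → ℕ) (k : ℕ) (z : 𝔤) : Prop :=
  z ∈ lcs 𝔤 k ∧ ∀ R : ℝ, ∃ (M : ℕ) (R' : ℝ), ∀ r : ℕ, 1 ≤ r → ∀ t : ℝ, |t| ≤ R →
    ∃ g ∈ wordBall (horizontal b w r R') M,
      g.log - (t * (r : ℝ) ^ (k + 1)) • z ∈ lcs 𝔤 (k + 1)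

theorem log_mul_sub_mem {k : ℕ} {g h : ExpGroup 𝔤} (hh : h.log ∈ lcs 𝔤 k) :
    (g * h).log - g.log - h.log ∈ lcs 𝔤 (k + 1) :=
  bch_sub_mem lcs_nilpotencyLength hh g.log

theorem isReachable_of_mem {k : ℕ} {z : 𝔤} (hz : z ∈ lcs 𝔤 (k + 1)) : IsReachable b w k z := by
  refine ⟨lcs_succ_le 𝔤 k hz, fun R => ⟨0, 0, fun r _ t _ => ⟨1, one_mem_wordBall, ?_⟩⟩⟩
  rw [ExpGroup.log_one, zero_sub]
  exact Submodule.neg_mem _ (Submodule.smul_mem _ _ hz)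

theorem IsReachable.add {k : ℕ} {y z : 𝔤} (hy : IsReachable b w k y) (hz : IsReachable b w k z) :
    IsReachable b w k (y + z) := by
  refine ⟨Submodule.add_mem _ hy.1 hz.1, fun R => ?_⟩
  obtain ⟨M₁, R₁, h₁⟩ := hy.2 R
  obtain ⟨M₂, R₂, h₂⟩ := hz.2 R
  refine ⟨M₁ + M₂, max R₁ R₂, fun r hr t ht => ?_⟩
  obtain ⟨g, hg, hgy⟩ := h₁ r hr t ht
  obtain ⟨h, hh, hhz⟩ := h₂ r hr t ht
  have hhk : h.log ∈ lcs 𝔤 k := by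
    have := Submodule.add_mem _ (lcs_succ_le 𝔤 k hhz)
      (Submodule.smul_mem _ (t * (r : ℝ) ^ (k + 1)) hz.1)
    rwa [sub_add_cancel] at this
  refine ⟨g * h, mul_mem_wordBall (wordBall_mono (horizontal_mono (le_max_left _ _)) le_rfl hg)
    (wordBall_mono (horizontal_mono (le_max_right _ _)) le_rfl hh), ?_⟩
  have := Submodule.add_mem _ (Submodule.add_mem _ (log_mul_sub_mem (g := g) hhk) hgy) hhz
  convert this using 1
  rw [smul_add]
  abel

theorem IsReachable.smul {k : ℕ} {z : 𝔤} (hz : IsReachable b w k z) (s : ℝ) :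
    IsReachable b w k (s • z) := by
  refine ⟨Submodule.smul_mem _ s hz.1, fun R => ?_⟩
  -- The scalar `s` is absorbed into the coefficient `t`, whose bound grows by the factor `|s|`.
  obtain ⟨M, R', h⟩ := hz.2 (R * |s|)
  refine ⟨M, R', fun r hr t ht => ?_⟩
  obtain ⟨g, hg, hgz⟩ := h r hr (t * s) (by rw [abs_mul]; gcongr)
  refine ⟨g, hg, ?_⟩
  rwa [smul_smul, mul_right_comm]

theorem isReachable_horizontal {v : 𝔤} (hv : ∀ i, w i ≠ 0 → b.repr v i = 0) :
    IsReachable b w 0 v := by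
  refine ⟨trivial, fun R => ⟨1, R * gauge b w 1 v, fun r hr t ht =>
    ⟨.exp ((t * (r : ℝ) ^ (0 + 1)) • v), mem_wordBall_one ⟨fun i hi => ?_, ?_⟩, ?_⟩⟩⟩
  · rw [map_smul, Finsupp.smul_apply, hv i hi, smul_zero]
  · rw [zero_add, pow_one, mul_smul, map_smul_eq_mul, gauge_smul_of_horizontal hr hv]
    exact mul_le_mul_of_nonneg_right ht (apply_nonneg _ _)
  · rw [sub_self]
    exact Submodule.zero_mem _

/-- The group commutator of `exp (r v)` with an element of leading part t r^(k+1) z has leading part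
t r^(k+2) ⁅v, z⁆ by `bch_commutator_sub_mem`; the extra power of `r` is the one required one step
deeper. -/
theorem IsReachable.lie {k : ℕ} {v z : 𝔤} (hv : ∀ i, w i ≠ 0 → b.repr v i = 0)
    (hz : IsReachable b w k z) : IsReachable b w (k + 1) ⁅v, z⁆ := by
  refine ⟨lie_mem_lcs_succ v hz.1, fun R => ?_⟩
  obtain ⟨M, R', h⟩ := hz.2 R
  refine ⟨1 + M + (M + 1), max (gauge b w 1 v) R', fun r hr t ht => ?_⟩
  obtain ⟨g, hg, hgz⟩ := h r hr t ht
  have hgk : g.log ∈ lcs 𝔤 k := by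
    have := Submodule.add_mem _ (lcs_succ_le 𝔤 k hgz)
      (Submodule.smul_mem _ (t * (r : ℝ) ^ (k + 1)) hz.1)
    rwa [sub_add_cancel] at this
  set a : ExpGroup 𝔤 := .exp ((r : ℝ) • v) with ha
  have hamem : a ∈ wordBall (horizontal b w r (max (gauge b w 1 v) R')) 1 := by
    refine mem_wordBall_one ⟨fun i hi => ?_, ?_⟩
    · change b.repr ((r : ℝ) • v) i = 0
      rw [map_smul, Finsupp.smul_apply, hv i hi, smul_zero]
    · exact (gauge_smul_of_horizontal hr hv).le.trans (le_max_left _ _)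
  have hgmem := wordBall_mono (n := M) (horizontal_mono (le_max_right (gauge b w 1 v) R')) le_rfl hg
  refine ⟨a * g * (g * a)⁻¹, mul_mem_wordBall (mul_mem_wordBall hamem hgmem)
    (inv_mem_wordBall inv_mem_horizontal (mul_mem_wordBall hgmem hamem)), ?_⟩
  have h1 : (a * g * (g * a)⁻¹).log - ⁅(r : ℝ) • v, g.log⁆ ∈ lcs 𝔤 (k + 2) :=
    bch_commutator_sub_mem lcs_nilpotencyLength hgk _
  have h2 := Submodule.add_mem _ h1 (lie_mem_lcs_succ ((r : ℝ) • v) hgz)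
  convert h2 using 1
  rw [lie_sub, lie_smul, smul_lie, smul_lie, smul_smul, pow_succ, ← mul_assoc]
  abel

/-- The series is spanned by brackets ⁅u, y⁆, and `u` may be replaced by a horizontal vector, since
the change in the bracket lies one term deeper. -/
theorem IsAdapted.isReachable (h : IsAdapted b w) {k : ℕ} {z : 𝔤} (hz : z ∈ lcs 𝔤 k) :
    IsReachable b w k z := by
  induction k generalizing z with
  | zero =>
    obtain ⟨v, hv, hx⟩ := h.exists_horizontal_add z
    have := (isReachable_horizontal hv).add (isReachable_of_mem (b := b) (w := w) hx)
    rwa [add_sub_cancel] at this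
  | succ k ih =>
    rw [lcs, LieModule.lowerCentralSeries_succ, LieSubmodule.lieIdeal_oper_eq_linear_span'] at hz
    induction hz using Submodule.span_induction with
    | zero => exact isReachable_of_mem (Submodule.zero_mem _)
    | add x y _ _ hx hy => exact hx.add hy
    | smul s x _ hx => exact hx.smul s
    | mem x hx =>
      obtain ⟨u, -, y, hy, rfl⟩ := hx
      obtain ⟨v, hv, hu⟩ := h.exists_horizontal_add u
      have h1 := lie_mem_lcs hu (show y ∈ lcs 𝔤 k from hy)
      rw [show 1 + k + 1 = k + 1 + 1 by omega] at h1
      have := ((ih hy).lie hv).add (isReachable_of_mem (b := b) (w := w) h1)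
      rwa [← add_lie, add_sub_cancel] at this

/-- `IsReachable` fixes the vector before the bounds are chosen. Here the coefficients vary
independently, so one `M` and one `R'` serve all bounded combinations of finitely many vectors. -/
theorem exists_reach_sum {κ : Type*} (s : Finset κ) {k : ℕ} {z : κ → 𝔤}
    (hz : ∀ i ∈ s, IsReachable b w k (z i)) (R : ℝ) :
    ∃ (M : ℕ) (R' : ℝ), ∀ r : ℕ, 1 ≤ r → ∀ t : κ → ℝ, (∀ i, |t i| ≤ R) →
      ∃ g ∈ wordBall (horizontal b w r R') M,
        g.log - ∑ i ∈ s, (t i * (r : ℝ) ^ (k + 1)) • z i ∈ lcs 𝔤 (k + 1) := by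
  classical
  induction s using Finset.induction_on with
  | empty =>
    refine ⟨0, 0, fun r _ t _ => ⟨1, one_mem_wordBall, ?_⟩⟩
    rw [ExpGroup.log_one, Finset.sum_empty, sub_zero]
    exact Submodule.zero_mem _
  | insert a s ha ih =>
    obtain ⟨M₁, R₁, h₁⟩ := (hz a (by simp)).2 R
    obtain ⟨M₂, R₂, h₂⟩ := ih fun i hi => hz i (by simp [hi])
    refine ⟨M₂ + M₁, max R₂ R₁, fun r hr t ht => ?_⟩
    obtain ⟨g, hg, hgy⟩ := h₂ r hr t ht
    obtain ⟨h, hh, hhz⟩ := h₁ r hr (t a) (ht a)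
    have hhk : h.log ∈ lcs 𝔤 k := by
      have := Submodule.add_mem _ (lcs_succ_le 𝔤 k hhz)
        (Submodule.smul_mem _ (t a * (r : ℝ) ^ (k + 1)) (hz a (by simp)).1)
      rwa [sub_add_cancel] at this
    refine ⟨g * h, mul_mem_wordBall (wordBall_mono (horizontal_mono (le_max_left _ _)) le_rfl hg)
      (wordBall_mono (horizontal_mono (le_max_right _ _)) le_rfl hh), ?_⟩
    have := Submodule.add_mem _ (Submodule.add_mem _ (log_mul_sub_mem (g := g) hhk) hgy) hhz
    convert this using 1
    rw [Finset.sum_insert ha]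
    abel

/-- Elements of bounded gauge are products of a bounded number of bounded horizontal elements,
uniformly in the scale. -/
theorem IsAdapted.exists_subset_wordBall_horizontal (h : IsAdapted b w) (R : ℝ) :
    ∃ (M : ℕ) (R' : ℝ), ∀ r : ℕ, 1 ≤ r → ∀ g : ExpGroup 𝔤, gauge b w r g.log ≤ R →
      g ∈ wordBall (horizontal b w r R') M := by
  have hc := lcs_nilpotencyLength (𝔤 := 𝔤)
  set c := LieModule.nilpotencyLength 𝔤 𝔤 with hcdef
  -- Descending induction on `k`: the coordinates of weight `k` are matched by a bounded product
  -- `q`, and `q⁻¹ * g` lies one term deeper with gauge still bounded uniformly in `r`.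
  have key : ∀ j k, k + j = c → ∀ R : ℝ, ∃ (M : ℕ) (R' : ℝ), ∀ r : ℕ, 1 ≤ r →
      ∀ g : ExpGroup 𝔤, g.log ∈ lcs 𝔤 k → gauge b w r g.log ≤ R →
      g ∈ wordBall (horizontal b w r R') M := by
    intro j
    induction j with
    | zero =>
      intro k hk R
      refine ⟨0, 0, fun r _ g hg _ => ?_⟩
      rw [add_zero] at hk
      rw [lcs, hk, hc] at hg
      have : g = 1 := ExpGroup.ext hg
      rw [this]
      exact one_mem_wordBall
    | succ j ih =>
      intro k hk R
      obtain ⟨M₁, R₁, h₁⟩ := exists_reach_sum (Finset.univ.filter fun i => w i = k)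
        (z := fun i => b i) (fun i hi => h.isReachable (h.basis_mem (Finset.mem_filter.mp hi).2.ge))
        R
      obtain ⟨B, hB⟩ := h.exists_gauge_wordBall_le M₁ R₁
      obtain ⟨K, hK, hmul⟩ := h.exists_gauge_mul_le (max B R)
      obtain ⟨M₂, R₂, h₂⟩ := ih (k + 1) (by omega) (B + K * R)
      refine ⟨M₁ + M₂, max R₁ R₂, fun r hr g hg hgR => ?_⟩
      have hr' : (0 : ℝ) < r := by exact_mod_cast hr
      obtain ⟨q, hq, hqg⟩ := h₁ r hr
        -- Division by r^(k+1) normalises the weight-`k` coordinates to absolute value at most `R`,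
        -- by the gauge bound on `g`.
        (fun i => if w i = k then b.repr g.log i / (r : ℝ) ^ (k + 1) else 0) (fun i => by
          have hR := (apply_nonneg _ _).trans hgR
          split_ifs with hi
          · rw [abs_div, abs_of_pos (a := (r : ℝ) ^ (k + 1)) (by positivity),
              div_le_iff₀ (by positivity)]
            have := abs_repr_le_gauge (b := b) (w := w) hr g.log i
            rw [hi] at this
            refine this.trans ?_
            gcongr
          · simpa using hR)
      have hdiff : g.log - q.log ∈ lcs 𝔤 (k + 1) := by
        have h3 : g.log - ∑ i ∈ Finset.univ.filter (fun i => w i = k),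
            ((if w i = k then b.repr g.log i / (r : ℝ) ^ (k + 1) else 0) * (r : ℝ) ^ (k + 1)) • b i
            ∈ lcs 𝔤 (k + 1) := by
          classical
          rw [Finset.sum_filter, h]
          have e : ∀ i, (if w i = k then ((if w i = k then b.repr g.log i / (r : ℝ) ^ (k + 1) else 0)
              * (r : ℝ) ^ (k + 1)) • b i else 0) = (if w i = k then b.repr g.log i else 0) • b i := by
            intro i
            split_ifs
            · rw [div_mul_cancel₀ _ (by positivity)]
            · simp
          simp only [e]
          intro i hi
          rw [map_sub, Finsupp.sub_apply, b.repr_sum_self]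
          split_ifs with hik
          · rw [sub_self]
          · rw [(h k _).mp hg i (by omega), sub_zero]
        have := Submodule.sub_mem _ h3 hqg
        convert this using 1
        abel
      have hlog : (q⁻¹ * g).log ∈ lcs 𝔤 (k + 1) := by
        have h4 := bch_add_sub_mem hc hdiff (-q.log) q.log
        rw [add_sub_cancel, bch_neg_left hc, sub_zero] at h4
        have := Submodule.add_mem _ (lcs_succ_le 𝔤 (k + 1) h4) hdiff
        rwa [sub_add_cancel] at this
      have hqB : gauge b w r (q⁻¹).log ≤ B := by
        rw [ExpGroup.log_inv, map_neg_eq_map]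
        exact hB r hr q hq
      have h5 := hmul r hr q⁻¹ g (hqB.trans (le_max_left _ _)) (hgR.trans (le_max_right _ _))
      have h6 := h₂ r hr (q⁻¹ * g) hlog (h5.trans (by gcongr))
      have h7 := mul_mem_wordBall
        (wordBall_mono (n := M₁) (horizontal_mono (le_max_left R₁ R₂)) le_rfl hq)
        (wordBall_mono (n := M₂) (horizontal_mono (le_max_right R₁ R₂)) le_rfl h6)
      rwa [mul_inv_cancel_left] at h7
  obtain ⟨M, R', h'⟩ := key c 0 (zero_add c) R
  exact ⟨M, R', fun r hr g hg => h' r hr g trivial hg⟩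

/-- Products of `n` bounded elements have bounded gauge at a scale proportional to `n`. -/
theorem IsAdapted.exists_gauge_wordBall_le_one (h : IsAdapted b w) (ρ : ℝ) :
    ∃ A : ℕ, 1 ≤ A ∧ ∀ n : ℕ, 1 ≤ n →
      ∀ g ∈ wordBall {g : ExpGroup 𝔤 | gauge b w 1 g.log ≤ ρ} n, gauge b w (A * n) g.log ≤ 1 := by
  obtain ⟨K, hK, hmul⟩ := h.exists_gauge_mul_le 1
  -- With this `A`, a single letter has gauge at most 1/((K + 1) n) at scale A n, so each
  -- multiplication adds at most 1/n.
  obtain ⟨A, hA⟩ := exists_nat_ge ((K + 1) * max ρ 1)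
  have hA1 : (1 : ℝ) ≤ A := by
    refine le_trans ?_ hA
    nlinarith [le_max_right ρ 1]
  refine ⟨A, by exact_mod_cast hA1, fun n hn g hg => ?_⟩
  have hn' : (1 : ℝ) ≤ n := by exact_mod_cast hn
  have hr : 1 ≤ A * n := Nat.mul_pos (by exact_mod_cast hA1) hn
  obtain ⟨l, hl, hlS, rfl⟩ := hg
  have key : ∀ l : List (ExpGroup 𝔤), l.length ≤ n → (∀ s ∈ l, gauge b w 1 s.log ≤ ρ) →
      gauge b w (A * n) l.prod.log ≤ (l.length : ℝ) / n := by
    intro l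
    -- Letters are appended on the right, as the left factor is the one with coefficient 1. The
    -- partial bound length/n ≤ 1 keeps `hmul` applicable throughout.
    induction l using List.reverseRecOn with
    | nil =>
      intro _ _
      rw [List.prod_nil, ExpGroup.log_one, map_zero]
      simp
    | append_singleton l s ih =>
      intro hl hlS
      rw [List.length_append, List.length_singleton] at hl
      have ih' := ih (by omega) fun s hs => hlS s (by simp [hs])
      have hs := hlS s (by simp)
      have hs' : gauge b w (A * n) s.log ≤ max ρ 1 / (A * n) := by
        have := gauge_le_div (b := b) (w := w) (k := 0) hr (x := s.log) (fun i hi => by omega)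
        rw [zero_add, pow_one, Nat.cast_mul] at this
        refine this.trans ?_
        gcongr
        exact hs.trans (le_max_left _ _)
      have hle1 : (l.length : ℝ) / n ≤ 1 := by
        rw [div_le_one (by positivity)]
        exact_mod_cast (by omega : l.length ≤ n)
      have hs1 : (K + 1) * gauge b w (A * n) s.log ≤ 1 / n := by
        calc (K + 1) * gauge b w (A * n) s.log ≤ (K + 1) * (max ρ 1 / (A * n)) := by gcongr
          _ = ((K + 1) * max ρ 1) / A / n := by field_simp
          _ ≤ 1 / n := by
            gcongr
            rw [div_le_one (by positivity)]
            exact hA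
      have h0 := apply_nonneg (gauge b w (A * n)) s.log
      have hn1 : 1 / (n : ℝ) ≤ 1 := by
        rw [div_le_one (by positivity)]
        exact hn'
      have := hmul (A * n) hr l.prod s (ih'.trans hle1) (by nlinarith)
      rw [List.prod_append, List.prod_singleton, List.length_append, List.length_singleton,
        Nat.cast_add, Nat.cast_one, add_div]
      nlinarith
  refine (key l hl hlS).trans ?_
  rw [div_le_one (by positivity)]
  exact_mod_cast hl

end Reach

/-! ### The growth degree of a lattice is the homogeneous dimension -/

section Lattice

open MeasureTheory

variable {ι : Type*} [Fintype ι] {𝔤 : Type*} [LieRing 𝔤] [LieAlgebra ℝ 𝔤]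

theorem ExpGroup.continuous_coord (b : Module.Basis ι ℝ 𝔤) :
    Continuous fun g : ExpGroup 𝔤 => b.equivFun g.log := by
  let : TopologicalSpace 𝔤 := moduleTopology ℝ 𝔤
  have : IsModuleTopology ℝ 𝔤 := ⟨rfl⟩
  exact (IsModuleTopology.continuous_of_linearMap b.equivFun.toLinearMap).comp
    (ExpGroup.log_continuous 𝔤)

theorem ExpGroup.continuous_exp_coord (b : Module.Basis ι ℝ 𝔤) :
    Continuous fun u : ι → ℝ => ExpGroup.exp (b.equivFun.symm u) := by
  let : TopologicalSpace 𝔤 := moduleTopology ℝ 𝔤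
  have : IsModuleTopology ℝ 𝔤 := ⟨rfl⟩
  have : ContinuousAdd 𝔤 := IsModuleTopology.toContinuousAdd ℝ 𝔤
  exact (ExpGroup.exp_continuous 𝔤).comp
    (IsModuleTopology.continuous_of_linearMap b.equivFun.symm.toLinearMap)

theorem continuous_gauge_log (b : Module.Basis ι ℝ 𝔤) (w : ι → ℕ) :
    Continuous fun g : ExpGroup 𝔤 => gauge b w 1 g.log := by
  have h := continuous_pi_iff.mp (ExpGroup.continuous_coord b)
  simp only [Module.Basis.equivFun_apply] at h
  simp only [gauge_one]
  fun_prop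

variable [LieRing.IsNilpotent 𝔤]

/-- Translations are differentiable in coordinates. Their continuity makes the projection to the
coset space open, as the use of cocompactness requires. -/
instance [FiniteDimensional ℝ 𝔤] : SeparatelyContinuousMul (ExpGroup 𝔤) := by
  let b := Module.finBasis ℝ 𝔤
  have h := (ExpGroup.continuous_exp_coord b)
  have e : ∀ g : ExpGroup 𝔤, ExpGroup.exp (b.equivFun.symm (b.equivFun g.log)) = g := fun g =>
    ExpGroup.ext (b.equivFun.symm_apply_apply g.log)
  have hid : Differentiable ℝ fun u => b.equivFun (b.equivFun.symm u) := by
    simp only [LinearEquiv.apply_symm_apply]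
    exact differentiable_id
  have hc := ExpGroup.continuous_coord b
  constructor
  · intro a
    have h1 : Continuous fun u => b.equivFun (a * .exp (b.equivFun.symm u)).log :=
      (differentiable_bch b _ (f := fun _ => a.log) (g := b.equivFun.symm)
        (differentiable_const _) hid).continuous
    have h2 := h.comp (h1.comp hc)
    simpa only [Function.comp_def, e] using h2
  · intro a
    have h1 : Continuous fun u => b.equivFun (.exp (b.equivFun.symm u) * a).log :=
      (differentiable_bch b _ (f := b.equivFun.symm) (g := fun _ => a.log) hid
        (differentiable_const _)).continuous
    have h2 := h.comp (h1.comp hc)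
    simpa only [Function.comp_def, e] using h2

variable {b : Module.Basis ι ℝ 𝔤} {w : ι → ℕ}

theorem IsAdapted.exists_gauge_mul_le_const (h : IsAdapted b w) (R : ℝ) :
    ∃ B : ℝ, ∀ r : ℕ, 1 ≤ r → ∀ g k : ExpGroup 𝔤, gauge b w r g.log ≤ R →
      gauge b w r k.log ≤ R → gauge b w r (g * k).log ≤ B := by
  obtain ⟨K, hK, hmul⟩ := h.exists_gauge_mul_le R
  exact ⟨R + K * R, fun r hr g k hg hk => (hmul r hr g k hg hk).trans (by gcongr)⟩

theorem gauge_inv (r : ℕ) (g : ExpGroup 𝔤) : gauge b w r (g⁻¹).log = gauge b w r g.log := by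
  rw [ExpGroup.log_inv, map_neg_eq_map]

variable {Γ : Type*} [Group Γ] {φ : Γ →* ExpGroup 𝔤}

theorem IsMaltsevCompletion.exists_gauge_lt (hφ : IsMaltsevCompletion φ)
    (b : Module.Basis ι ℝ 𝔤) (w : ι → ℕ) :
    ∃ δ : ℝ, 0 < δ ∧ ∀ γ, gauge b w 1 (φ γ).log < δ → γ = 1 := by
  have := hφ.discrete
  obtain ⟨U, hU, hU1⟩ := isOpen_induced_iff.mp (isOpen_discrete ({1} : Set φ.range))
  have h1 : (fun u : ι → ℝ => ExpGroup.exp (b.equivFun.symm u)) 0 ∈ U := by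
    have : (1 : φ.range) ∈ Subtype.val ⁻¹' U := by rw [hU1]; rfl
    simp only [map_zero]
    exact this
  obtain ⟨δ, hδ, hball⟩ := Metric.isOpen_iff.mp (hU.preimage (ExpGroup.continuous_exp_coord b)) 0 h1
  refine ⟨δ, hδ, fun γ hγ => ?_⟩
  have hmem : b.equivFun (φ γ).log ∈ Metric.ball (0 : ι → ℝ) δ := by
    rw [mem_ball_zero_iff, pi_norm_lt_iff hδ]
    intro i
    refine lt_of_le_of_lt ?_ hγ
    simpa using abs_repr_le_gauge (b := b) (w := w) le_rfl (φ γ).log i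
  have h2 := hball hmem
  simp only [Set.mem_preimage, LinearEquiv.symm_apply_apply] at h2
  have h3 : (⟨φ γ, γ, rfl⟩ : φ.range) ∈ Subtype.val ⁻¹' U := h2
  rw [hU1, Set.mem_singleton_iff, Subtype.ext_iff] at h3
  exact hφ.injective (h3.trans φ.map_one.symm)

/-- The images of the open gauge balls form an increasing open cover of the compact coset space, so
one ball already meets every coset. -/
theorem IsMaltsevCompletion.exists_eq_mul (hφ : IsMaltsevCompletion φ) [FiniteDimensional ℝ 𝔤]
    (b : Module.Basis ι ℝ 𝔤) (w : ι → ℕ) :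
    ∃ κ : ℝ, ∀ g, ∃ γ k, gauge b w 1 k.log ≤ κ ∧ g = φ γ * k := by
  have := hφ.cocompact
  let V : ℕ → Set (ExpGroup 𝔤 ⧸ φ.range) := fun n =>
    (QuotientGroup.mk '' {g : ExpGroup 𝔤 | gauge b w 1 g.log < n})
  have hV : ∀ n, IsOpen (V n) := fun n =>
    QuotientGroup.isOpenMap_coe _ (isOpen_lt (continuous_gauge_log b w) continuous_const)
  have hmono : Monotone V := by
    intro m n hmn
    refine Set.image_mono fun g hg => ?_
    have hmn' : (m : ℝ) ≤ n := by exact_mod_cast hmn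
    exact lt_of_lt_of_le (show gauge b w 1 g.log < m from hg) hmn'
  obtain ⟨n, hn⟩ := isCompact_univ.elim_directed_cover V hV (fun q _ => by
    obtain ⟨g, rfl⟩ := QuotientGroup.mk_surjective q
    obtain ⟨n, hn⟩ := exists_nat_gt (gauge b w 1 g.log)
    exact Set.mem_iUnion.mpr ⟨n, g, hn, rfl⟩) hmono.directed_le
  refine ⟨n, fun g => ?_⟩
  -- The quotient consists of cosets with the lattice on the right; passing to `g⁻¹` puts the
  -- lattice element on the left.
  obtain ⟨k, hk, hkg⟩ := hn (Set.mem_univ (QuotientGroup.mk g⁻¹))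
  obtain ⟨γ, hγ⟩ := QuotientGroup.eq.mp hkg
  refine ⟨γ⁻¹, k⁻¹, ?_, ?_⟩
  · rw [gauge_inv]
    exact le_of_lt hk
  · rw [map_inv, hγ]
    group

/-- Packing: discreteness makes the lattice translates of a small cube disjoint, they all have the
volume of the cube, and they lie in a box with sides proportional to r^(w i + 1). -/
theorem IsAdapted.exists_card_le (h : IsAdapted b w) (hφ : IsMaltsevCompletion φ) (R : ℝ) :
    ∃ C : ℕ, ∀ r : ℕ, 1 ≤ r → ∀ T : Finset Γ, (∀ γ ∈ T, gauge b w r (φ γ).log ≤ R) →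
      T.card ≤ C * r ^ homogeneousDim 𝔤 := by
  obtain ⟨δ, hδ, hδ1⟩ := hφ.exists_gauge_lt b w
  obtain ⟨K, hK, hmul⟩ := h.exists_gauge_mul_le 1
  obtain ⟨B, hB⟩ := h.exists_gauge_mul_le_const (max R 1)
  -- The cube of half-side ε must be so small that a quotient of two of its elements has gauge below
  -- δ, where the identity is the only lattice element.
  obtain ⟨ε, hε, hε1, hεδ⟩ : ∃ ε : ℝ, 0 < ε ∧ Fintype.card ι * ε ≤ 1 ∧
      Fintype.card ι * ε + K * (Fintype.card ι * ε) < δ := by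
    refine ⟨min 1 δ / ((1 + K) * (Fintype.card ι + 1)), by positivity, ?_, ?_⟩
    · rw [← mul_div_assoc, div_le_one (by positivity)]
      have h1 := min_le_left 1 δ
      have h2 : (0 : ℝ) ≤ Fintype.card ι := by positivity
      nlinarith
    · rw [← one_add_mul, ← mul_div_assoc, ← mul_div_assoc, div_lt_iff₀ (by positivity)]
      have h1 := min_le_right 1 δ
      have h2 : (0 : ℝ) ≤ Fintype.card ι := by positivity
      have h3 : (1 + K) * (Fintype.card ι * min 1 δ) ≤ (1 + K) * (Fintype.card ι * δ) := by gcongr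
      nlinarith
  let U : Set (ι → ℝ) := Set.Icc (fun _ => -ε) (fun _ => ε)
  have hUg : ∀ u ∈ U, gauge b w 1 (b.equivFun.symm u) ≤ Fintype.card ι * ε := by
    intro u hu
    rw [gauge_one]
    have : ∀ i ∈ Finset.univ, |b.repr (b.equivFun.symm u) i| ≤ ε := by
      intro i _
      have e : b.repr (b.equivFun.symm u) i = u i := congrFun (b.equivFun.apply_symm_apply u) i
      rw [e, abs_le]
      exact ⟨hu.1 i, hu.2 i⟩
    simpa using Finset.sum_le_card_nsmul _ _ _ this
  have hUvol : volume U = ENNReal.ofReal ((2 * ε) ^ Fintype.card ι) := by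
    rw [Real.volume_Icc_pi]
    simp only [sub_neg_eq_add, ← two_mul]
    rw [Finset.prod_const, ← ENNReal.ofReal_pow (by positivity), Finset.card_univ]
  have hdisj : ∀ γ γ' : Γ, γ ≠ γ' →
      Disjoint (leftMul b (φ γ) '' U) (leftMul b (φ γ') '' U) := by
    intro γ γ' hne
    rw [Set.disjoint_left]
    rintro _ ⟨u, hu, rfl⟩ ⟨u', hu', heq⟩
    have h1 : φ γ' * .exp (b.equivFun.symm u') = φ γ * .exp (b.equivFun.symm u) :=
      ExpGroup.ext (b.equivFun.injective heq)
    have h2 : φ (γ⁻¹ * γ') = .exp (b.equivFun.symm u) * (.exp (b.equivFun.symm u'))⁻¹ := by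
      rw [map_mul, map_inv, eq_mul_inv_iff_mul_eq, mul_assoc, h1, inv_mul_cancel_left]
    have h3 := hmul 1 le_rfl (.exp (b.equivFun.symm u)) (.exp (b.equivFun.symm u'))⁻¹
      ((hUg u hu).trans hε1) (by rw [gauge_inv]; exact (hUg u' hu').trans hε1)
    rw [gauge_inv, ← h2] at h3
    have h4 := hδ1 (γ⁻¹ * γ') (h3.trans_lt (lt_of_le_of_lt (by
      gcongr
      · exact hUg u hu
      · exact hUg u' hu') hεδ))
    exact hne (inv_mul_eq_one.mp h4)
  have hUmeas : ∀ γ : Γ, MeasurableSet (leftMul b (φ γ) '' U) := fun γ =>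
    (isCompact_Icc.image (differentiable_leftMul (φ γ)).continuous).measurableSet
  obtain ⟨C, hC⟩ := exists_nat_ge ((2 * max B 0) ^ Fintype.card ι / (2 * ε) ^ Fintype.card ι)
  refine ⟨C, fun r hr T hT => ?_⟩
  have hr' : (1 : ℝ) ≤ r := by exact_mod_cast hr
  have hsub : (⋃ γ ∈ T, leftMul b (φ γ) '' U) ⊆
      Set.Icc (fun i => -(max B 0 * (r : ℝ) ^ (w i + 1)))
        (fun i => max B 0 * (r : ℝ) ^ (w i + 1)) := by
    refine Set.iUnion₂_subset fun γ hγ => ?_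
    rintro _ ⟨u, hu, rfl⟩
    have h1 : gauge b w r (b.equivFun.symm u) ≤ 1 := by
      refine (gauge_le_div (k := 0) hr (fun i hi => by omega)).trans ?_
      rw [div_le_one (by positivity)]
      exact ((hUg u hu).trans hε1).trans (by simpa using hr')
    have h2 := hB r hr (φ γ) (.exp (b.equivFun.symm u)) ((hT γ hγ).trans (le_max_left _ _))
      (h1.trans (le_max_right _ _))
    have h3 : ∀ i, |leftMul b (φ γ) u i| ≤ max B 0 * (r : ℝ) ^ (w i + 1) := fun i =>
      (abs_repr_le_gauge hr _ i).trans (by gcongr; exact h2.trans (le_max_left _ _))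
    exact ⟨fun i => (abs_le.mp (h3 i)).1, fun i => (abs_le.mp (h3 i)).2⟩
  have hvol := measure_mono (μ := volume) hsub
  rw [measure_biUnion_finset (fun γ _ γ' _ hne => hdisj γ γ' hne) (fun γ _ => hUmeas γ)] at hvol
  simp only [h.volume_leftMul_image (φ _) (s := U) measurableSet_Icc, hUvol, Finset.sum_const,
    Real.volume_Icc_pi, sub_neg_eq_add, ← two_mul] at hvol
  rw [← ENNReal.ofReal_prod_of_nonneg (fun i _ => by positivity), nsmul_eq_mul,
    ← ENNReal.ofReal_natCast, ← ENNReal.ofReal_mul (by positivity),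
    ENNReal.ofReal_le_ofReal_iff (Finset.prod_nonneg fun i _ => by positivity)] at hvol
  simp only [← mul_assoc] at hvol
  rw [Finset.prod_mul_distrib, Finset.prod_const, Finset.card_univ, Finset.prod_pow_eq_pow_sum,
    ← h.homogeneousDim_eq] at hvol
  have : (T.card : ℝ) ≤ C * (r : ℝ) ^ homogeneousDim 𝔤 := by
    refine le_trans ?_ (mul_le_mul_of_nonneg_right hC (by positivity))
    rw [div_mul_eq_mul_div, le_div_iff₀ (by positivity)]
    exact hvol
  exact_mod_cast this

/-- The Bass–Guivarc'h formula. The generating set consists of the lattice elements of gauge at most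
ρ, a finite set by the packing bound. -/
theorem IsAdapted.hasGrowthDegree (h : IsAdapted b w) (hφ : IsMaltsevCompletion φ)
    [FiniteDimensional ℝ 𝔤] : HasGrowthDegree Γ (homogeneousDim 𝔤) := by
  obtain ⟨κ, hκ⟩ := hφ.exists_eq_mul b w
  -- The bound `card ι` is needed for the box, each coordinate contributing at most 1; the extra 1
  -- serves the proof of generation, also when ι is empty.
  obtain ⟨M, R, hM⟩ := h.exists_subset_wordBall_horizontal (Fintype.card ι + 1)
  obtain ⟨B, hB⟩ := h.exists_gauge_mul_le_const (max κ R)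
  obtain ⟨ρ', hρ'⟩ := h.exists_gauge_mul_le_const (max B κ)
  -- ρ' bounds the lattice steps k q k'⁻¹ in the coarse tracking of a product, and κ bounds the
  -- final remainder when it is itself a lattice element.
  set ρ := max ρ' κ with hρ
  have hfin : {γ : Γ | gauge b w 1 (φ γ).log ≤ ρ}.Finite := by
    obtain ⟨C, hC⟩ := h.exists_card_le hφ ρ
    by_contra hinf
    obtain ⟨T, hT, hcard⟩ := Set.Infinite.exists_subset_card_eq hinf (C + 1)
    have := hC 1 le_rfl T fun γ hγ => hT hγ
    rw [one_pow, mul_one] at this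
    omega
  have hκ0 : 0 ≤ κ := by
    obtain ⟨γ, k, hk, -⟩ := hκ 1
    exact (apply_nonneg _ _).trans hk
  -- A path with horizontal steps is shadowed by a lattice path of the same length: at each step the
  -- remainder times the new letter is brought back to gauge at most κ.
  have coarse : ∀ l : List (ExpGroup 𝔤), (∀ q ∈ l, q ∈ horizontal b w 1 R) →
      ∃ γ ∈ wordBall {γ : Γ | gauge b w 1 (φ γ).log ≤ ρ} l.length,
        ∃ k : ExpGroup 𝔤, gauge b w 1 k.log ≤ κ ∧ l.prod = φ γ * k := by
    intro l
    induction l using List.reverseRecOn with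
    | nil =>
      intro _
      refine ⟨1, one_mem_wordBall, 1, ?_, by simp⟩
      rw [ExpGroup.log_one, map_zero]
      exact hκ0
    | append_singleton l q ih =>
      intro hl
      obtain ⟨γ, hγ, k, hk, hlk⟩ := ih fun q hq => hl q (by simp [hq])
      obtain ⟨γ', k', hk', hkq⟩ := hκ (k * q)
      refine ⟨γ * γ', ?_, k', hk', ?_⟩
      · rw [List.length_append, List.length_singleton]
        refine mul_mem_wordBall hγ (mem_wordBall_one ?_)
        have e : φ γ' = k * q * k'⁻¹ := by rw [hkq]; group
        have h1 := hB 1 le_rfl k q (hk.trans (le_max_left _ _))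
          ((hl q (by simp)).2.trans (le_max_right _ _))
        have h2 := hρ' 1 le_rfl (k * q) k'⁻¹ (h1.trans (le_max_left _ _))
          (by rw [gauge_inv]; exact hk'.trans (le_max_right _ _))
        rw [← e] at h2
        exact h2.trans (le_max_left _ _)
      · rw [List.prod_append, List.prod_singleton, hlk, map_mul, mul_assoc, hkq, mul_assoc]
  have cover : ∀ r : ℕ, 1 ≤ r → ∀ g : ExpGroup 𝔤, gauge b w r g.log ≤ Fintype.card ι + 1 →
      ∃ γ ∈ wordBall {γ : Γ | gauge b w 1 (φ γ).log ≤ ρ} (r * M),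
        ∃ k : ExpGroup 𝔤, gauge b w 1 k.log ≤ κ ∧ g = φ γ * k := by
    intro r hr g hg
    obtain ⟨l, hl, hlS, rfl⟩ := wordBall_subset_wordBall_mul (horizontal_subset_wordBall hr R)
      (hM r hr g hg)
    obtain ⟨γ, hγ, hk⟩ := coarse l hlS
    exact ⟨γ, wordBall_mono subset_rfl hl hγ, hk⟩
  have hcoe : (hfin.toFinset : Set Γ) = {γ : Γ | gauge b w 1 (φ γ).log ≤ ρ} := hfin.coe_toFinset
  refine ⟨hfin.toFinset, fun γ hγ => ?_, ?_, ?_, ?_⟩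
  · rw [Set.Finite.mem_toFinset] at hγ ⊢
    change gauge b w 1 (φ γ⁻¹).log ≤ ρ
    rw [map_inv, gauge_inv]
    exact hγ
  · rw [hcoe, eq_top_iff]
    intro γ _
    -- At a large enough scale the given lattice element has gauge at most 1, hence it is covered;
    -- the remainder is then a lattice element and belongs to the generating set.
    obtain ⟨r, hr⟩ := exists_nat_ge (max 1 (gauge b w 1 (φ γ).log))
    have hr1 : (1 : ℝ) ≤ r := (le_max_left _ _).trans hr
    have hr1' : 1 ≤ r := by exact_mod_cast hr1
    obtain ⟨γ', hγ', k, hk, hγk⟩ := cover r hr1' (φ γ) (by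
      refine (gauge_le_div (k := 0) hr1' (fun i hi => by omega)).trans ?_
      have h1 : gauge b w 1 (φ γ).log / (r : ℝ) ^ (0 + 1) ≤ 1 := by
        rw [zero_add, pow_one, div_le_one (by positivity)]
        exact (le_max_right _ _).trans hr
      have h2 : (0 : ℝ) ≤ Fintype.card ι := by positivity
      linarith)
    have hk' : k = φ (γ'⁻¹ * γ) := by rw [map_mul, map_inv, hγk, inv_mul_cancel_left]
    have hmem : γ'⁻¹ * γ ∈ Subgroup.closure {γ : Γ | gauge b w 1 (φ γ).log ≤ ρ} := by
      refine Subgroup.subset_closure ?_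
      change gauge b w 1 (φ (γ'⁻¹ * γ)).log ≤ ρ
      rw [← hk']
      exact hk.trans (le_max_right _ _)
    have hmem' : γ' ∈ Subgroup.closure {γ : Γ | gauge b w 1 (φ γ).log ≤ ρ} := by
      obtain ⟨l, -, hl, rfl⟩ := hγ'
      exact Subgroup.list_prod_mem _ fun s hs => Subgroup.subset_closure (hl s hs)
    have := mul_mem hmem' hmem
    rwa [mul_inv_cancel_left] at this
  · rw [hcoe]
    obtain ⟨A, hA, hAn⟩ := h.exists_gauge_wordBall_le_one ρ
    obtain ⟨C, hC⟩ := h.exists_card_le hφ 1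
    -- `Dominated` uses the same constant outside and inside the function, so the sum of the two
    -- constants is taken.
    refine ⟨C + A, by omega, fun n hn => ?_⟩
    have hwf := finite_wordBall hfin n
    calc (wordBall {γ : Γ | gauge b w 1 (φ γ).log ≤ ρ} n).ncard
        = hwf.toFinset.card := Set.ncard_eq_toFinset_card _ hwf
      _ ≤ C * (A * n) ^ homogeneousDim 𝔤 := by
        refine hC (A * n) (Nat.mul_pos hA hn) _ fun γ hγ => hAn n hn _ ?_
        rw [Set.Finite.mem_toFinset] at hγ
        obtain ⟨l, hl, hlS, rfl⟩ := hγ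
        refine ⟨l.map φ, by simpa using hl, fun s hs => ?_, (map_list_prod φ l).symm⟩
        obtain ⟨t, ht, rfl⟩ := List.mem_map.mp hs
        exact hlS t ht
      _ ≤ (C + A) * ((C + A) * n) ^ homogeneousDim 𝔤 := by
        gcongr <;> omega
  · rw [hcoe]
    set κ' := max κ 1 with hκ'
    have hκ'0 : 0 < κ' := lt_of_lt_of_le one_pos (le_max_right _ _)
    obtain ⟨C, hC⟩ := exists_nat_ge (max 1 (κ' ^ Fintype.card ι))
    have hC1 : (1 : ℝ) ≤ C := (le_max_left _ _).trans hC
    have hC1' : 1 ≤ C := by exact_mod_cast hC1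
    refine ⟨C + M, by omega, fun n hn => ?_⟩
    have hwf := finite_wordBall hfin (n * M)
    have hn' : (0 : ℝ) < n := by exact_mod_cast hn
    -- The box at scale `n` is covered by translates of a fixed cube by the word ball of radius n M;
    -- comparing volumes bounds the size of that ball from below.
    have hsub : Set.Icc (fun i => -((n : ℝ) ^ (w i + 1))) (fun i => (n : ℝ) ^ (w i + 1)) ⊆
        ⋃ γ ∈ hwf.toFinset, leftMul b (φ γ) '' Set.Icc (fun _ => -κ') (fun _ => κ') := by
      intro u hu
      have hg : gauge b w n (b.equivFun.symm u) ≤ Fintype.card ι + 1 := by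
        rw [gauge_apply]
        have : ∀ i ∈ Finset.univ, |b.repr (b.equivFun.symm u) i| / (n : ℝ) ^ (w i + 1) ≤ 1 := by
          intro i _
          have e : b.repr (b.equivFun.symm u) i = u i :=
            congrFun (b.equivFun.apply_symm_apply u) i
          rw [e, div_le_one (by positivity), abs_le]
          exact ⟨hu.1 i, hu.2 i⟩
        have := Finset.sum_le_card_nsmul _ _ _ this
        rw [Finset.card_univ, nsmul_eq_mul, mul_one] at this
        linarith
      obtain ⟨γ, hγ, k, hk, hgk⟩ := cover n hn (.exp (b.equivFun.symm u)) hg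
      refine Set.mem_iUnion₂.mpr ⟨γ, (Set.Finite.mem_toFinset _).mpr hγ, b.equivFun k.log, ?_, ?_⟩
      · have h1 : ∀ i, |b.equivFun k.log i| ≤ κ' := by
          intro i
          have := abs_repr_le_gauge (b := b) (w := w) le_rfl k.log i
          rw [Nat.cast_one, one_pow, mul_one] at this
          exact (this.trans hk).trans (le_max_left _ _)
        exact ⟨fun i => (abs_le.mp (h1 i)).1, fun i => (abs_le.mp (h1 i)).2⟩
      · have e : (ExpGroup.exp (b.equivFun.symm (b.equivFun k.log)) : ExpGroup 𝔤) = k :=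
          ExpGroup.ext (b.equivFun.symm_apply_apply _)
        rw [leftMul, e, ← hgk]
        exact b.equivFun.apply_symm_apply u
    have hvol := (measure_mono (μ := volume) hsub).trans (measure_biUnion_finset_le _ _)
    simp only [h.volume_leftMul_image (φ _) (s := Set.Icc (fun _ => -κ') (fun _ => κ'))
      measurableSet_Icc, Finset.sum_const, Real.volume_Icc_pi, sub_neg_eq_add, ← two_mul] at hvol
    rw [← ENNReal.ofReal_prod_of_nonneg (fun i _ => by positivity),
      ← ENNReal.ofReal_prod_of_nonneg (fun i _ => by positivity), nsmul_eq_mul,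
      ← ENNReal.ofReal_natCast, ← ENNReal.ofReal_mul (by positivity),
      ENNReal.ofReal_le_ofReal_iff (by positivity), Finset.prod_mul_distrib, Finset.prod_const,
      Finset.prod_pow_eq_pow_sum, ← h.homogeneousDim_eq, Finset.prod_const, Finset.card_univ,
      mul_pow, mul_left_comm] at hvol
    have hvol' := le_of_mul_le_mul_left hvol (by positivity)
    have hreal : ((n ^ homogeneousDim 𝔤 : ℕ) : ℝ) ≤ ((C * hwf.toFinset.card : ℕ) : ℝ) := by
      push_cast
      refine hvol'.trans ?_
      rw [mul_comm]
      gcongr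
      exact (le_max_right _ _).trans hC
    calc n ^ homogeneousDim 𝔤 ≤ C * hwf.toFinset.card := by exact_mod_cast hreal
      _ = C * (wordBall {γ : Γ | gauge b w 1 (φ γ).log ≤ ρ} (n * M)).ncard := by
        rw [Set.ncard_eq_toFinset_card _ hwf]
      _ ≤ (C + M) * (wordBall {γ : Γ | gauge b w 1 (φ γ).log ≤ ρ} ((C + M) * n)).ncard := by
        refine Nat.mul_le_mul (Nat.le_add_right _ _)
          (Set.ncard_le_ncard (wordBall_mono subset_rfl ?_) (finite_wordBall hfin _))
        rw [mul_comm n M]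
        exact Nat.mul_le_mul_right n (Nat.le_add_left _ _)

theorem IsMaltsevCompletion.growthDegree_eq [FiniteDimensional ℝ 𝔤]
    (hφ : IsMaltsevCompletion φ) : growthDegree Γ = homogeneousDim 𝔤 := by
  obtain ⟨n, b, w, h⟩ := exists_isAdapted 𝔤
  exact (h.hasGrowthDegree hφ).growthDegree_eq

end Lattice

/-! ### Conclusion -/

section Final

theorem homogeneousDim_grLie {𝔤 : Type*} [LieRing 𝔤] [LieAlgebra ℝ 𝔤] [LieRing.IsNilpotent 𝔤] :
    homogeneousDim (GrLie 𝔤) = homogeneousDim 𝔤 := by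
  simp only [homogeneousDim, finrank_lcs_grLie]

/-- The isomorphism of topological groups with a given bijective differential. -/
theorem exists_continuousMulEquiv {L M : Type*} [LieRing L] [LieAlgebra ℝ L]
    [LieRing.IsNilpotent L] [LieRing M] [LieAlgebra ℝ M] [LieRing.IsNilpotent M]
    (F : ExpGroup L →* ExpGroup M) (hF : Continuous F) (f : L ≃ₗ⁅ℝ⁆ M)
    (hf : ∀ x, F (.exp x) = .exp (f x)) : ∃ Φ : ExpGroup L ≃ₜ* ExpGroup M, ∀ a, Φ a = F a := by
  let : TopologicalSpace L := moduleTopology ℝ L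
  have : IsModuleTopology ℝ L := ⟨rfl⟩
  let : TopologicalSpace M := moduleTopology ℝ M
  have : IsModuleTopology ℝ M := ⟨rfl⟩
  have : ContinuousAdd L := IsModuleTopology.toContinuousAdd ℝ L
  let g : ExpGroup M → ExpGroup L := fun a => .exp (f.symm a.log)
  have hg : Continuous g := (ExpGroup.exp_continuous L).comp
    ((IsModuleTopology.continuous_of_linearMap
      (f.toLinearEquiv.symm : M →ₗ[ℝ] L)).comp (ExpGroup.log_continuous M))
  exact ⟨{ toFun := F
           invFun := g
           left_inv := fun a => by
             have := hf a.log
             exact ExpGroup.ext ((congrArg (fun a => f.symm a.log) this).trans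
               (f.symm_apply_apply a.log))
           right_inv := fun a => (hf _).trans (ExpGroup.ext (f.apply_symm_apply a.log))
           map_mul' := F.map_mul
           continuous_toFun := hF
           continuous_invFun := hg }, fun _ => rfl⟩

end Final

end Carnot

theorem mainTheorem3
    {Γ Δ : Type*} [Group Γ] [Group Δ] [Group.FG Γ] [Group.FG Δ]
    [Group.IsNilpotent Γ] [Group.IsNilpotent Δ]
    (hΓ : ∀ x : Γ, x ≠ 1 → ¬ IsOfFinOrder x) (hΔ : ∀ x : Δ, x ≠ 1 → ¬ IsOfFinOrder x)
    (hd : Carnot.growthDegree Γ = Carnot.growthDegree Δ)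
    {𝔤 𝔥 : Type*} [LieRing 𝔤] [LieAlgebra ℝ 𝔤] [FiniteDimensional ℝ 𝔤] [LieRing.IsNilpotent 𝔤]
    [LieRing 𝔥] [LieAlgebra ℝ 𝔥] [FiniteDimensional ℝ 𝔥] [LieRing.IsNilpotent 𝔥]
    (ι : Γ →* Carnot.ExpGroup 𝔤) (hι : Carnot.IsMaltsevCompletion ι)
    (κ : Δ →* Carnot.ExpGroup 𝔥) (hκ : Carnot.IsMaltsevCompletion κ)
    (F : Carnot.CarnotCompletion 𝔤 →* Carnot.CarnotCompletion 𝔥)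
    (hFc : Continuous F) (hF : Function.Surjective F) :
    Nonempty (Carnot.CarnotCompletion 𝔤 ≃ₜ* Carnot.CarnotCompletion 𝔥) ∧
    (∃ Φ : Carnot.CarnotCompletion 𝔤 ≃ₜ* Carnot.CarnotCompletion 𝔥, ∀ a, Φ a = F a) ∧
    ∃ dF : Carnot.GrLie 𝔤 ≃ₗ⁅ℝ⁆ Carnot.GrLie 𝔥,
      ∀ X : Carnot.GrLie 𝔤, F (Carnot.ExpGroup.exp X) = Carnot.ExpGroup.exp (dF X) := by
  obtain ⟨f, hf⟩ := Carnot.exists_differential F hFc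
  have hsurj : Function.Surjective f := fun y => by
    obtain ⟨a, ha⟩ := hF (.exp y)
    exact ⟨a.log, congrArg Carnot.ExpGroup.log ((hf a.log).symm.trans ha)⟩
  -- Equality of growth degrees enters only here, through the Bass–Guivarc'h formula on both sides.
  have hdim : Carnot.homogeneousDim (Carnot.GrLie 𝔤) = Carnot.homogeneousDim (Carnot.GrLie 𝔥) := by
    rw [Carnot.homogeneousDim_grLie, Carnot.homogeneousDim_grLie, ← hι.growthDegree_eq, hd,
      hκ.growthDegree_eq]
  have hinj := Carnot.injective_of_surjective_of_homogeneousDim_eq f hsurj hdim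
  let dF : Carnot.GrLie 𝔤 ≃ₗ⁅ℝ⁆ Carnot.GrLie 𝔥 := LieEquiv.ofBijective f ⟨hinj, hsurj⟩
  obtain ⟨Φ, hΦ⟩ := Carnot.exists_continuousMulEquiv F hFc dF hf
  exact ⟨⟨Φ⟩, ⟨Φ, hΦ⟩, dF, hf⟩
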